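/- Let $\tilde B$ be an $(n+m)\times n$ integer matrix whose top $n\times n$ part $B$ is skew-symmetric. Write $\vec\Gamma$ for the directed graph on $[n]=\{1,\dots,n\}$ with an edge $i\to j$ whenever $\tilde B_{ij}>0$, and $\Gamma$ for its underlying undirected graph. Assume that $\vec\Gamma$ has no oriented cycles and that $\tilde B$ has rank $n$. For an extended exchange matrix, the cluster algebra $A(\tilde B)$ is the $\mathbb{C}$-subalgebra of $\mathbb{C}(x_1,\dots,x_{n+m})$ generated by all cluster variables obtained by iterated mutation from the initial seed $((x_1,\dots,x_{n+m}),\tilde B)$, together with the inverses of the frozen variables $x_{n+1},\dots,x_{n+m}$; the cluster variety is $\mathcal{A}=\operatorname{Spec}A(\tilde B)$. Let $I\subseteq[n]$ be an anticlique of $\Gamma$ (no two elements of $I$ are adjacent) with $k$ elements, and let $\mathcal{O}_I\subseteq\mathcal{A}$ be the locally closed subvariety where $x_i=0$ for $i\in I$ and $x_i\neq0$ for $i\in[n]\setminus I$. Let $\tilde B_I$ be the matrix formed by the columns of $\tilde B$ indexed by $I$, where the variables $x_j$ with $j\in[n]\setminus I$ are relabelled as frozen, and put $$X^*(I)=(\tilde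 B_I\mathbb{Q}^I\cap\mathbb{Z}^{n+m})/\tilde B_I\mathbb{Z}^I .$$ Let $\mathrm{Aut}(A(\tilde B_I))$ be the group of $\mathbb{C}$-algebra automorphisms $\phi$ of $A(\tilde B_I)$ that multiply each cluster variable by a nonzero scalar. Via $\phi\mapsto(\zeta_1,\dots,\zeta_{n+m})$, where $\phi(x_r)=\zeta_r x_r$, $\mathrm{Aut}(A(\tilde B_I))$ maps injectively to the torus $(\mathbb{C}^*)^{n+m}$. Let $\mathrm{Aut}_0(A(\tilde B_I))\subseteq\mathrm{Aut}(A(\tilde B_I))$ be the subgroup of those $\phi$ with $\phi(x_i)=x_i$ for all $i\in I$. Then $\mathrm{Aut}(A(\tilde B_I))$ and $\mathrm{Aut}_0(A(\tilde B_I))$ are Zariski closed in $(\mathbb{C}^*)^{n+m}$, and are regarded as varieties in this way. Moreover $2k\le n+m$, and there are isomorphisms of varieties over $\mathbb{C}$ $$\mathcal{O}_I\;\simeq\;\mathbb{A}^k\times\mathrm{Aut}_0(A(\tilde B_I))\;\simeq\;\mathbb{A}^k\times\mathbb{G}_m^{\,n+m-2k}\times C,$$ where $C$ is a finite set that is a torsor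 under the group $\mathrm{Hom}(X^*(I),\mathbb{C}^*)$. For the full group one has $$\mathbb{G}_m^{\,k}\times\mathcal{O}_I\;\simeq\;\mathbb{A}^k\times\mathrm{Aut}(A(\tilde B_I)).$$ -/

import Mathlib

open CategoryTheory CategoryTheory.Limits AlgebraicGeometry

noncomputable section

/-- An extended exchange matrix.  The rows are indexed by `E` (all variables), the columns by `N`
(the mutable variables), and `ι : N ↪ E` says which rows belong to mutable variables; the square
submatrix on the mutable rows is skew-symmetric.  For the usual `(n+m) × n` matrices,
`N = Fin n`, `E = Fin (n+m)` and `ι` is the inclusion of the first `n` indices. -/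
structure ExtendedExchangeMatrix {E N : Type} (ι : N ↪ E) where
  mat : Matrix E N ℤ
  skew : ∀ i j : N, mat (ι i) j = -mat (ι j) i

namespace ExtendedExchangeMatrix

variable {E N : Type} {ι : N ↪ E}

/-- The directed graph on the mutable indices: there is an edge `i → j` whenever `B i j > 0`. -/
def Arrow (B : ExtendedExchangeMatrix ι) (i j : N) : Prop := 0 < B.mat (ι i) j

/-- The directed graph has no oriented cycle. -/
def IsAcyclic (B : ExtendedExchangeMatrix ι) : Prop := ∀ i : N, ¬ Relation.TransGen B.Arrow i i

/-- The undirected graph underlying the directed graph. -/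
def undirectedGraph (B : ExtendedExchangeMatrix ι) : SimpleGraph N := SimpleGraph.fromRel B.Arrow

/-- The rank of the matrix is its number of columns. -/
def IsFullRank [Fintype N] (B : ExtendedExchangeMatrix ι) : Prop :=
  (B.mat.map (Int.cast : ℤ → ℚ)).rank = Fintype.card N

open Classical in
/-- Mutation of an extended exchange matrix in the direction `k`. -/
def mutate (B : ExtendedExchangeMatrix ι) (k : N) : ExtendedExchangeMatrix ι where
  mat := fun i j =>
    if i = ι k ∨ j = k then -B.mat i j
    else B.mat i j + max (B.mat i k) 0 * max (B.mat (ι k) j) 0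
      - min (B.mat i k) 0 * min (B.mat (ι k) j) 0
  skew := by
    intro i j
    have hij := B.skew i j
    have hik := B.skew i k
    have hjk := B.skew k j
    by_cases h1 : i = k
    · simp [h1, hjk]
    · by_cases h2 : j = k
      · simp [h2, hik]
      · simp only [EmbeddingLike.apply_eq_iff_eq, h1, h2, or_self, if_false]
        rw [hij, hik, hjk]
        have hmax : ∀ a : ℤ, max (-a) 0 = -min a 0 := fun a => by omega
        have hmin : ∀ a : ℤ, min (-a) 0 = -max a 0 := fun a => by omega
        rw [hmax, hmax, hmin, hmin]
        ring

/-- `B_I`: keep only the columns indexed by `I`; the rows not in `I` become frozen. -/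
def restrict (B : ExtendedExchangeMatrix ι) (I : Finset N) :
    ExtendedExchangeMatrix ((Function.Embedding.subtype (· ∈ I)).trans ι) where
  mat := B.mat.submatrix id Subtype.val
  skew := fun i j => B.skew i.1 j.1

end ExtendedExchangeMatrix

/-- The ambient field `ℂ(t_e : e ∈ E)`. -/
abbrev AmbientField (E : Type) : Type := FractionRing (MvPolynomial E ℂ)

/-- A cluster in the ambient field together with an extended exchange matrix. -/
structure ClusterSeed {E N : Type} (ι : N ↪ E) where
  x : E → AmbientField E
  B : ExtendedExchangeMatrix ι

open Classical in
/-- Mutation of a seed in the direction `k`. -/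
def ClusterSeed.mutate {E N : Type} [Fintype E] {ι : N ↪ E} (s : ClusterSeed ι) (k : N) :
    ClusterSeed ι where
  x := Function.update s.x (ι k)
    ((∏ i, s.x i ^ (s.B.mat i k).toNat + ∏ i, s.x i ^ (-s.B.mat i k).toNat) / s.x (ι k))
  B := s.B.mutate k

namespace ExtendedExchangeMatrix

variable {E N : Type} [Fintype E] {ι : N ↪ E} (B : ExtendedExchangeMatrix ι)

/-- The initial seed: its cluster consists of the variables `t_e`, which generate the
ambient field. -/
def initialSeed : ClusterSeed ι where
  x := fun e => algebraMap (MvPolynomial E ℂ) (AmbientField E) (MvPolynomial.X e)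
  B := B

/-- The seeds obtained from the initial one by finite sequences of mutations. -/
def IsSeed (s : ClusterSeed ι) : Prop :=
  Relation.ReflTransGen (fun s t => ∃ k : N, t = s.mutate k) B.initialSeed s

/-- All cluster variables, mutable and frozen. -/
def clusterVariables : Set (AmbientField E) := {z | ∃ s, B.IsSeed s ∧ ∃ e, z = s.x e}

/-- The cluster algebra: generated by all cluster variables and the reciprocals of the
frozen variables. -/
def clusterAlgebra : Subalgebra ℂ (AmbientField E) :=
  Algebra.adjoin ℂ (B.clusterVariables ∪ {z | ∃ e, e ∉ Set.range ι ∧ z = (B.initialSeed.x e)⁻¹})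

/-- The initial cluster variables, as elements of the cluster algebra. -/
def initialVariable (e : E) : B.clusterAlgebra :=
  ⟨B.initialSeed.x e, Algebra.subset_adjoin (Or.inl ⟨_, Relation.ReflTransGen.refl, e, rfl⟩)⟩

/-- The group of cluster automorphisms: the `ℂ`-algebra automorphisms that multiply every cluster
variable by a non-zero scalar. -/
def clusterAut : Subgroup (B.clusterAlgebra ≃ₐ[ℂ] B.clusterAlgebra) where
  carrier := {φ | ∀ z : B.clusterAlgebra, (z : AmbientField E) ∈ B.clusterVariables →
    ∃ ζ : ℂˣ, φ z = (ζ : ℂ) • z}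
  one_mem' := fun z _ => ⟨1, by simp⟩
  mul_mem' := by
    intro φ ψ hφ hψ z hz
    obtain ⟨a, ha⟩ := hφ z hz
    obtain ⟨b, hb⟩ := hψ z hz
    refine ⟨a * b, ?_⟩
    rw [AlgEquiv.mul_apply, hb, map_smul, ha, smul_smul, Units.val_mul, mul_comm]
  inv_mem' := by
    intro φ hφ z hz
    obtain ⟨a, ha⟩ := hφ z hz
    refine ⟨a⁻¹, ?_⟩
    apply φ.injective
    rw [map_smul, ha, smul_smul, ← Units.val_mul, inv_mul_cancel, Units.val_one, one_smul]
    exact AlgEquiv.apply_symm_apply φ z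

/-- The cluster automorphisms that fix the initial mutable variables. -/
def mutableFixingAut : Subgroup (B.clusterAlgebra ≃ₐ[ℂ] B.clusterAlgebra) where
  carrier := {φ | φ ∈ B.clusterAut ∧
    ∀ i : N, φ (B.initialVariable (ι i)) = B.initialVariable (ι i)}
  one_mem' := ⟨one_mem _, fun _ => rfl⟩
  mul_mem' := fun hφ hψ => ⟨mul_mem hφ.1 hψ.1, fun i => by
    rw [AlgEquiv.mul_apply, hψ.2, hφ.2]⟩
  inv_mem' := by
    intro φ hφ
    refine ⟨inv_mem hφ.1, fun i => φ.injective ?_⟩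
    rw [hφ.2]
    exact AlgEquiv.apply_symm_apply φ _

/-- The regular functions on a group `G` of cluster automorphisms, viewed as a subvariety of the
torus `(ℂ*)^E` through `φ ↦ (ζ_e)` where `φ (x_e) = ζ_e x_e`: the algebra of functions generated
by the coordinate functions `φ ↦ ζ_e` and their inverses. -/
def autRegularFunctions (G : Subgroup (B.clusterAlgebra ≃ₐ[ℂ] B.clusterAlgebra)) :
    Subalgebra ℂ (G → ℂ) :=
  Algebra.adjoin ℂ
    {f | ∃ e : E,
      (∀ φ : G, φ.1 (B.initialVariable e) = f φ • B.initialVariable e) ∨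
      (∀ φ : G, φ.1 (B.initialVariable e) = (f φ)⁻¹ • B.initialVariable e)}

/-- Evaluation of regular functions at a cluster automorphism. -/
def autEval (G : Subgroup (B.clusterAlgebra ≃ₐ[ℂ] B.clusterAlgebra)) (φ : G) :
    B.autRegularFunctions G →ₐ[ℂ] ℂ :=
  (Pi.evalAlgHom ℂ (fun _ : G => ℂ) φ).comp (B.autRegularFunctions G).val

/-- The lattice `B ℚ^N ∩ ℤ^E`. -/
def saturatedLattice [Fintype N] : AddSubgroup (E → ℤ) where
  carrier := {a | ∃ u : N → ℚ,
    (B.mat.map (Int.cast : ℤ → ℚ)).mulVec u = fun e => ((a e : ℤ) : ℚ)}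
  zero_mem' := ⟨0, by ext; simp⟩
  add_mem' := by
    rintro a b ⟨u, hu⟩ ⟨v, hv⟩
    exact ⟨u + v, by rw [Matrix.mulVec_add, hu, hv]; ext; simp⟩
  neg_mem' := by
    rintro a ⟨u, hu⟩
    exact ⟨-u, by rw [Matrix.mulVec_neg, hu]; ext; simp⟩

/-- The lattice `B ℤ^N`. -/
def columnLattice [Fintype N] : AddSubgroup (E → ℤ) := B.mat.mulVecLin.range.toAddSubgroup

/-- The group `X* = (B ℚ^N ∩ ℤ^E) / B ℤ^N`. -/
abbrev XStar [Fintype N] : Type :=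
  B.saturatedLattice ⧸ B.columnLattice.addSubgroupOf B.saturatedLattice

/-- The product of the variables `x_j`, for `j` a mutable index outside `I`. -/
def outerProduct [Fintype N] [DecidableEq N] (I : Finset N) : B.clusterAlgebra :=
  ∏ j ∈ Iᶜ, B.initialVariable (ι j)

/-- The ideal generated by the `x_i`, `i ∈ I`, after inverting `x_j` for the mutable indices
`j ∉ I`. -/
def stratumIdeal [Fintype N] [DecidableEq N] (I : Finset N) :
    Ideal (Localization.Away (B.outerProduct I)) :=
  Ideal.span ((fun i => algebraMap B.clusterAlgebra (Localization.Away (B.outerProduct I))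
    (B.initialVariable (ι i))) '' (I : Set N))

/-- The coordinate ring of the stratum of `I`: invert `x_j` for the mutable indices `j ∉ I`, and
divide by the ideal generated by the `x_i` for `i ∈ I`. -/
abbrev StratumRing [Fintype N] [DecidableEq N] (I : Finset N) : Type :=
  Localization.Away (B.outerProduct I) ⧸ B.stratumIdeal I

end ExtendedExchangeMatrix

/-- The affine scheme over `ℂ` with a given coordinate ring. -/
abbrev affineVariety (R : Type) [CommRing R] [Algebra ℂ R] : Over (Spec (CommRingCat.of ℂ)) :=
  Over.mk (Spec.map (CommRingCat.ofHom (algebraMap ℂ R)))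

namespace ExtendedExchangeMatrix

variable {E N : Type} [Fintype E] {ι : N ↪ E} (B : ExtendedExchangeMatrix ι)

/-- The cluster variety. -/
abbrev clusterVariety : Over (Spec (CommRingCat.of ℂ)) := affineVariety B.clusterAlgebra

/-- The stratum `O_I` of the cluster variety, where `x_i = 0` for `i ∈ I` and `x_j ≠ 0` for the
other mutable indices. -/
abbrev stratum [Fintype N] [DecidableEq N] (I : Finset N) : Over (Spec (CommRingCat.of ℂ)) :=
  affineVariety (B.StratumRing I)

/-- The inclusion of the stratum into the cluster variety. -/
def stratumInclusion [Fintype N] [DecidableEq N] (I : Finset N) :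
    B.stratum I ⟶ B.clusterVariety :=
  Over.homMk (Spec.map (CommRingCat.ofHom (Ideal.Quotient.mk (B.stratumIdeal I))) ≫
    Spec.map (CommRingCat.ofHom
      (algebraMap B.clusterAlgebra (Localization.Away (B.outerProduct I))))) (by
    simp only [Over.mk_hom, ← Spec.map_comp, ← CommRingCat.ofHom_comp])

/-- The stratum is a locally closed subscheme of the cluster variety. -/
instance isImmersion_stratumInclusion [Fintype N] [DecidableEq N] (I : Finset N) :
    IsImmersion (B.stratumInclusion I).left := by
  have h1 : IsClosedImmersion (Spec.map (CommRingCat.ofHom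
      (Ideal.Quotient.mk (B.stratumIdeal I)))) :=
    IsClosedImmersion.spec_of_surjective _ Ideal.Quotient.mk_surjective
  have h2 : IsOpenImmersion (Spec.map (CommRingCat.ofHom
      (algebraMap B.clusterAlgebra (Localization.Away (B.outerProduct I))))) :=
    IsOpenImmersion.of_isLocalization (B.outerProduct I)
  exact IsImmersion.comp _ _

/-- The points of the stratum are the points of the cluster variety at which `x_i` vanishes
exactly for the mutable indices `i ∈ I`. -/
lemma range_stratumInclusion [Fintype N] [DecidableEq N] (I : Finset N) :
    Set.range (B.stratumInclusion I).left.base =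
      {p : PrimeSpectrum B.clusterAlgebra |
        ∀ i : N, B.initialVariable (ι i) ∈ p.asIdeal ↔ i ∈ I} := by
  let L := Localization.Away (B.outerProduct I)
  let J : Ideal L := B.stratumIdeal I
  have hL : ∀ q : PrimeSpectrum B.clusterAlgebra,
      q ∈ Set.range (PrimeSpectrum.comap (algebraMap B.clusterAlgebra L)) ↔
        ∀ i : N, i ∉ I → B.initialVariable (ι i) ∉ q.asIdeal := by
    intro q
    rw [PrimeSpectrum.localization_away_comap_range L (B.outerProduct I)]
    change B.outerProduct I ∉ q.asIdeal ↔ _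
    rw [outerProduct, q.isPrime.prod_mem_iff]
    simp
  have hJ : ∀ q : PrimeSpectrum L, q ∈ Set.range (PrimeSpectrum.comap (Ideal.Quotient.mk J)) ↔
      ∀ i ∈ I, B.initialVariable (ι i) ∈
        (PrimeSpectrum.comap (algebraMap B.clusterAlgebra L) q).asIdeal := by
    intro q
    rw [range_comap_of_surjective _ _ Ideal.Quotient.mk_surjective, Ideal.mk_ker,
      PrimeSpectrum.mem_zeroLocus, SetLike.coe_subset_coe]
    change B.stratumIdeal I ≤ q.asIdeal ↔ _
    rw [stratumIdeal, Ideal.span_le, Set.image_subset_iff]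
    rfl
  ext p
  change p ∈ Set.range (PrimeSpectrum.comap (algebraMap B.clusterAlgebra L) ∘
    PrimeSpectrum.comap (Ideal.Quotient.mk J)) ↔ _
  rw [Set.range_comp]
  constructor
  · rintro ⟨q, hq, rfl⟩ i
    exact ⟨fun h => by_contra fun hi => (hL _).1 ⟨q, rfl⟩ i hi h, (hJ q).1 hq i⟩
  · intro hp
    obtain ⟨q, rfl⟩ := (hL p).2 fun i hi h => hi ((hp i).1 h)
    exact ⟨q, (hJ q).2 fun i hi => (hp i).2 hi, rfl⟩

/-- A group of cluster automorphisms, as a variety. -/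
abbrev autVariety (G : Subgroup (B.clusterAlgebra ≃ₐ[ℂ] B.clusterAlgebra)) :
    Over (Spec (CommRingCat.of ℂ)) :=
  affineVariety (B.autRegularFunctions G)

end ExtendedExchangeMatrix

/-- The affine space `𝔸^k` over `ℂ`. -/
abbrev affineSpaceVariety (k : ℕ) : Over (Spec (CommRingCat.of ℂ)) :=
  Over.mk (𝔸(Fin k; Spec (CommRingCat.of ℂ)) ↘ Spec (CommRingCat.of ℂ))

/-- The torus `𝔾_m^d` over `ℂ`: its coordinate ring is the ring of Laurent polynomials in `d`
variables. -/
abbrev torusVariety (d : ℕ) : Over (Spec (CommRingCat.of ℂ)) :=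
  affineVariety (AddMonoidAlgebra ℂ (Fin d → ℤ))

/-- A finite set as a variety over `ℂ`. -/
abbrev finiteVariety (C : Type) : Over (Spec (CommRingCat.of ℂ)) := affineVariety (C → ℂ)

end

/-! For i in I let y_i be the variable obtained from the initial seed by one mutation at i, so that
x_i y_i is the exchange binomial P_i. As I has no edges, P_i involves no variable of I, and
mutations inside I merely toggle between x_i and y_i.

The first step replaces the full matrix by its columns in I: inverting the x_j with j mutable
outside I turns the cluster algebra A(B) into A(B_I) (`isLocalization_away_outerProduct`). The
generators of A(B_I) lie in A(B) up to these denominators. Conversely, the Laurent phenomenon places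
A(B) in the Laurent ring of each of the 2^k clusters obtained by toggling a subset of I. The
intersection of these rings is generated by the x_i and y_i for i in I together with the other
variables and their inverses (`mem_adjoin_mixedGenerators`), and all of these belong to A(B_I). The
Laurent phenomenon itself holds because the upper bound of a seed is invariant under mutation
(`upperBound_mutate`). This comes down to a coprimality statement for two successive mutations
(`regularModulo_mutate`), for which the independence of the columns is needed.

The second step computes A(B_I) modulo the x_i. There the y_i become free, and the frozen variables
are subject only to x^c = -1 for every column c. A character of ℤ^E that is -1 on the columns and 1
on the unit vectors of I absorbs the signs, and the quotient becomes a polynomial ring in k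
variables over the group algebra of ℤ^E/Λ, where Λ is spanned by the columns and these unit vectors
(`nonempty_quotient_mutableIdeal_algEquiv`).

The third step identifies the automorphisms. A scaling of the initial variables extends to a cluster
automorphism exactly when its character kills the columns, and it fixes the x_i exactly when it
kills Λ. Hence the two groups are the character groups of ℤ^E modulo the columns and of ℤ^E/Λ. Their
rings of regular functions are the corresponding group algebras, and every point of these rings is
an automorphism, which expresses Zariski closedness.

The rest is about lattices. The columns vanish on the coordinates in I, so Λ is free of rank 2k. The
torsion of ℤ^E/Λ is X*, which yields the torus and the finite factor, and ℤ^E modulo the columns is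
ℤ^k × ℤ^E/Λ, which yields the statement for the full group. -/

noncomputable section

set_option linter.unusedSectionVars false

/-! ### Affine varieties and their coordinate rings. -/

/-- Isomorphic algebras have isomorphic affine varieties. -/
lemma nonempty_affineVariety_iso {R S : Type} [CommRing R] [Algebra ℂ R] [CommRing S]
    [Algebra ℂ S] (e : R ≃ₐ[ℂ] S) : Nonempty (affineVariety R ≅ affineVariety S) :=
  ⟨(algSpec (CommRingCat.of ℂ)).mapIso
    (Iso.op (X := CommAlgCat.of ℂ S) (Y := CommAlgCat.of ℂ R) (CommAlgCat.isoMk e.symm))⟩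

open scoped TensorProduct in
/-- The product of affine varieties is the affine variety of the tensor product. -/
lemma nonempty_affineVariety_prod_iso (R S : Type) [CommRing R] [Algebra ℂ R] [CommRing S]
    [Algebra ℂ S] : Nonempty (affineVariety R ⨯ affineVariety S ≅ affineVariety (R ⊗[ℂ] S)) := by
  refine ⟨Over.isoMk (Over.prodLeftIsoPullback _ _ ≪≫ pullbackSpecIso ℂ R S) ?_⟩
  have h1 : (pullbackSpecIso ℂ R S).hom ≫ Spec.map (CommRingCat.ofHom (algebraMap ℂ (R ⊗[ℂ] S))) =
      pullback.fst _ _ ≫ Spec.map (CommRingCat.ofHom (algebraMap ℂ R)) :=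
    pullbackSpecIso_hom_base ℂ R S
  have h2 := Over.prodLeftIsoPullback_hom_fst (affineVariety R) (affineVariety S)
  rw [Iso.trans_hom, Category.assoc]
  refine (congrArg _ h1).trans ?_
  refine (Category.assoc _ _ _).symm.trans ((congrArg (· ≫ _) h2).trans ?_)
  exact Over.w (prod.fst : affineVariety R ⨯ affineVariety S ⟶ affineVariety R)

/-- Affine space is the affine variety of the polynomial ring. -/
lemma nonempty_affineSpaceVariety_iso (k : ℕ) :
    Nonempty (affineSpaceVariety k ≅ affineVariety (MvPolynomial (Fin k) ℂ)) :=
  ⟨Over.isoMk (AffineSpace.SpecIso (Fin k) (CommRingCat.of ℂ)) (by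
    rw [← Iso.eq_inv_comp]
    exact (AffineSpace.SpecIso_inv_over (CommRingCat.of ℂ)).symm)⟩

open scoped TensorProduct in
/-- The group algebra of a product is the tensor product of the group algebras. -/
def AddMonoidAlgebra.prodAlgEquivTensor (X Y : Type) [AddCommMonoid X] [AddCommMonoid Y] :
    AddMonoidAlgebra ℂ (X × Y) ≃ₐ[ℂ] AddMonoidAlgebra ℂ X ⊗[ℂ] AddMonoidAlgebra ℂ Y :=
  (AddMonoidAlgebra.curryAlgEquiv ℂ).trans
  (((AddMonoidAlgebra.scalarTensorEquiv (M := X) ℂ (AddMonoidAlgebra ℂ Y)).symm.restrictScalars ℂ).trans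
    (Algebra.TensorProduct.comm ℂ _ _))

/-! ### Laurent monomials and Laurent rings in algebraically independent elements. -/

section Laurent

variable {K E : Type} [Field K] [Fintype E]

/-- The Laurent monomial with exponent vector `g`. -/
def laurentMonomial (x : E → K) (g : E → ℤ) : K := ∏ e, x e ^ g e

lemma laurentMonomial_zero (x : E → K) : laurentMonomial x 0 = 1 := by simp [laurentMonomial]

lemma laurentMonomial_add {x : E → K} (hx : ∀ e, x e ≠ 0) (g h : E → ℤ) :
    laurentMonomial x (g + h) = laurentMonomial x g * laurentMonomial x h := by
  simp only [laurentMonomial, Pi.add_apply, ← Finset.prod_mul_distrib]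
  exact Finset.prod_congr rfl fun e _ => zpow_add₀ (hx e) _ _

lemma laurentMonomial_ne_zero {x : E → K} (hx : ∀ e, x e ≠ 0) (g : E → ℤ) :
    laurentMonomial x g ≠ 0 := Finset.prod_ne_zero_iff.2 fun e _ => zpow_ne_zero _ (hx e)

lemma laurentMonomial_neg (x : E → K) (g : E → ℤ) :
    laurentMonomial x (-g) = (laurentMonomial x g)⁻¹ := by
  simp [laurentMonomial, zpow_neg, Finset.prod_inv_distrib]

lemma laurentMonomial_single [DecidableEq E] (x : E → K) (e : E) (a : ℤ) :
    laurentMonomial x (Pi.single e a) = x e ^ a := by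
  rw [laurentMonomial, Finset.prod_eq_single e (fun b _ hb => by simp [Pi.single_eq_of_ne hb])
    (by simp), Pi.single_eq_same]

lemma laurentMonomial_congr {x y : E → K} {g : E → ℤ} (h : ∀ e, g e ≠ 0 → x e = y e) :
    laurentMonomial x g = laurentMonomial y g := by
  refine Finset.prod_congr rfl fun e _ => ?_
  by_cases hg : g e = 0
  · simp [hg]
  · rw [h e hg]

/-- Monomials with truncated exponents are monomials in the positive part of the exponent. -/
lemma prod_pow_toNat (x : E → K) (g : E → ℤ) :
    ∏ e, x e ^ (g e).toNat = laurentMonomial x g⁺ := by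
  refine Finset.prod_congr rfl fun e _ => ?_
  rw [← zpow_natCast]
  congr 1
  simp [posPart_def]

variable [Algebra ℂ K]

/-- The Laurent polynomials in the elements `x e`. -/
def laurentRing (x : E → K) : Subalgebra ℂ K :=
  Algebra.adjoin ℂ (Set.range x ∪ Set.range x⁻¹)

lemma mem_laurentRing (x : E → K) (e : E) : x e ∈ laurentRing x :=
  Algebra.subset_adjoin (Or.inl ⟨e, rfl⟩)

lemma inv_mem_laurentRing (x : E → K) (e : E) : (x e)⁻¹ ∈ laurentRing x :=
  Algebra.subset_adjoin (Or.inr ⟨e, rfl⟩)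

lemma laurentMonomial_mem (x : E → K) (g : E → ℤ) : laurentMonomial x g ∈ laurentRing x := by
  refine prod_mem fun e _ => ?_
  obtain ⟨n, hn | hn⟩ := (g e).eq_nat_or_neg
  · rw [hn, zpow_natCast]; exact pow_mem (mem_laurentRing x e) n
  · rw [hn, zpow_neg, zpow_natCast, ← inv_pow]; exact pow_mem (inv_mem_laurentRing x e) n

/-- Evaluation of Laurent polynomials. -/
def laurentHom {x : E → K} (hx : ∀ e, x e ≠ 0) : AddMonoidAlgebra ℂ (E → ℤ) →ₐ[ℂ] K :=
  AddMonoidAlgebra.lift ℂ K (E → ℤ)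
    { toFun := fun g => laurentMonomial x g.toAdd
      map_one' := laurentMonomial_zero x
      map_mul' := fun g h => laurentMonomial_add hx g.toAdd h.toAdd }

lemma laurentHom_single {x : E → K} (hx : ∀ e, x e ≠ 0) (g : E → ℤ) (c : ℂ) :
    laurentHom hx (AddMonoidAlgebra.single g c) = c • laurentMonomial x g := by
  simp [laurentHom, AddMonoidAlgebra.lift_single]

lemma range_laurentHom {x : E → K} (hx : ∀ e, x e ≠ 0) : (laurentHom hx).range = laurentRing x := by
  classical
  apply le_antisymm
  · rintro _ ⟨f, rfl⟩
    change laurentHom hx f ∈ _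
    induction f using AddMonoidAlgebra.induction_linear with
    | zero => simp
    | add f g hf hg => rw [map_add]; exact add_mem hf hg
    | single g c => rw [laurentHom_single]; exact Subalgebra.smul_mem _ (laurentMonomial_mem x g) c
  · refine Algebra.adjoin_le ?_
    rintro _ (⟨e, rfl⟩ | ⟨e, rfl⟩)
    · refine ⟨AddMonoidAlgebra.single (Pi.single e 1) 1, ?_⟩
      simpa [laurentMonomial_single] using laurentHom_single hx (Pi.single e 1) 1
    · refine ⟨AddMonoidAlgebra.single (Pi.single e (-1)) 1, ?_⟩
      simpa [laurentMonomial_single] using laurentHom_single hx (Pi.single e (-1)) 1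

lemma AlgebraicIndependent.linearIndependent_laurentMonomial {x : E → K}
    (hx : AlgebraicIndependent ℂ x) : LinearIndependent ℂ (laurentMonomial x) := by
  classical
  have hne : ∀ e, x e ≠ 0 := hx.ne_zero
  rw [linearIndependent_iff']
  intro s c hc g hg
  -- Multiplying by the monomial with exponent `N` clears every denominator in `s`, so that a linear
  -- relation between Laurent monomials becomes a polynomial relation.
  let N : E → ℤ := fun e => ∑ h ∈ s, |h e|
  have hN : ∀ h ∈ s, ∀ e, 0 ≤ h e + N e := fun h hh e => by
    have := Finset.single_le_sum (f := fun h : E → ℤ => |h e|) (fun h _ => abs_nonneg _) hh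
    have := neg_abs_le (h e)
    simp only [N]; linarith
  let ν : (E → ℤ) → E →₀ ℕ := fun h => Finsupp.equivFunOnFinite.symm fun e => (h e + N e).toNat
  have hν : ∀ h ∈ s, laurentMonomial x (h + N) = ∏ e, x e ^ ν h e := fun h hh => by
    refine Finset.prod_congr rfl fun e _ => ?_
    rw [← zpow_natCast]
    congr 1
    exact (Int.toNat_of_nonneg (hN h hh e)).symm
  have hνinj : Set.InjOn ν s := fun a ha b hb hab => by
    funext e
    have h1 := DFunLike.congr_fun hab e
    have h2 := hN a ha e
    have h3 := hN b hb e
    simp only [ν, Finsupp.equivFunOnFinite_symm_apply_apply] at h1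
    omega
  have key : MvPolynomial.aeval x (∑ h ∈ s, MvPolynomial.monomial (ν h) (c h)) = 0 := by
    rw [map_sum, ← zero_mul (laurentMonomial x N), ← hc, Finset.sum_mul]
    refine Finset.sum_congr rfl fun h hh => ?_
    rw [MvPolynomial.aeval_monomial, smul_mul_assoc, ← laurentMonomial_add hne, hν h hh,
      Algebra.smul_def, Finsupp.prod_fintype _ _ (by simp)]
  have h0 := (injective_iff_map_eq_zero _).1 hx _ key
  have h1 := congrArg (MvPolynomial.coeff (ν g)) h0
  rw [MvPolynomial.coeff_sum, Finset.sum_eq_single g] at h1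
  · rwa [MvPolynomial.coeff_monomial, if_pos rfl] at h1
  · intro b hb hbg
    rw [MvPolynomial.coeff_monomial, if_neg fun h => hbg (hνinj hb hg h)]
  · exact fun h => (h hg).elim

lemma AlgebraicIndependent.laurentHom_injective {x : E → K} (hx : AlgebraicIndependent ℂ x) :
    Function.Injective (laurentHom (x := x) hx.ne_zero) := by
  rw [injective_iff_map_eq_zero]
  intro f hf
  have := (linearIndependent_iff.1 hx.linearIndependent_laurentMonomial) f.coeff (by
    rw [← hf]
    simp [laurentHom, AddMonoidAlgebra.lift_apply, Finsupp.linearCombination_apply])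
  exact AddMonoidAlgebra.coeff_injective this

/-- Being algebraic over a domain and over its field of fractions are the same. The version over a
field allows denominators in the remaining variables. -/
lemma AlgebraicIndependent.transcendental_intermediateField {x : E → K}
    (hx : AlgebraicIndependent ℂ x) (e : E) :
    Transcendental (IntermediateField.adjoin ℂ (x '' {e}ᶜ)) (x e) := by
  have h := ((AlgebraicIndependent.iff_transcendental_adjoin_image e).1 hx).2
  open IntermediateField.algebraAdjoinAdjoin in
  rwa [Transcendental, ← IsFractionRing.isAlgebraic_iff (Algebra.adjoin ℂ (x '' {e}ᶜ))
    (IntermediateField.adjoin ℂ (x '' {e}ᶜ)) K]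

/-- Replacing one element by its quotient into a function of the others preserves
algebraic independence. -/
lemma AlgebraicIndependent.update_div [DecidableEq E] {x : E → K}
    (hx : AlgebraicIndependent ℂ x) (e : E) {p : K} (hp : p ≠ 0)
    (hpm : p ∈ IntermediateField.adjoin ℂ (x '' {e}ᶜ)) :
    AlgebraicIndependent ℂ (Function.update x e (p / x e)) := by
  rw [AlgebraicIndependent.iff_transcendental_adjoin_image e] at hx ⊢
  have himg : Function.update x e (p / x e) '' {e}ᶜ = x '' {e}ᶜ :=
    Set.image_congr fun a ha => Function.update_of_ne ha _ _
  refine ⟨?_, ?_⟩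
  · convert! hx.1 using 2 with j
    exact Function.update_of_ne j.2 _ _
  · rw [himg, Function.update_self]
    have htr := ((AlgebraicIndependent.iff_transcendental_adjoin_image e).2 hx
      ).transcendental_intermediateField e
    -- If p / x_e were algebraic over the field generated by the other elements, then so would be
    -- x_e = p (p / x_e)⁻¹, because p lies in that field.
    intro halg
    apply htr
    have h1 : IsAlgebraic (IntermediateField.adjoin ℂ (x '' {e}ᶜ)) (p / x e) := by
      open IntermediateField.algebraAdjoinAdjoin in
      rwa [← IsFractionRing.isAlgebraic_iff (Algebra.adjoin ℂ (x '' {e}ᶜ))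
        (IntermediateField.adjoin ℂ (x '' {e}ᶜ)) K]
    have h2 := (isAlgebraic_algebraMap (R := IntermediateField.adjoin ℂ (x '' {e}ᶜ)) (A := K)
      ⟨p, hpm⟩).mul h1.inv
    convert! h2 using 1
    change x e = p * (p / x e)⁻¹
    field_simp

end Laurent

/-! ### Non-zero divisors modulo 1 + x^β. -/

section Regular

/-- A Laurent polynomial with two terms, one of which has a unit coefficient, is not a
zero divisor. -/
lemma AddMonoidAlgebra.eq_zero_of_binomial_mul_eq_zero {Q : Type} [CommRing Q] {u v : Q}
    (hu : IsUnit u) {m n : ℤ} (hmn : m ≠ n) {a : AddMonoidAlgebra Q ℤ}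
    (h : (AddMonoidAlgebra.single m u + AddMonoidAlgebra.single n v) * a = 0) : a = 0 := by
  by_contra ha
  have hne : a.coeff.support.Nonempty := by
    rw [Finsupp.support_nonempty_iff]
    exact fun h0 => ha (AddMonoidAlgebra.coeff_injective h0)
  -- The extreme exponent of `a` in the direction from n to m: there the second term contributes
  -- nothing to the coefficient of degree k + m, which is therefore u times the coefficient of `a`
  -- at k.
  obtain ⟨k, hk, hmax⟩ := Finset.exists_max_image a.coeff.support (fun k => k * (m - n)) hne
  have h0 : a.coeff (k + m - n) = 0 := by
    by_contra hne
    have := hmax _ (Finsupp.mem_support_iff.2 hne)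
    have : 0 < (m - n) * (m - n) := mul_self_pos.2 (sub_ne_zero.2 hmn)
    nlinarith
  have h1 := congrArg (fun f => f.coeff (k + m)) h
  simp only [add_mul, AddMonoidAlgebra.coeff_add, Finsupp.add_apply,
    AddMonoidAlgebra.coeff_single_mul_apply, AddMonoidAlgebra.coeff_zero, Finsupp.zero_apply] at h1
  rw [show -m + (k + m) = k by ring, show -n + (k + m) = k + m - n by ring, h0, mul_zero, add_zero,
    hu.mul_right_eq_zero] at h1
  exact (Finsupp.mem_support_iff.1 hk) h1

variable {Γ : Type} [AddCommGroup Γ]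

/-- Divisibility by a polynomial supported in degree zero, with respect to a grading, can be
checked after multiplication by an element which is a sum of two terms of different degrees
modulo that polynomial. -/
lemma AddMonoidAlgebra.dvd_of_dvd_mul (ℓ : Γ →+ ℤ) {β g₀ g₁ : Γ} (hβ : ℓ β = 0) (hg : ℓ g₀ ≠ ℓ g₁)
    (c : ℂ) {h z a : AddMonoidAlgebra ℂ Γ}
    (hh : h = single g₀ 1 + single g₁ c + (1 + single β 1) * z)
    (ha : (1 + single β 1) ∣ h * a) : (1 + single β (1 : ℂ)) ∣ a := by
  set P : AddMonoidAlgebra ℂ Γ := 1 + single β 1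
  -- Since ℓ β = 0, the quotient by 1 + X^β keeps the grading by ℓ. The map `φ` sends X^g to its
  -- class times T^(ℓ g); it kills 1 + X^β and turns `h` into a binomial in T with a unit
  -- coefficient.
  let Q := AddMonoidAlgebra ℂ Γ ⧸ Ideal.span {P}
  let φ : AddMonoidAlgebra ℂ Γ →ₐ[ℂ] AddMonoidAlgebra Q ℤ :=
    AddMonoidAlgebra.lift ℂ _ Γ
      { toFun := fun g => single (ℓ g.toAdd) (Ideal.Quotient.mk _ (single g.toAdd 1))
        map_one' := by
          simp only [toAdd_one, map_zero]
          exact congrArg _ (map_one _)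
        map_mul' := fun g g' => by
          simp only [toAdd_mul, map_add, single_mul_single, ← map_mul, mul_one] }
  have hφ : ∀ g c, φ (single g c) = c • single (ℓ g) (Ideal.Quotient.mk _ (single g 1)) :=
    fun g c => by simp [φ, AddMonoidAlgebra.lift_single]
  have hφP : φ P = 0 := by
    simp only [P, map_add, map_one, hφ, hβ, one_smul]
    have : (1 : AddMonoidAlgebra Q ℤ) = single 0 (Ideal.Quotient.mk _ 1) := rfl
    rw [this, ← single_add, ← map_add,
      Ideal.Quotient.eq_zero_iff_mem.2 (Ideal.mem_span_singleton_self P), single_zero]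
  -- Setting T = 1 recovers the quotient map, so divisibility of `a` can be read off from φ a = 0.
  let ε : AddMonoidAlgebra Q ℤ →ₐ[Q] Q := AddMonoidAlgebra.lift Q Q ℤ 1
  have hε : ∀ f, ε (φ f) = Ideal.Quotient.mk _ f := by
    intro f
    have : (ε.restrictScalars ℂ).comp φ = Ideal.Quotient.mkₐ ℂ (Ideal.span {P}) := by
      ext g
      simp only [Function.comp_apply, AlgHom.coe_comp, AlgHom.coe_restrictScalars', hφ, one_smul]
      refine (AddMonoidAlgebra.lift_single (1 : Multiplicative ℤ →* Q) _ _).trans ?_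
      rw [MonoidHom.one_apply, smul_eq_mul, mul_one]
      rfl
    exact DFunLike.congr_fun this f
  have hφa : φ h * φ a = 0 := by
    obtain ⟨q, hq⟩ := ha
    rw [← map_mul, hq, map_mul, hφP, zero_mul]
  have hφh : φ h = single (ℓ g₀) (Ideal.Quotient.mk _ (single g₀ 1)) +
      single (ℓ g₁) (c • Ideal.Quotient.mk _ (single g₁ 1)) := by
    rw [hh, map_add, map_mul, hφP, zero_mul, add_zero, map_add, hφ, hφ, one_smul, smul_single]
  rw [hφh] at hφa
  have hu : IsUnit (Ideal.Quotient.mk (Ideal.span {P}) (single g₀ 1)) := by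
    refine IsUnit.map _ (IsUnit.of_mul_eq_one (single (-g₀) 1) ?_)
    rw [single_mul_single, add_neg_cancel, mul_one]; rfl
  have ha0 := eq_zero_of_binomial_mul_eq_zero hu hg hφa
  rw [← Ideal.mem_span_singleton, ← Ideal.Quotient.eq_zero_iff_mem, ← hε, ha0, map_zero]

end Regular

section Coprime

variable {K E : Type} [Field K] [Algebra ℂ K]

/-- `h` is a non-zero divisor modulo `d` in the subalgebra `R`. -/
def RegularModulo (R : Subalgebra ℂ K) (d h : K) : Prop :=
  ∀ a ∈ R, (∃ z ∈ R, h * a = d * z) → ∃ z ∈ R, a = d * z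

lemma RegularModulo.mul {R : Subalgebra ℂ K} {d h h' : K} (hd : RegularModulo R d h)
    (hd' : RegularModulo R d h') (hR : h' ∈ R) : RegularModulo R d (h * h') := fun a ha hz =>
  hd' a ha (hd (h' * a) (mul_mem hR ha) (by simpa only [mul_assoc] using hz))

lemma RegularModulo.pow {R : Subalgebra ℂ K} {d h : K} (hd : RegularModulo R d h) (hR : h ∈ R)
    (n : ℕ) : RegularModulo R d (h ^ n) := by
  induction n with
  | zero => intro a _ hz; simpa using hz
  | succ n ih => rw [pow_succ]; exact ih.mul hd hR

/-- An element all of whose denominators are coprime is integral. -/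
lemma RegularModulo.mem {R : Subalgebra ℂ K} {d h f : K} (hd : RegularModulo R d h) (hdR : d ∈ R)
    (hR : h ∈ R) (hd0 : d ≠ 0) {m n : ℕ} (h1 : f * d ^ m ∈ R) (h2 : f * h ^ n ∈ R) : f ∈ R := by
  induction m with
  | zero => simpa using h1
  | succ m ih =>
    apply ih
    -- As h^n (f d^(m+1)) = d (f h^n d^m), regularity of h^n removes one factor d from the
    -- denominator of f.
    obtain ⟨z, hz, hfz⟩ := hd.pow hR n (f * d ^ (m + 1)) h1
      ⟨f * h ^ n * d ^ m, mul_mem h2 (pow_mem hdR m), by ring⟩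
    have : f * d ^ m = z := mul_left_cancel₀ hd0 (by rw [← hfz]; ring)
    rwa [this]

variable [Fintype E]

/-- `AddMonoidAlgebra.dvd_of_dvd_mul` carried over to the Laurent ring by the isomorphism with the
group algebra. The case c = 0 is allowed: a single monomial modulo 1 + x^β is a unit there. -/
lemma regularModulo_laurentRing {x : E → K} (hx : AlgebraicIndependent ℂ x) (ℓ : (E → ℤ) →+ ℤ)
    {β g₀ g₁ : E → ℤ} (hβ : ℓ β = 0) (hg : ℓ g₀ ≠ ℓ g₁) (c : ℂ) {h z : K} (hz : z ∈ laurentRing x)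
    (hh : h = laurentMonomial x g₀ + c • laurentMonomial x g₁ + (1 + laurentMonomial x β) * z) :
    RegularModulo (laurentRing x) (1 + laurentMonomial x β) h := by
  have hs := fun g c => laurentHom_single (x := x) hx.ne_zero g c
  rw [← range_laurentHom hx.ne_zero] at hz ⊢
  obtain ⟨z, rfl⟩ := hz
  rintro _ ⟨a, rfl⟩ ⟨_, ⟨w, rfl⟩, hw⟩
  have hP : laurentHom (x := x) hx.ne_zero (1 + AddMonoidAlgebra.single β 1) =
      1 + laurentMonomial x β := by
    rw [map_add, map_one, hs, one_smul]
  obtain ⟨q, hq⟩ := AddMonoidAlgebra.dvd_of_dvd_mul ℓ hβ hg c rfl (a := a) (z := z) ⟨w, by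
    apply hx.laurentHom_injective
    rw [hh] at hw
    simp only [map_mul, map_add, hs, one_smul, map_one]
    exact hw⟩
  refine ⟨_, ⟨q, rfl⟩, ?_⟩
  rw [← hP]
  exact (congrArg _ hq).trans (map_mul _ _ _)

end Coprime

section Monomial

variable {K E : Type} [Field K] [Fintype E]

lemma laurentMonomial_update [DecidableEq E] {x : E → K} {e : E} (hx : x e ≠ 0) {z : K}
    (g : E → ℤ) :
    laurentMonomial (Function.update x e z) g = laurentMonomial x g * (z / x e) ^ g e := by
  rw [laurentMonomial, laurentMonomial, ← Finset.mul_prod_erase _ _ (Finset.mem_univ e),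
    ← Finset.mul_prod_erase _ (fun i => x i ^ g i) (Finset.mem_univ e), Function.update_self,
    div_zpow, Finset.prod_congr rfl fun i hi => by
      rw [Function.update_of_ne (Finset.ne_of_mem_erase hi)]]
  have := zpow_ne_zero (g e) hx
  field_simp

lemma laurentMonomial_zsmul (x : E → K) (n : ℤ) (g : E → ℤ) :
    laurentMonomial x (n • g) = laurentMonomial x g ^ n := by
  simp only [laurentMonomial, Pi.smul_apply, smul_eq_mul, ← Finset.prod_zpow, ← zpow_mul, mul_comm]

lemma one_add_laurentMonomial_ne_zero [Algebra ℂ K] {x : E → K} (hx : AlgebraicIndependent ℂ x)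
    (g : E → ℤ) : 1 + laurentMonomial x g ≠ 0 := by
  intro h
  have h1 : laurentHom (x := x) hx.ne_zero (1 + AddMonoidAlgebra.single g 1) = 0 := by
    rw [map_add, map_one, laurentHom_single, one_smul, h]
  have h2 := (injective_iff_map_eq_zero _).1 hx.laurentHom_injective _ h1
  have h3 := congrArg (fun f => f.coeff g) h2
  by_cases hg : g = 0
  · subst hg
    simp [AddMonoidAlgebra.one_def] at h3
  · simp [AddMonoidAlgebra.one_def, hg] at h3

/-- If the generators of a ring of Laurent polynomials become elements of `R` after inverting
`h`, then so do all its elements. -/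
lemma exists_mul_pow_mem [Algebra ℂ K] {x : E → K} {R : Subalgebra ℂ K} {h : K} (hR : h ∈ R)
    (h1 : ∀ e, x e ∈ R) (h2 : ∀ e, (x e)⁻¹ * h ∈ R) {f : K} (hf : f ∈ laurentRing x) :
    ∃ n : ℕ, f * h ^ n ∈ R := by
  induction hf using Algebra.adjoin_induction with
  | mem f hf =>
    obtain ⟨e, rfl⟩ | ⟨e, rfl⟩ := hf
    · exact ⟨0, by simpa using h1 e⟩
    · exact ⟨1, by simpa using h2 e⟩
  | algebraMap c => exact ⟨0, by simp⟩
  | add f g _ _ hf hg =>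
    obtain ⟨m, hm⟩ := hf
    obtain ⟨n, hn⟩ := hg
    refine ⟨m + n, ?_⟩
    have := add_mem (mul_mem hm (pow_mem hR n)) (mul_mem hn (pow_mem hR m))
    convert! this using 1
    ring
  | mul f g _ _ hf hg =>
    obtain ⟨m, hm⟩ := hf
    obtain ⟨n, hn⟩ := hg
    refine ⟨m + n, ?_⟩
    convert! mul_mem hm hn using 1
    ring

end Monomial

/-! ### Mutation of exchange matrices and seeds. -/

namespace ExtendedExchangeMatrix

variable {E N : Type} {ι : N ↪ E} (B : ExtendedExchangeMatrix ι)

/-- A column of an extended exchange matrix. -/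
def column (k : N) : E → ℤ := fun e => B.mat e k

lemma column_self (k : N) : B.column k (ι k) = 0 := by
  have := B.skew k k
  change B.mat (ι k) k = 0
  omega

lemma column_apply_comm (j k : N) : B.column k (ι j) = -B.column j (ι k) := B.skew j k

@[ext]
lemma ext_mat {B B' : ExtendedExchangeMatrix ι} (h : B.mat = B'.mat) : B = B' := by
  cases B; cases B'; congr

lemma mutate_mutate (k : N) : (B.mutate k).mutate k = B := by
  ext i j
  have hs := B.skew k k
  by_cases h : i = ι k ∨ j = k
  · simp [mutate, h]
  · push Not at h
    simp only [mutate, h.1, h.2, or_true, true_or, or_false, if_true, if_false]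
    have hmax : ∀ a : ℤ, max (-a) 0 = -min a 0 := fun a => by omega
    have hmin : ∀ a : ℤ, min (-a) 0 = -max a 0 := fun a => by omega
    rw [hmax, hmax, hmin, hmin]
    ring

lemma column_mutate_self (k : N) : (B.mutate k).column k = -B.column k := by
  funext e
  simp [column, mutate]

lemma column_mutate_apply {j k : N} (hjk : j ≠ k) (e : E) (he : e ≠ ι k) :
    (B.mutate k).column j e = B.column j e + max (B.column k e) 0 * max (B.column j (ι k)) 0 -
      min (B.column k e) 0 * min (B.column j (ι k)) 0 := by
  simp [column, mutate, hjk, he]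

lemma column_mutate_apply_self (j k : N) :
    (B.mutate k).column j (ι k) = -B.column j (ι k) := by
  simp [column, mutate]

/-- Mutation preserves the linear independence of the columns. -/
lemma linearIndependent_column_mutate [Fintype N] (h : LinearIndependent ℤ B.column) (k : N) :
    LinearIndependent ℤ (B.mutate k).column := by
  classical
  rw [Fintype.linearIndependent_iff] at h ⊢
  intro u hu
  have hu' : ∀ e, ∑ j, u j * (B.mutate k).column j e = 0 := fun e => by
    simpa [Finset.sum_apply] using congrFun hu e
  have h0 : ∑ j, u j * B.column j (ι k) = 0 := by
    have := hu' (ι k)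
    simp only [column_mutate_apply_self, mul_neg, Finset.sum_neg_distrib] at this
    exact neg_eq_zero.1 this
  -- With b_j the entry of column j in row k, the j-th term of the relation is u_j c_j + (u_j b_j)
  -- c_k⁺ + u_j max(-b_j, 0) c_k away from row k. The middle terms sum to zero by `h0`, and column k
  -- itself changes sign; collecting the multiples of c_k gives `w`.
  let w : N → ℤ := Function.update u k (∑ j, u j * max (-B.column j (ι k)) 0 - u k)
  have hsplit : ∀ f : N → ℤ, ∑ j, f j = f k + ∑ j ∈ Finset.univ.erase k, f j := fun f =>
    (Finset.add_sum_erase _ _ (Finset.mem_univ k)).symm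
  have hw : ∑ j, w j • B.column j = 0 := by
    funext e
    simp only [Finset.sum_apply, Pi.smul_apply, smul_eq_mul, Pi.zero_apply]
    rw [hsplit, Finset.sum_congr rfl fun j hj => by
      rw [show w j = u j from Function.update_of_ne (Finset.ne_of_mem_erase hj) _ _],
      show w k = _ from Function.update_self _ _ _]
    by_cases he : e = ι k
    · subst he
      rw [hsplit, column_self] at h0
      rw [column_self]
      linarith
    · have h1 := hu' e
      rw [hsplit, column_mutate_self, Pi.neg_apply, Finset.sum_congr rfl fun j hj => by
        rw [B.column_mutate_apply (Finset.ne_of_mem_erase hj) e he]] at h1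
      have h2 : ∀ j, u j * (B.column j e + max (B.column k e) 0 * max (B.column j (ι k)) 0 -
          min (B.column k e) 0 * min (B.column j (ι k)) 0) = u j * B.column j e +
          (u j * B.column j (ι k)) * max (B.column k e) 0 +
          (u j * max (-B.column j (ι k)) 0) * B.column k e := fun j => by
        have e1 : min (B.column k e) 0 = B.column k e - max (B.column k e) 0 := by omega
        have e2 : min (B.column j (ι k)) 0 = B.column j (ι k) - max (B.column j (ι k)) 0 := by omega
        have e3 : max (-B.column j (ι k)) 0 = max (B.column j (ι k)) 0 - B.column j (ι k) := by
          omega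
        rw [e1, e2, e3]
        ring
      rw [Finset.sum_congr rfl fun j _ => h2 j, Finset.sum_add_distrib, Finset.sum_add_distrib,
        ← Finset.sum_mul, ← Finset.sum_mul] at h1
      rw [hsplit, column_self] at h0
      have h3 : ∑ j, u j * max (-B.column j (ι k)) 0 =
          ∑ j ∈ Finset.univ.erase k, u j * max (-B.column j (ι k)) 0 := by
        rw [hsplit, column_self]; simp
      rw [h3]
      simp only [mul_zero, zero_add] at h0
      rw [h0] at h1
      linarith
  have hw0 := h w hw
  have hj : ∀ j, j ≠ k → u j = 0 := fun j hj => by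
    simpa [w, Function.update_of_ne hj] using hw0 j
  intro j
  by_cases hjk : j = k
  · subst hjk
    have h4 := hw0 j
    simp only [w, Function.update_self] at h4
    rw [hsplit, Finset.sum_eq_zero fun i hi => by rw [hj i (Finset.ne_of_mem_erase hi), zero_mul],
      column_self] at h4
    simpa using h4
  · exact hj j hjk

end ExtendedExchangeMatrix

namespace ClusterSeed

variable {E N : Type} [Fintype E] {ι : N ↪ E} (s : ClusterSeed ι)

lemma ext_seed {s t : ClusterSeed ι} (hx : s.x = t.x) (hB : s.B = t.B) : s = t := by
  cases s; cases t; congr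

/-- The exchange polynomial of a seed in the direction `k`. -/
def exchange (k : N) : AmbientField E :=
  ∏ e, s.x e ^ (s.B.mat e k).toNat + ∏ e, s.x e ^ (-s.B.mat e k).toNat

lemma mutate_x_self (k : N) : (s.mutate k).x (ι k) = s.exchange k / s.x (ι k) := by
  simp [mutate, exchange]

lemma mutate_x_of_ne {k : N} {e : E} (h : e ≠ ι k) : (s.mutate k).x e = s.x e := by
  simp [mutate, h]

open Classical in
lemma mutate_x (k : N) :
    (s.mutate k).x = Function.update s.x (ι k) (s.exchange k / s.x (ι k)) := rfl

/-- The first factor is a unit of the Laurent ring, so questions of divisibility by the exchange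
polynomial concern 1 + x^c only. -/
lemma exchange_eq (hx : ∀ e, s.x e ≠ 0) (k : N) : s.exchange k =
    laurentMonomial s.x (s.B.column k)⁻ * (1 + laurentMonomial s.x (s.B.column k)) := by
  have h1 := prod_pow_toNat s.x (s.B.column k)
  have h2 := prod_pow_toNat s.x (-s.B.column k)
  rw [mul_add, mul_one, ← laurentMonomial_add hx]
  have h3 : (s.B.column k)⁻ + s.B.column k = (s.B.column k)⁺ := by
    conv_lhs => enter [2]; rw [← posPart_sub_negPart (s.B.column k)]
    abel
  rw [h3, ← h1, ← posPart_neg, ← h2, add_comm]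
  rfl

lemma exchange_ne_zero (hx : AlgebraicIndependent ℂ s.x) (k : N) : s.exchange k ≠ 0 := by
  rw [exchange_eq _ hx.ne_zero]
  exact mul_ne_zero (laurentMonomial_ne_zero hx.ne_zero _) (one_add_laurentMonomial_ne_zero hx _)

/-- The diagonal entry at k vanishes, so the exchange polynomial does not involve x_k and
`AlgebraicIndependent.update_div` applies. -/
lemma algebraicIndependent_mutate (hx : AlgebraicIndependent ℂ s.x) (k : N) :
    AlgebraicIndependent ℂ (s.mutate k).x := by
  classical
  rw [mutate_x]
  convert! hx.update_div (ι k) (s.exchange_ne_zero hx k) ?_ using 1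
  have h : ∀ n : E → ℕ, n (ι k) = 0 →
      ∏ e, s.x e ^ n e ∈ IntermediateField.adjoin ℂ (s.x '' {ι k}ᶜ) := fun n hn => by
    refine prod_mem fun e _ => ?_
    by_cases he : e = ι k
    · rw [he, hn, pow_zero]; exact one_mem _
    · have : s.x e ∈ s.x '' {ι k}ᶜ := ⟨e, he, rfl⟩
      exact pow_mem (IntermediateField.subset_adjoin ℂ _ this) _
  have h0 : s.B.mat (ι k) k = 0 := s.B.column_self k
  exact add_mem (h _ (by simp [h0])) (h _ (by simp [h0]))

lemma mul_mutate_x (hx : ∀ e, s.x e ≠ 0) (k : N) : s.x (ι k) * (s.mutate k).x (ι k) =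
    laurentMonomial s.x (s.B.column k)⁻ * (1 + laurentMonomial s.x (s.B.column k)) := by
  rw [mutate_x_self, mul_div_cancel₀ _ (hx _), exchange_eq _ hx]

/-- Mutation negates column k, which swaps the two monomials, and alters only x_k, which occurs in
neither. This makes mutation of seeds an involution. -/
lemma exchange_mutate (k : N) : (s.mutate k).exchange k = s.exchange k := by
  have h : ∀ n m : E → ℕ, n (ι k) = 0 → n = m →
      ∏ e, (s.mutate k).x e ^ n e = ∏ e, s.x e ^ m e := fun n m hn hm => by
    subst hm
    refine Finset.prod_congr rfl fun e _ => ?_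
    by_cases he : e = ι k
    · rw [he, hn, pow_zero, pow_zero]
    · rw [s.mutate_x_of_ne he]
  have h0 : s.B.mat (ι k) k = 0 := s.B.column_self k
  have h1 : ∀ e, (s.mutate k).B.mat e k = -s.B.mat e k := congrFun (s.B.column_mutate_self k)
  rw [exchange, exchange, add_comm]
  simp only [h1, neg_neg]
  rw [h _ _ (by simp [h0]) rfl, h (fun e => (-s.B.mat e k).toNat) _ (by simp [h0]) rfl]

lemma mutate_mutate (hx : AlgebraicIndependent ℂ s.x) (k : N) : (s.mutate k).mutate k = s := by
  refine ext_seed (funext fun e => ?_) (s.B.mutate_mutate k)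
  by_cases he : e = ι k
  · subst he
    rw [mutate_x_self, exchange_mutate, mutate_x_self, div_div_cancel₀ (exchange_ne_zero _ hx k)]
  · rw [mutate_x_of_ne _ he, mutate_x_of_ne _ he]

end ClusterSeed

/-! ### Coprimality for two successive mutations. -/

lemma RegularModulo.unit_mul {K : Type} [Field K] [Algebra ℂ K] {R : Subalgebra ℂ K} {d h u : K}
    (hd : RegularModulo R d h) (hu : u ∈ R) (hu' : u⁻¹ ∈ R) (hu0 : u ≠ 0) :
    RegularModulo R (u * d) h := by
  rintro a ha ⟨z, hz, hza⟩
  obtain ⟨w, hw, rfl⟩ := hd a ha ⟨u * z, mul_mem hu hz, by rw [hza]; ring⟩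
  exact ⟨u⁻¹ * w, mul_mem hu' hw, by field_simp⟩

/-- The cofactor is a geometric sum. Its exact value for n = 1 is recorded because there it becomes
the coefficient of a surviving monomial. -/
lemma exists_one_add_pow_eq {K : Type} [Field K] [Algebra ℂ K] {R : Subalgebra ℂ K} {t : K}
    (ht : t ∈ R) (n : ℕ) : ∃ z ∈ R, (1 + t) ^ n = 1 + t * z ∧ (n = 1 → z = 1) := by
  refine ⟨∑ i ∈ Finset.range n, (1 + t) ^ i,
    sum_mem fun i _ => pow_mem (add_mem (one_mem R) ht) i, ?_, ?_⟩
  · have := mul_geom_sum (1 + t) n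
    rw [add_sub_cancel_left] at this
    rw [this]; ring
  · rintro rfl; simp

namespace ClusterSeed

variable {E N : Type} [Fintype E] {ι : N ↪ E} (s : ClusterSeed ι)

/-- The seed with the opposite exchange matrix. -/
def neg : ClusterSeed ι where
  x := s.x
  B := ⟨-s.B.mat, fun i j => by simp [s.B.skew i j]⟩

/-- The exchange relation is symmetric in its two monomials. This reduces the case of a negative
entry to that of a positive one. -/
lemma neg_mutate (k : N) : s.neg.mutate k = (s.mutate k).neg := by
  refine ext_seed ?_ ?_
  · simp [mutate, neg, add_comm]
  · ext i j
    have hmax : ∀ a : ℤ, max (-a) 0 = -min a 0 := fun a => by omega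
    have hmin : ∀ a : ℤ, min (-a) 0 = -max a 0 := fun a => by omega
    change _ = -((s.B.mutate k).mat i j)
    by_cases h : i = ι k ∨ j = k
    · simp [mutate, neg, ExtendedExchangeMatrix.mutate, h]
    · simp only [mutate, neg, ExtendedExchangeMatrix.mutate, h, if_false, Matrix.neg_apply,
        hmax, hmin]
      ring

/-- The elements governing the passage between the two orders of mutation, for two directions
joined by an edge of the exchange graph. -/
lemma regularModulo_of_pos (hx : AlgebraicIndependent ℂ s.x) {j k : N} (hjk : j ≠ k)
    (hb : 0 < s.B.column j (ι k)) :
    (s.mutate j).x (ι j) ∈ laurentRing ((s.mutate k).mutate j).x ∧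
    s.x (ι k) ∈ laurentRing ((s.mutate k).mutate j).x ∧
    RegularModulo (laurentRing ((s.mutate k).mutate j).x)
      (s.x (ι j) * ((s.mutate k).mutate j).x (ι j)) ((s.mutate j).x (ι j)) ∧
    RegularModulo (laurentRing ((s.mutate k).mutate j).x)
      (s.x (ι j) * ((s.mutate k).mutate j).x (ι j)) (s.x (ι k)) := by
  classical
  have hx' := s.algebraicIndependent_mutate hx k
  have hy := (s.mutate k).algebraicIndependent_mutate hx' j
  have hιjk : ι j ≠ ι k := fun h => hjk (ι.injective h)
  have hx0 := hx.ne_zero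
  have hx'0 := hx'.ne_zero
  have hy0 := hy.ne_zero
  set x := s.x with hxdef
  set x' := (s.mutate k).x with hx'def
  set y := ((s.mutate k).mutate j).x with hydef
  set cj := s.B.column j with hcj
  set ck := s.B.column k with hck
  set β := (s.mutate k).B.column j with hβ
  have hcj0 : cj (ι j) = 0 := s.B.column_self j
  have hck0 : ck (ι k) = 0 := s.B.column_self k
  have hβ0 : β (ι j) = 0 := (s.mutate k).B.column_self j
  -- The entry is written as n + 1 so that the exponent n left after dividing by x_j is a natural
  -- number.
  obtain ⟨n, hn⟩ : ∃ n : ℕ, cj (ι k) = n + 1 := ⟨(cj (ι k) - 1).toNat, by omega⟩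
  have hckj : ck (ι j) = -(n + 1) := by
    have := s.B.column_apply_comm j k
    rw [← hn]; exact this
  have hβk : β (ι k) = -(n + 1) := by
    have := s.B.column_mutate_apply_self j k
    rw [← hn]; exact this
  -- The last summand only repairs coordinate k, where mutation changes n + 1 into -(n + 1).
  have hβe : β = cj + ((n : ℤ) + 1) • ck⁺ - (2 * ((n : ℤ) + 1)) • Pi.single (ι k) 1 := by
    funext e
    by_cases he : e = ι k
    · subst he
      simp only [Pi.sub_apply, Pi.add_apply, Pi.smul_apply, smul_eq_mul, Pi.single_eq_same, hβk,
        hn, posPart_def, Pi.sup_apply, hck0, Pi.zero_apply, max_self]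
      ring
    · have h1 : β e = _ := s.B.column_mutate_apply hjk e he
      rw [h1, ← hcj, ← hck, hn]
      simp only [Pi.sub_apply, Pi.add_apply, Pi.smul_apply, smul_eq_mul, Pi.single_eq_of_ne he,
        posPart_def, Pi.sup_apply, Pi.zero_apply]
      rw [max_eq_left (by omega : (0 : ℤ) ≤ n + 1), min_eq_right (by omega : (0 : ℤ) ≤ n + 1)]
      ring
  have hx'y : ∀ g : E → ℤ, g (ι j) = 0 → laurentMonomial x' g = laurentMonomial y g := fun g hg =>
    laurentMonomial_congr fun e he =>
      ((s.mutate k).mutate_x_of_ne (fun h => he (by rw [h, hg]))).symm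
  have hxy : ∀ g : E → ℤ, g (ι j) = 0 → g (ι k) = 0 →
      laurentMonomial x g = laurentMonomial y g := fun g hg hg' => by
    rw [← hx'y g hg]
    exact laurentMonomial_congr fun e he => (s.mutate_x_of_ne (fun h => he (by rw [h, hg']))).symm
  have madd := fun g h => laurentMonomial_add hy0 g h
  have mmem := fun g => laurentMonomial_mem y g
  -- the exchange relations
  set t := laurentMonomial x (-ck) with ht
  set r := laurentMonomial y ck⁺ with hr
  set η := laurentMonomial y β with hη
  set q := laurentMonomial y cj⁻ with hq
  set v := laurentMonomial y β⁻ with hv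
  have hr0 : r ≠ 0 := laurentMonomial_ne_zero hy0 _
  have hv0 : v ≠ 0 := laurentMonomial_ne_zero hy0 _
  have hrx : laurentMonomial x ck⁺ = r := hxy _ (by simp [hckj]; try omega)
    (by simp [hck0])
  have rel1 : x (ι k) * x' (ι k) = r * (1 + t) := by
    have h1 := s.mul_mutate_x hx0 k
    rw [← hxdef, ← hck] at h1
    rw [h1, ← hrx, mul_add, mul_add, mul_one, mul_one, ht, ← laurentMonomial_add hx0,
      ← laurentMonomial_add hx0, add_comm]
    congr 2
    · conv_lhs => enter [2]; rw [← posPart_sub_negPart ck]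
      abel
    · conv_rhs => enter [2]; rw [← posPart_sub_negPart ck]
      abel
  have rel2 : x (ι j) * (s.mutate j).x (ι j) = q * (1 + laurentMonomial x cj) := by
    rw [hq, ← hxy _ (by simp [hcj0]) (by simp [hn]; try omega)]
    exact s.mul_mutate_x hx0 j
  have rel3 : x (ι j) * y (ι j) = v * (1 + η) := by
    rw [hv, hη, ← hx'y _ hβ0, ← hx'y _ (by simp [hβ0]),
      show x (ι j) = x' (ι j) from (s.mutate_x_of_ne hιjk).symm]
    exact (s.mutate k).mul_mutate_x hx'0 j
  have ht1 : 1 + t ≠ 0 := one_add_laurentMonomial_ne_zero hx _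
  have hx'k : x' (ι k) = r * (1 + t) / x (ι k) := by
    rw [← rel1, mul_div_cancel_left₀ _ (hx0 _)]
  -- Substituting x'_k = r (1 + t) / x_k into y^β, whose exponent at k is -(n + 1), cancels the
  -- powers of r and x_k and leaves a power of 1 + t.
  have rel4 : laurentMonomial x cj = η * (1 + t) ^ (n + 1) := by
    have h1 : η = laurentMonomial x β * (x' (ι k) / x (ι k)) ^ (β (ι k)) := by
      rw [hη, ← hx'y _ hβ0]
      refine (congrArg (laurentMonomial · β) ?_).trans (laurentMonomial_update (hx0 (ι k)) β)
      funext e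
      by_cases he : e = ι k
      · rw [he, Function.update_self]
      · rw [Function.update_of_ne he]
        exact s.mutate_x_of_ne he
    have h2 : laurentMonomial x β = laurentMonomial x cj * r ^ (n + 1) *
        ((x (ι k)) ^ (2 * (n + 1)))⁻¹ := by
      rw [hβe, sub_eq_add_neg, laurentMonomial_add hx0, laurentMonomial_add hx0,
        laurentMonomial_neg, laurentMonomial_zsmul, laurentMonomial_zsmul, laurentMonomial_single,
        hrx, zpow_one]
      norm_cast
    rw [h1, h2, hβk, hx'k]
    have := hx0 (ι k)
    have e1 : (-((n : ℤ) + 1)) = -((n + 1 : ℕ) : ℤ) := by push_cast; ring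
    rw [e1, zpow_neg, zpow_natCast]
    rw [pow_mul, div_div, ← pow_two, div_pow, mul_pow]
    field_simp
  -- the factorisation of the monomial `t`
  let gτ : E → ℤ := -ck - ((n : ℤ) + 1) • Pi.single (ι j) 1
  have hgτj : gτ (ι j) = 0 := by simp [gτ, hckj]
  have hgτk : gτ (ι k) = 0 := by simp [gτ, hck0, hιjk]
  set τ := laurentMonomial y gτ with hτ
  have htτ : t = x (ι j) ^ (n + 1) * τ := by
    have : -ck = ((n : ℤ) + 1) • Pi.single (ι j) 1 + gτ := by simp [gτ]
    rw [ht, this, laurentMonomial_add hx0, laurentMonomial_zsmul, laurentMonomial_single,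
      hxy _ hgτj hgτk, zpow_one]
    norm_cast
  have hyjinv : laurentMonomial y (-Pi.single (ι j) 1) = (y (ι j))⁻¹ := by
    rw [laurentMonomial_neg, laurentMonomial_single, zpow_one]
  have hyj : laurentMonomial y (Pi.single (ι j) 1) = y (ι j) := by
    rw [laurentMonomial_single, zpow_one]
  -- Thus x_j is 1 + η times a unit: terms containing x_j vanish modulo 1 + η.
  have hxj : x (ι j) = (1 + η) * (v * (y (ι j))⁻¹) := by
    rw [← mul_assoc, mul_comm _ v, ← rel3, mul_assoc, mul_inv_cancel₀ (hy0 _), mul_one]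
  have hvy : v * (y (ι j))⁻¹ ∈ laurentRing y := mul_mem (mmem _) (inv_mem_laurentRing y _)
  have hη1 : 1 + η ∈ laurentRing y := add_mem (one_mem _) (mmem _)
  have hxjm : x (ι j) ∈ laurentRing y := by rw [hxj]; exact mul_mem hη1 hvy
  have htm : t ∈ laurentRing y := by rw [htτ]; exact mul_mem (pow_mem hxjm _) (mmem _)
  obtain ⟨Z, hZ, hZeq, hZ1⟩ := exists_one_add_pow_eq htm (n + 1)
  -- the two elements
  have form1 : (s.mutate j).x (ι j) = laurentMonomial y (cj⁻ - β⁻ + Pi.single (ι j) 1) +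
      laurentMonomial y (cj⁻ + β + gτ) * Z * x (ι j) ^ n := by
    apply mul_left_cancel₀ (hx0 (ι j))
    rw [rel2, rel4, hZeq, madd, madd, madd, sub_eq_add_neg, madd, laurentMonomial_neg, hyj, ← hq,
      ← hv, ← hη, ← hτ, htτ]
    have : x (ι j) * (q * v⁻¹ * y (ι j)) = q * (1 + η) := by
      rw [show x (ι j) * (q * v⁻¹ * y (ι j)) = q * v⁻¹ * (x (ι j) * y (ι j)) by ring, rel3]
      field_simp
    rw [mul_add (x (ι j)), this]
    ring
  have form2 : x (ι k) = laurentMonomial y (ck⁺ - Pi.single (ι k) 1) +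
      laurentMonomial y (ck⁺ - Pi.single (ι k) 1) * τ * x (ι j) ^ (n + 1) := by
    have h1 : laurentMonomial y (ck⁺ - Pi.single (ι k) 1) = r * (x' (ι k))⁻¹ := by
      rw [sub_eq_add_neg, madd, laurentMonomial_neg, laurentMonomial_single, zpow_one,
        show y (ι k) = x' (ι k) from (s.mutate k).mutate_x_of_ne hιjk.symm]
    rw [h1, mul_assoc _ τ, mul_comm τ, ← htτ]
    apply mul_right_cancel₀ (hx'0 (ι k))
    rw [rel1]
    have := hx'0 (ι k)
    field_simp
  have hvm : v⁻¹ ∈ laurentRing y := by rw [hv, ← laurentMonomial_neg]; exact mmem _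
  -- The grading is the degree in y_j; β has degree zero as a diagonal entry vanishes.
  let ℓ : (E → ℤ) →+ ℤ := Pi.evalAddMonoidHom _ (ι j)
  have hℓ : ∀ g, ℓ g = g (ι j) := fun _ => rfl
  have hg0 : ℓ (cj⁻ - β⁻ + Pi.single (ι j) 1) = 1 := by simp [hℓ, negPart_def, hcj0, hβ0]
  have hg1 : ℓ (cj⁻ + β + gτ) = 0 := by simp [hℓ, negPart_def, hcj0, hβ0, hgτj]
  have hg2 : ℓ (ck⁺ - Pi.single (ι k) 1) = 0 := by
    simp [hℓ, hckj, hιjk]; try omega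
  have hℓβ : ℓ β = 0 := hβ0
  have hm1 : laurentMonomial y (cj⁻ + β + gτ) * Z ∈ laurentRing y := mul_mem (mmem _) hZ
  have hm2 : laurentMonomial y (ck⁺ - Pi.single (ι k) 1) * τ ∈ laurentRing y :=
    mul_mem (mmem _) (mmem _)
  refine ⟨?_, ?_, ?_, ?_⟩
  · rw [form1]; exact add_mem (mmem _) (mul_mem hm1 (pow_mem hxjm _))
  · rw [form2]; exact add_mem (mmem _) (mul_mem hm2 (pow_mem hxjm _))
  · rw [rel3]
    refine RegularModulo.unit_mul ?_ (mmem _) hvm hv0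
    -- For n = 0 no factor x_j survives in the second term, but Z = 1 makes it a monomial of degree
    -- 0 against the degree 1 of the first term. For larger n it is divisible by x_j and disappears
    -- modulo 1 + η.
    cases n with
    | zero =>
      refine regularModulo_laurentRing (g₀ := cj⁻ - β⁻ + Pi.single (ι j) 1)
        (g₁ := cj⁻ + β + gτ) hy ℓ hℓβ (by rw [hg0, hg1]; exact one_ne_zero) 1
        (zero_mem _) ?_
      rw [form1, hZ1 rfl]; simp
    | succ n =>
      refine regularModulo_laurentRing (g₀ := cj⁻ - β⁻ + Pi.single (ι j) 1)
        (g₁ := cj⁻ + β + gτ) hy ℓ hℓβ (by rw [hg0, hg1]; exact one_ne_zero) 0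
        (mul_mem (mul_mem hm1 hvy) (pow_mem hxjm n)) ?_
      rw [form1, pow_succ]
      conv_lhs => enter [2, 2, 2]; rw [hxj]
      simp only [zero_smul]
      ring
  · rw [rel3]
    refine RegularModulo.unit_mul ?_ (mmem _) hvm hv0
    -- Only the first monomial survives modulo 1 + η. The second exponent carries the coefficient 0
    -- and is any vector of a different degree.
    refine regularModulo_laurentRing (g₀ := ck⁺ - Pi.single (ι k) 1)
      (g₁ := cj⁻ - β⁻ + Pi.single (ι j) 1) hy ℓ hℓβ (by rw [hg0, hg2]; exact zero_ne_one) 0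
      (mul_mem (mul_mem hm2 hvy) (pow_mem hxjm n)) ?_
    conv_lhs => rw [form2, pow_succ]
    conv_lhs => enter [2, 2, 2]; rw [hxj]
    simp only [zero_smul]
    ring

end ClusterSeed

/-- A linear form separating two linearly independent vectors. -/
lemma exists_addMonoidHom_eq_zero_and_ne_zero {E : Type} {a b : E → ℤ}
    (h : ∀ u v : ℤ, u • a + v • b = 0 → u = 0 ∧ v = 0) :
    ∃ ℓ : (E → ℤ) →+ ℤ, ℓ a = 0 ∧ ℓ b ≠ 0 := by
  by_contra! hcon
  have ha : ∃ e, a e ≠ 0 := by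
    by_contra! h0
    have := h 1 0 (by funext e; simp [h0])
    exact one_ne_zero this.1
  obtain ⟨e, he⟩ := ha
  -- The forms a_e (coordinate e') - a_e' (coordinate e) all kill a; if they all kill b as well,
  -- then a and b are proportional.
  have h1 : ∀ e', a e * b e' - a e' * b e = 0 := fun e' => by
    simpa using hcon (a e • Pi.evalAddMonoidHom (fun _ => ℤ) e' -
      a e' • Pi.evalAddMonoidHom (fun _ => ℤ) e) (by simp [mul_comm])
  refine he (h (-b e) (a e) ?_).2
  funext e'
  simp only [Pi.add_apply, Pi.smul_apply, smul_eq_mul, Pi.zero_apply]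
  linarith [h1 e']

namespace ClusterSeed

variable {E N : Type} [Fintype E] {ι : N ↪ E} (s : ClusterSeed ι)

/-- When the entry vanishes, x_k does not enter the exchange relation at j, and the correction terms
in the mutation of column j are zero. -/
lemma mutate_x_mutate_of_column_eq_zero {j k : N} (hjk : j ≠ k) (hb : s.B.column j (ι k) = 0) :
    (s.mutate k).B.column j = s.B.column j ∧
      ((s.mutate k).mutate j).x (ι j) = (s.mutate j).x (ι j) := by
  have hιjk : ι j ≠ ι k := fun h => hjk (ι.injective h)
  have hcol : (s.mutate k).B.column j = s.B.column j := by
    funext e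
    by_cases he : e = ι k
    · rw [he, hb, show (s.mutate k).B.column j (ι k) = _ from s.B.column_mutate_apply_self j k, hb,
        neg_zero]
    · rw [show (s.mutate k).B.column j e = _ from s.B.column_mutate_apply hjk e he, hb]
      simp
  refine ⟨hcol, ?_⟩
  have h : ∀ n : E → ℕ, n (ι k) = 0 →
      ∏ e, (s.mutate k).x e ^ n e = ∏ e, s.x e ^ n e := fun n hn => by
    refine Finset.prod_congr rfl fun e _ => ?_
    by_cases he : e = ι k
    · rw [he, hn, pow_zero, pow_zero]
    · rw [s.mutate_x_of_ne he]
  have h1 : ∀ e, (s.mutate k).B.mat e j = s.B.mat e j := congrFun hcol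
  have h0 : s.B.mat (ι k) j = 0 := hb
  rw [mutate_x_self, mutate_x_self, s.mutate_x_of_ne hιjk, exchange, exchange]
  simp only [h1]
  rw [h _ (by simp [h0]), h _ (by simp [h0])]

/-- The opposite variable at j is now a unit, and x_k is a monomial times 1 + y^(c_k). This is
coprime to 1 + y^(c_j) because the two columns are not proportional: some grading kills c_j but not
c_k. -/
lemma regularModulo_of_zero (hx : AlgebraicIndependent ℂ s.x)
    (hlin : LinearIndependent ℤ s.B.column) {j k : N} (hjk : j ≠ k)
    (hb : s.B.column j (ι k) = 0) :
    (s.mutate j).x (ι j) ∈ laurentRing ((s.mutate k).mutate j).x ∧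
    s.x (ι k) ∈ laurentRing ((s.mutate k).mutate j).x ∧
    RegularModulo (laurentRing ((s.mutate k).mutate j).x)
      (s.x (ι j) * ((s.mutate k).mutate j).x (ι j)) ((s.mutate j).x (ι j)) ∧
    RegularModulo (laurentRing ((s.mutate k).mutate j).x)
      (s.x (ι j) * ((s.mutate k).mutate j).x (ι j)) (s.x (ι k)) := by
  classical
  have hx' := s.algebraicIndependent_mutate hx k
  have hy := (s.mutate k).algebraicIndependent_mutate hx' j
  have hιjk : ι j ≠ ι k := fun h => hjk (ι.injective h)
  have hx0 := hx.ne_zero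
  have hy0 := hy.ne_zero
  obtain ⟨hcol, hxj⟩ := s.mutate_x_mutate_of_column_eq_zero hjk hb
  have hpair : LinearIndependent ℤ ![s.B.column j, s.B.column k] := by
    convert! hlin.comp ![j, k] (by
      intro a b; fin_cases a <;> fin_cases b <;> simp [hjk, hjk.symm]) using 1
    funext a
    fin_cases a <;> rfl
  obtain ⟨ℓ, hℓj, hℓk⟩ := exists_addMonoidHom_eq_zero_and_ne_zero (a := s.B.column j)
    (b := s.B.column k) (LinearIndependent.pair_iff.1 hpair)
  set x := s.x with hxdef
  set y := ((s.mutate k).mutate j).x with hydef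
  set cj := s.B.column j with hcj
  set ck := s.B.column k with hck
  have hcj0 : cj (ι j) = 0 := s.B.column_self j
  have hck0 : ck (ι k) = 0 := s.B.column_self k
  have hckj : ck (ι j) = 0 := by
    have : ck (ι j) = -cj (ι k) := s.B.column_apply_comm j k
    rw [this, hb, neg_zero]
  have hxy : ∀ g : E → ℤ, g (ι j) = 0 → g (ι k) = 0 →
      laurentMonomial x g = laurentMonomial y g := fun g hg hg' =>
    laurentMonomial_congr fun e he => by
      rw [hydef, (s.mutate k).mutate_x_of_ne (fun h => he (by rw [h, hg])),
        s.mutate_x_of_ne (fun h => he (by rw [h, hg']))]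
  have madd := fun g h => laurentMonomial_add hy0 g h
  have mmem := fun g => laurentMonomial_mem y g
  have rel : x (ι j) * y (ι j) =
      laurentMonomial y cj⁻ * (1 + laurentMonomial y cj) := by
    rw [hxj, ← hxy _ hcj0 hb, ← hxy _ (by simp [hcj0]) (by simp [hb])]
    exact s.mul_mutate_x hx0 j
  have hyk : y (ι k) = (s.mutate k).x (ι k) := (s.mutate k).mutate_x_of_ne hιjk.symm
  let g₀ : E → ℤ := ck⁻ - Pi.single (ι k) 1
  have form : x (ι k) = laurentMonomial y (g₀ + ck) + laurentMonomial y g₀ := by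
    have h := s.mul_mutate_x hx0 k
    rw [← hyk, ← hck, ← hxdef, hxy _ hckj hck0, hxy _ (by simp [hckj]) (by simp [hck0])] at h
    rw [madd, show laurentMonomial y g₀ = laurentMonomial y ck⁻ * (y (ι k))⁻¹ by
      simp only [g₀]
      rw [sub_eq_add_neg, madd, laurentMonomial_neg, laurentMonomial_single, zpow_one]]
    apply mul_right_cancel₀ (hy0 (ι k))
    rw [h]
    have := hy0 (ι k)
    field_simp
    ring
  have hu : (laurentMonomial y cj⁻)⁻¹ ∈ laurentRing y := by
    rw [← laurentMonomial_neg]; exact mmem _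
  have hdeg : ∀ g : E → ℤ, ℓ (g + ck) ≠ ℓ g := fun g => by
    rw [map_add]; intro h; exact hℓk (by linarith)
  refine ⟨?_, ?_, ?_, ?_⟩
  · rw [← hxj]; exact mem_laurentRing y _
  · rw [form]; exact add_mem (mmem _) (mmem _)
  · rw [rel]
    refine RegularModulo.unit_mul ?_ (mmem _) hu (laurentMonomial_ne_zero hy0 _)
    refine regularModulo_laurentRing hy ℓ hℓj (hdeg (Pi.single (ι j) 1)).symm 0 (zero_mem _) ?_
    rw [← hxj, laurentMonomial_single]
    simp
  · rw [rel]
    refine RegularModulo.unit_mul ?_ (mmem _) hu (laurentMonomial_ne_zero hy0 _)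
    refine regularModulo_laurentRing hy ℓ hℓj (hdeg g₀) 1 (zero_mem _) ?_
    rw [form]
    simp

lemma regularModulo_mutate (hx : AlgebraicIndependent ℂ s.x)
    (hlin : LinearIndependent ℤ s.B.column) {j k : N} (hjk : j ≠ k) :
    (s.mutate j).x (ι j) ∈ laurentRing ((s.mutate k).mutate j).x ∧
    s.x (ι k) ∈ laurentRing ((s.mutate k).mutate j).x ∧
    RegularModulo (laurentRing ((s.mutate k).mutate j).x)
      (s.x (ι j) * ((s.mutate k).mutate j).x (ι j)) ((s.mutate j).x (ι j)) ∧
    RegularModulo (laurentRing ((s.mutate k).mutate j).x)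
      (s.x (ι j) * ((s.mutate k).mutate j).x (ι j)) (s.x (ι k)) := by
  rcases lt_trichotomy (s.B.column j (ι k)) 0 with h | h | h
  · have := s.neg.regularModulo_of_pos hx hjk (show 0 < -s.B.column j (ι k) by omega)
    rwa [neg_mutate, neg_mutate, neg_mutate] at this
  · exact s.regularModulo_of_zero hx hlin hjk h
  · exact s.regularModulo_of_pos hx hjk h

/-- An element which is a Laurent polynomial in a cluster and in two adjacent clusters is a
Laurent polynomial in the cluster at distance two. -/
lemma mem_laurentRing_mutate_mutate (hx : AlgebraicIndependent ℂ s.x)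
    (hlin : LinearIndependent ℤ s.B.column) {j k : N} (hjk : j ≠ k) {f : AmbientField E}
    (hfj : f ∈ laurentRing (s.mutate j).x) (hfk : f ∈ laurentRing (s.mutate k).x) :
    f ∈ laurentRing ((s.mutate k).mutate j).x := by
  obtain ⟨h1, h2, h3, h4⟩ := s.regularModulo_mutate hx hlin hjk
  have hιjk : ι j ≠ ι k := fun h => hjk (ι.injective h)
  have hx' := s.algebraicIndependent_mutate hx k
  have hxj := s.algebraicIndependent_mutate hx j
  have hy := (s.mutate k).algebraicIndependent_mutate hx' j
  have hym := mem_laurentRing ((s.mutate k).mutate j).x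
  have hyim := inv_mem_laurentRing ((s.mutate k).mutate j).x
  have hd0 : s.x (ι j) * ((s.mutate k).mutate j).x (ι j) ≠ 0 :=
    mul_ne_zero (hx.ne_zero _) (hy.ne_zero _)
  have hxk : (s.mutate k).x (ι j) = s.x (ι j) := s.mutate_x_of_ne hιjk
  have hex : s.x (ι j) * ((s.mutate k).mutate j).x (ι j) ∈
      laurentRing ((s.mutate k).mutate j).x := by
    rw [← hxk, mutate_x_self, mul_div_cancel₀ _ (hx'.ne_zero _), ← exchange_mutate,
      exchange_eq _ hy.ne_zero]
    exact mul_mem (laurentMonomial_mem _ _) (add_mem (one_mem _) (laurentMonomial_mem _ _))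
  -- The two Laurent conditions on f bound its denominator in the new cluster by a power of x_j y_j
  -- and, below, by a power of x_k times the opposite variable at j. These are coprime, so no
  -- denominator remains.
  obtain ⟨m, hm⟩ := exists_mul_pow_mem hex (x := (s.mutate k).x) (f := f) (fun e => by
      by_cases he : e = ι j
      · subst he
        have := mul_mem hex (hyim (ι j))
        rwa [mul_assoc, mul_inv_cancel₀ (hy.ne_zero _), mul_one, ← hxk] at this
      · rw [← (s.mutate k).mutate_x_of_ne he]; exact hym e) (fun e => by
      by_cases he : e = ι j
      · subst he
        rw [hxk, inv_mul_cancel_left₀ (hx.ne_zero _)]; exact hym _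
      · rw [← (s.mutate k).mutate_x_of_ne he]; exact mul_mem (hyim e) hex) hfk
  obtain ⟨n, hn⟩ := exists_mul_pow_mem (mul_mem h1 h2) (x := (s.mutate j).x) (f := f) (fun e => by
      by_cases he : e = ι j
      · rw [he]; exact h1
      · rw [s.mutate_x_of_ne he]
        by_cases he' : e = ι k
        · rw [he']; exact h2
        · rw [← s.mutate_x_of_ne he', ← (s.mutate k).mutate_x_of_ne he]; exact hym e) (fun e => by
      by_cases he : e = ι j
      · rw [he, inv_mul_cancel_left₀ (hxj.ne_zero _)]; exact h2
      · rw [s.mutate_x_of_ne he]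
        by_cases he' : e = ι k
        · rw [he', mul_left_comm, inv_mul_cancel₀ (hx.ne_zero _), mul_one]; exact h1
        · rw [← s.mutate_x_of_ne he', ← (s.mutate k).mutate_x_of_ne he]
          exact mul_mem (hyim e) (mul_mem h1 h2)) hfj
  exact (h3.mul h4 h2).mem hex (mul_mem h1 h2) hd0 hm hn

/-! ### Upper bounds and the Laurent phenomenon. -/

/-- The upper bound of a seed: the elements which are Laurent polynomials in its cluster and in
all the adjacent clusters. -/
def upperBound : Subalgebra ℂ (AmbientField E) :=
  laurentRing s.x ⊓ ⨅ k, laurentRing (s.mutate k).x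

lemma mem_upperBound {f : AmbientField E} : f ∈ s.upperBound ↔
    f ∈ laurentRing s.x ∧ ∀ k, f ∈ laurentRing (s.mutate k).x := by
  simp [upperBound, Algebra.mem_inf, Algebra.mem_iInf]

/-- The clusters adjacent to the mutated seed are the original one, for j = k, and those at distance
two, for which coprimality gives the Laurent property. -/
lemma upperBound_le_mutate (hx : AlgebraicIndependent ℂ s.x)
    (hlin : LinearIndependent ℤ s.B.column) (k : N) :
    s.upperBound ≤ (s.mutate k).upperBound := by
  intro f hf
  rw [mem_upperBound] at hf ⊢
  refine ⟨hf.2 k, fun j => ?_⟩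
  by_cases hjk : j = k
  · subst hjk
    rw [s.mutate_mutate hx]; exact hf.1
  · exact s.mem_laurentRing_mutate_mutate hx hlin hjk (hf.2 j) (hf.2 k)

/-- Mutation is an involution preserving the hypotheses, so the inclusion holds in both directions.
-/
lemma upperBound_mutate [Fintype N] (hx : AlgebraicIndependent ℂ s.x)
    (hlin : LinearIndependent ℤ s.B.column) (k : N) :
    (s.mutate k).upperBound = s.upperBound := by
  refine le_antisymm ?_ (s.upperBound_le_mutate hx hlin k)
  have := (s.mutate k).upperBound_le_mutate (s.algebraicIndependent_mutate hx k)
    (s.B.linearIndependent_column_mutate hlin k) k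
  rwa [s.mutate_mutate hx] at this

lemma mem_upperBound_x (hx : AlgebraicIndependent ℂ s.x) (e : E) : s.x e ∈ s.upperBound := by
  rw [mem_upperBound]
  refine ⟨mem_laurentRing _ e, fun k => ?_⟩
  by_cases he : e = ι k
  · subst he
    have h0 := (s.algebraicIndependent_mutate hx k).ne_zero
    have h1 : s.x (ι k) = (s.mutate k).exchange k * ((s.mutate k).x (ι k))⁻¹ := by
      rw [exchange_mutate, mutate_x_self, inv_div, mul_div_cancel₀ _ (s.exchange_ne_zero hx k)]
    rw [h1, exchange_eq _ h0]
    exact mul_mem (mul_mem (laurentMonomial_mem _ _)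
      (add_mem (one_mem _) (laurentMonomial_mem _ _))) (inv_mem_laurentRing _ _)
  · rw [← s.mutate_x_of_ne he]; exact mem_laurentRing _ e

lemma mem_upperBound_inv {e : E} (he : e ∉ Set.range ι) : (s.x e)⁻¹ ∈ s.upperBound := by
  rw [mem_upperBound]
  refine ⟨inv_mem_laurentRing _ e, fun k => ?_⟩
  rw [← s.mutate_x_of_ne (k := k) fun h => he ⟨k, h.symm⟩]
  exact inv_mem_laurentRing _ e

end ClusterSeed

namespace ExtendedExchangeMatrix

variable {E N : Type} [Fintype E] {ι : N ↪ E} (B : ExtendedExchangeMatrix ι)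

lemma algebraicIndependent_initialSeed : AlgebraicIndependent ℂ B.initialSeed.x := by
  have h := MvPolynomial.algebraicIndependent_X E ℂ
  exact h.map' (f := IsScalarTower.toAlgHom ℂ (MvPolynomial E ℂ) (AmbientField E))
    (IsFractionRing.injective (MvPolynomial E ℂ) (AmbientField E))

variable {B}

lemma IsSeed.algebraicIndependent {s : ClusterSeed ι} (hs : B.IsSeed s) :
    AlgebraicIndependent ℂ s.x := by
  induction hs with
  | refl => exact B.algebraicIndependent_initialSeed
  | tail _ h ih => obtain ⟨k, rfl⟩ := h; exact ClusterSeed.algebraicIndependent_mutate _ ih k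

lemma IsSeed.linearIndependent [Fintype N] {s : ClusterSeed ι} (hs : B.IsSeed s)
    (hB : LinearIndependent ℤ B.column) : LinearIndependent ℤ s.B.column := by
  induction hs with
  | refl => exact hB
  | tail _ h ih => obtain ⟨k, rfl⟩ := h; exact linearIndependent_column_mutate _ ih k

lemma IsSeed.upperBound_eq [Fintype N] {s : ClusterSeed ι} (hs : B.IsSeed s)
    (hB : LinearIndependent ℤ B.column) : s.upperBound = B.initialSeed.upperBound := by
  induction hs with
  | refl => rfl
  | tail hs h ih =>
    obtain ⟨k, rfl⟩ := h
    rw [← ih]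
    exact ClusterSeed.upperBound_mutate _ (IsSeed.algebraicIndependent hs)
      (IsSeed.linearIndependent hs hB) k

/-- The Laurent phenomenon for an exchange matrix with linearly independent columns. -/
theorem clusterAlgebra_le_laurentRing [Fintype N] (hB : LinearIndependent ℤ B.column) {s : ClusterSeed ι}
    (hs : B.IsSeed s) : B.clusterAlgebra ≤ laurentRing s.x := by
  -- All seeds share one upper bound. A cluster variable lies in the upper bound of its own seed,
  -- hence in that of `s`.
  refine le_trans ?_ (fun f hf => (s.mem_upperBound.1 hf).1 : s.upperBound ≤ _)
  rw [hs.upperBound_eq hB]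
  refine Algebra.adjoin_le ?_
  rintro _ (⟨t, ht, e, rfl⟩ | ⟨e, he, rfl⟩)
  · have := t.mem_upperBound_x ht.algebraicIndependent e
    rwa [ht.upperBound_eq hB] at this
  · exact B.initialSeed.mem_upperBound_inv he

end ExtendedExchangeMatrix

/-! ### Intersections of Laurent rings. -/

section OneVariable

variable {K : Type} [Field K] [Algebra ℂ K]

lemma Transcendental.linearIndependent_zpow {F : IntermediateField ℂ K} {t : K}
    (ht : Transcendental F t) : LinearIndependent F (fun n : ℤ => t ^ n) := by
  have ht0 : t ≠ 0 := fun h => ht (h ▸ isAlgebraic_zero)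
  have hpow : LinearIndependent F (fun n : ℕ => t ^ n) := by
    have h := (Polynomial.basisMonomials F).linearIndependent.map_injOn
      (Polynomial.aeval t).toLinearMap (transcendental_iff_injective.1 ht).injOn
    convert! h using 1
    funext n
    simp
  rw [linearIndependent_iff']
  intro s c hc n hn
  let m : ℤ := ∑ i ∈ s, |i|
  have hm : ∀ i ∈ s, 0 ≤ i + m := fun i hi => by
    have := Finset.single_le_sum (f := fun i : ℤ => |i|) (fun i _ => abs_nonneg i) hi
    have := neg_abs_le i
    simp only [m]
    linarith
  have hinj : Function.Injective fun i : s => ((i : ℤ) + m).toNat := fun i j hij => by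
    have := hm i i.2
    have := hm j j.2
    have h : ((i : ℤ) + m).toNat = ((j : ℤ) + m).toNat := hij
    exact Subtype.ext (by omega)
  have hsum : ∑ i : s, c i • t ^ ((i : ℤ) + m).toNat = 0 := by
    rw [← zero_mul (t ^ m), ← hc, Finset.sum_mul, ← Finset.sum_coe_sort s]
    refine Finset.sum_congr rfl fun i _ => ?_
    rw [smul_mul_assoc, ← zpow_add₀ ht0, ← zpow_natCast, Int.toNat_of_nonneg (hm i i.2)]
  exact (Fintype.linearIndependent_iff.1 (hpow.comp _ hinj)) (fun i => c i) hsum ⟨n, hn⟩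

/-- Laurent polynomials in one variable over a subalgebra. -/
lemma exists_finsupp_of_mem_adjoin {D : Subalgebra ℂ K} {t : K} (ht : t ≠ 0) {f : K}
    (hf : f ∈ Algebra.adjoin ℂ ((D : Set K) ∪ {t, t⁻¹})) :
    ∃ a : ℤ →₀ D, f = a.sum fun n c => (c : K) * t ^ n := by
  let φ : AddMonoidAlgebra D ℤ →ₐ[D] K := AddMonoidAlgebra.lift D K ℤ
    { toFun := fun n => t ^ n.toAdd
      map_one' := zpow_zero t
      map_mul' := fun m n => zpow_add₀ ht m.toAdd n.toAdd }
  have hφ : ∀ n c, φ (AddMonoidAlgebra.single n c) = (c : K) * t ^ n := fun n c => by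
    simp only [φ]
    rw [AddMonoidAlgebra.lift_single, Algebra.smul_def]
    rfl
  have hle : Algebra.adjoin ℂ ((D : Set K) ∪ {t, t⁻¹}) ≤ φ.range.restrictScalars ℂ := by
    refine Algebra.adjoin_le ?_
    rintro z (hz | rfl | rfl)
    · exact ⟨AddMonoidAlgebra.single 0 ⟨z, hz⟩, by simpa using hφ 0 ⟨z, hz⟩⟩
    · exact ⟨AddMonoidAlgebra.single 1 1, by simpa using hφ 1 1⟩
    · exact ⟨AddMonoidAlgebra.single (-1) 1, by simpa using hφ (-1) 1⟩
  obtain ⟨a, rfl⟩ := hle hf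
  refine ⟨a.coeff, ?_⟩
  refine (AddMonoidAlgebra.lift_apply _ _).trans ?_
  refine Finsupp.sum_congr fun n _ => ?_
  rw [Algebra.smul_def]
  rfl

/-- In rank one, the upper bound is generated by the two cluster variables. -/
lemma mem_adjoin_of_mem_adjoin {F : IntermediateField ℂ K} {D : Subalgebra ℂ K}
    (hDF : D ≤ F.toSubalgebra) {t p : K} (ht : Transcendental F t) (hp : p ∈ D) (hp0 : p ≠ 0)
    {f : K} (h1 : f ∈ Algebra.adjoin ℂ ((D : Set K) ∪ {t, t⁻¹}))
    (h2 : f ∈ Algebra.adjoin ℂ ((D : Set K) ∪ {p / t, (p / t)⁻¹})) :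
    f ∈ Algebra.adjoin ℂ ((D : Set K) ∪ {t, p / t}) := by
  have ht0 : t ≠ 0 := fun h => ht (h ▸ isAlgebraic_zero)
  obtain ⟨a, ha⟩ := exists_finsupp_of_mem_adjoin ht0 h1
  obtain ⟨b, hb⟩ := exists_finsupp_of_mem_adjoin (div_ne_zero hp0 ht0) h2
  let pF : F := ⟨p, hDF hp⟩
  let ι : D → F := fun d => ⟨d, hDF d.2⟩
  -- Both expansions of f are Laurent polynomials in t over the field `F`, over which t is
  -- transcendental, so their coefficients at t^n agree.
  have key : ∀ n : ℤ, (a n : K) = b (-n) * p ^ (-n) := by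
    let s : Finset ℤ := a.support ∪ b.support.map (Equiv.neg ℤ).toEmbedding
    have hli := linearIndependent_iff'.1 ht.linearIndependent_zpow s
      (fun n => ι (a n) - ι (b (-n)) * pF ^ (-n)) ?_
    · intro n
      by_cases hn : n ∈ s
      · have := congrArg Subtype.val (hli n hn)
        exact sub_eq_zero.1 this
      · simp only [s, Finset.mem_union, Finset.mem_map_equiv, not_or, Finsupp.notMem_support_iff] at hn
        have h2 : b (-n) = 0 := hn.2
        rw [hn.1, h2]; simp
    · have e1 : f = ∑ n ∈ s, (a n : K) * t ^ n := by
        rw [ha, Finsupp.sum_of_support_subset _ Finset.subset_union_left _ (by simp)]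
      have e2 : f = ∑ n ∈ s, ((b (-n) : K) * p ^ (-n)) * t ^ n := by
        have : f = ∑ n ∈ s.map (Equiv.neg ℤ).toEmbedding, (b n : K) * (p / t) ^ n := by
          rw [hb, Finsupp.sum_of_support_subset _ _ _ (by simp)]
          intro n hn
          simp only [s, Finset.mem_map_equiv, Finset.mem_union]
          right
          simpa using hn
        rw [this, Finset.sum_map]
        refine Finset.sum_congr rfl fun n _ => ?_
        simp only [Equiv.coe_toEmbedding, Equiv.neg_apply]
        rw [div_zpow, zpow_neg t, div_inv_eq_mul, mul_assoc]
      rw [← sub_eq_zero.2 (e1.symm.trans e2), ← Finset.sum_sub_distrib]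
      refine Finset.sum_congr rfl fun n _ => ?_
      rw [← sub_mul, Algebra.smul_def]
      congr 1
  have hD : ∀ d : D, (d : K) ∈ Algebra.adjoin ℂ ((D : Set K) ∪ {t, p / t}) := fun d =>
    Algebra.subset_adjoin (Or.inl d.2)
  rw [ha]
  refine sum_mem fun n _ => ?_
  obtain ⟨m, rfl | rfl⟩ := n.eq_nat_or_neg
  · dsimp only
    rw [zpow_natCast]
    exact mul_mem (hD _) (pow_mem (Algebra.subset_adjoin (by simp)) m)
  · dsimp only
    -- A negative power t^(-m) has a coefficient divisible by p^m, and p^m t^(-m) = (p / t)^m.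
    rw [key, neg_neg, mul_assoc, zpow_neg, zpow_natCast, zpow_natCast, ← div_eq_mul_inv, ← div_pow]
    exact mul_mem (hD _) (pow_mem (Algebra.subset_adjoin (by simp)) m)

end OneVariable

section Mixed

variable {K E : Type} [Field K] [Algebra ℂ K] [Fintype E]

lemma adjoin_iUnion_eq (G : E → Set K) (e : E) :
    Algebra.adjoin ℂ (⋃ e', G e') =
      Algebra.adjoin ℂ ((Algebra.adjoin ℂ (⋃ e' ∈ ({e}ᶜ : Set E), G e') : Set K) ∪ G e) := by
  apply le_antisymm
  · refine Algebra.adjoin_le (Set.iUnion_subset fun e' z hz => ?_)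
    by_cases he : e' = e
    · subst he; exact Algebra.subset_adjoin (Or.inr hz)
    · exact Algebra.subset_adjoin (Or.inl (Algebra.subset_adjoin (Set.mem_biUnion he hz)))
  · refine Algebra.adjoin_le (Set.union_subset ?_ ?_)
    · exact Algebra.adjoin_mono (Set.iUnion₂_subset fun e' _ => Set.subset_iUnion G e')
    · exact (Set.subset_iUnion G e).trans Algebra.subset_adjoin

open Classical in
/-- The generators attached to an index: both `x e` and `y e` on `J`, the powers of `y e` on `M`
and the powers of `x e` elsewhere. -/
def mixedGenerators (x y : E → K) (J M : Finset E) (e : E) : Set K :=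
  if e ∈ J then {x e, y e} else if e ∈ M then {y e, (y e)⁻¹} else {x e, (x e)⁻¹}

/-- An element which is a Laurent polynomial in all the clusters obtained by replacing some of
the `x e` by `p e / x e`, for pairwise unrelated indices `e`, is a polynomial in the `x e` and
`p e / x e` and a Laurent polynomial in the other variables. -/
lemma mem_adjoin_mixedGenerators {x p : E → K} (hx : AlgebraicIndependent ℂ x) {T : Finset E}
    (hp : ∀ e ∈ T, p e ∈ Algebra.adjoin ℂ (⋃ e' ∈ ((T : Set E)ᶜ), {x e', (x e')⁻¹}))
    (hp0 : ∀ e ∈ T, p e ≠ 0) {f : K}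
    (hf : ∀ M ⊆ T, f ∈ Algebra.adjoin ℂ (⋃ e, mixedGenerators x (fun e => p e / x e) ∅ M e)) :
    f ∈ Algebra.adjoin ℂ (⋃ e, mixedGenerators x (fun e => p e / x e) T ∅ e) := by
  classical
  -- The indices in J are already settled, in that only x_e and y_e occur for them and no inverses.
  -- Outside J every choice M of toggled indices is kept available, so that the induction can use
  -- both positions of the next index.
  suffices h : ∀ J ⊆ T, ∀ M ⊆ T \ J,
      f ∈ Algebra.adjoin ℂ (⋃ e, mixedGenerators x (fun e => p e / x e) J M e) from
    h T subset_rfl ∅ (Finset.empty_subset _)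
  intro J
  induction J using Finset.induction with
  | empty => exact fun _ M hM => hf M (by simpa using hM)
  | insert e J heJ ih =>
    intro hJ M hM
    have heT : e ∈ T := hJ (Finset.mem_insert_self e J)
    have heM : e ∉ M := fun h => by simpa using (Finset.mem_sdiff.1 (hM h)).2
    have hJT : J ⊆ T := (Finset.subset_insert e J).trans hJ
    have hMJ : M ⊆ T \ J := hM.trans (Finset.sdiff_subset_sdiff subset_rfl (Finset.subset_insert e J))
    have h1 := ih hJT M hMJ
    have h2 := ih hJT (insert e M) (Finset.insert_subset (Finset.mem_sdiff.2 ⟨heT, heJ⟩) hMJ)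
    set y : E → K := fun e => p e / x e with hy
    have hG : ∀ J' M', (J' = J ∨ J' = insert e J) → (M' = M ∨ M' = insert e M) →
        ∀ e' ∈ ({e}ᶜ : Set E), mixedGenerators x y J' M' e' = mixedGenerators x y J M e' := by
      rintro J' M' (rfl | rfl) (rfl | rfl) e' he' <;>
        simp [mixedGenerators, Finset.mem_insert, show e' ≠ e from he']
    have hU : ∀ J' M', (J' = J ∨ J' = insert e J) → (M' = M ∨ M' = insert e M) →
        (⋃ e' ∈ ({e}ᶜ : Set E), mixedGenerators x y J' M' e') =
          ⋃ e' ∈ ({e}ᶜ : Set E), mixedGenerators x y J M e' := fun J' M' hJ' hM' =>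
      Set.iUnion₂_congr (hG J' M' hJ' hM')
    rw [adjoin_iUnion_eq _ e] at h1 h2 ⊢
    rw [hU _ _ (Or.inl rfl) (Or.inr rfl),
      show mixedGenerators x y J (insert e M) e = {y e, (y e)⁻¹} by
        simp [mixedGenerators, heJ]] at h2
    rw [show mixedGenerators x y J M e = {x e, (x e)⁻¹} by simp [mixedGenerators, heJ, heM]] at h1
    rw [hU _ _ (Or.inr rfl) (Or.inl rfl),
      show mixedGenerators x y (insert e J) M e = {x e, y e} by simp [mixedGenerators]]
    have hxF : ∀ e' ≠ e, x e' ∈ IntermediateField.adjoin ℂ (x '' {e}ᶜ) := fun e' he' =>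
      IntermediateField.subset_adjoin ℂ _ (Set.mem_image_of_mem x he')
    have hpF : ∀ e' ∈ T, p e' ∈ IntermediateField.adjoin ℂ (x '' {e}ᶜ) := fun e' he' => by
      have hle : Algebra.adjoin ℂ (⋃ e' ∈ ((T : Set E)ᶜ), {x e', (x e')⁻¹}) ≤
          (IntermediateField.adjoin ℂ (x '' {e}ᶜ)).toSubalgebra := by
        refine Algebra.adjoin_le (Set.iUnion₂_subset fun i hi => ?_)
        have hie : i ≠ e := fun h => hi (h ▸ heT)
        rintro z (rfl | rfl)
        · exact hxF i hie
        · exact IntermediateField.inv_mem _ (hxF i hie)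
      exact hle (hp e' he')
    -- The two positions of e differ only in the generators at e, so the one-variable statement
    -- applies over the algebra generated at the other indices. That algebra avoids x_e because no p
    -- with index in T involves a variable of T.
    refine mem_adjoin_of_mem_adjoin (F := IntermediateField.adjoin ℂ (x '' {e}ᶜ)) ?_
      (hx.transcendental_intermediateField e) ?_ (hp0 e heT) h1 h2
    · refine Algebra.adjoin_le (Set.iUnion₂_subset fun i hi => ?_)
      have hyF : i ∈ T → y i ∈ IntermediateField.adjoin ℂ (x '' {e}ᶜ) := fun hiT =>
        div_mem (hpF i hiT) (hxF i hi)
      intro z hz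
      simp only [mixedGenerators] at hz
      split_ifs at hz with h h'
      · obtain rfl | rfl := hz
        · exact hxF i hi
        · exact hyF (hJT h)
      · have hiT := (Finset.mem_sdiff.1 (hMJ h')).1
        obtain rfl | rfl := hz
        · exact hyF hiT
        · exact IntermediateField.inv_mem _ (hyF hiT)
      · obtain rfl | rfl := hz
        · exact hxF i hi
        · exact IntermediateField.inv_mem _ (hxF i hi)
    · refine Algebra.adjoin_mono (Set.iUnion₂_subset fun i hi => ?_) (hp e heT)
      have hiT : i ∉ T := hi
      have hie : i ∈ ({e}ᶜ : Set E) := fun h => hiT (by rw [Set.mem_singleton_iff.1 h]; exact heT)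
      have : mixedGenerators x y J M i = {x i, (x i)⁻¹} := by
        rw [mixedGenerators, if_neg fun h => hiT (hJT h),
          if_neg fun h => hiT (Finset.mem_sdiff.1 (hMJ h)).1]
      rw [← this]
      exact Set.subset_biUnion_of_mem (u := fun i => mixedGenerators x y J M i) hie

end Mixed

/-! ### Toggling the variables of an anticlique. -/

namespace ExtendedExchangeMatrix

variable {E N : Type} [Fintype E] {ι : N ↪ E} (B : ExtendedExchangeMatrix ι)

/-- The cluster variable obtained from the initial seed by one mutation. -/
def oppositeVariable (i : N) : AmbientField E := (B.initialSeed.mutate i).x (ι i)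

lemma initialSeed_mul_oppositeVariable (i : N) :
    B.initialSeed.x (ι i) * B.oppositeVariable i = B.initialSeed.exchange i := by
  rw [oppositeVariable, ClusterSeed.mutate_x_self,
    mul_div_cancel₀ _ (B.algebraicIndependent_initialSeed.ne_zero _)]

lemma isSeed_initialSeed : B.IsSeed B.initialSeed := Relation.ReflTransGen.refl

variable {B} in
lemma IsSeed.mutate {s : ClusterSeed ι} (hs : B.IsSeed s) (k : N) : B.IsSeed (s.mutate k) :=
  Relation.ReflTransGen.tail hs ⟨k, rfl⟩

/-- There are no edges between the indices in `I`. -/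
def IsIndependent (I : Finset N) : Prop := ∀ i ∈ I, ∀ j ∈ I, B.column j (ι i) = 0

/-- The seed `s` arises from the initial one by exchanging the variables in `M`, a set of pairwise
unrelated indices. -/
structure IsFlip (I M : Finset N) (s : ClusterSeed ι) : Prop where
  flipped : ∀ i ∈ M, s.x (ι i) = B.oppositeVariable i
  fixed : ∀ e, (∀ i ∈ M, e ≠ ι i) → s.x e = B.initialSeed.x e
  column : ∀ i ∈ I, s.B.column i = B.column i ∨ s.B.column i = -B.column i

variable {B}

/-- The toggled variables do not occur in the exchange polynomial, and a change of sign of the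
column only swaps its two monomials. -/
lemma IsFlip.exchange_eq {I M : Finset N} {s : ClusterSeed ι} (hI : B.IsIndependent I)
    (hM : M ⊆ I) (hs : B.IsFlip I M s) {k : N} (hk : k ∈ I) :
    s.exchange k = B.initialSeed.exchange k := by
  have h : ∀ n : E → ℕ, (∀ i ∈ I, n (ι i) = 0) →
      ∏ e, s.x e ^ n e = ∏ e, B.initialSeed.x e ^ n e := fun n hn => by
    refine Finset.prod_congr rfl fun e _ => ?_
    by_cases he : ∀ i ∈ M, e ≠ ι i
    · rw [hs.fixed e he]
    · push Not at he
      obtain ⟨i, hi, rfl⟩ := he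
      rw [hn i (hM hi), pow_zero, pow_zero]
  have h0 : ∀ i ∈ I, B.initialSeed.B.mat (ι i) k = 0 := fun i hi => hI i hi k hk
  rcases hs.column k hk with hc | hc
  · have h1 : ∀ e, s.B.mat e k = B.initialSeed.B.mat e k := congrFun hc
    rw [ClusterSeed.exchange, ClusterSeed.exchange]
    simp only [h1]
    rw [h _ fun i hi => by simp [h0 i hi], h _ fun i hi => by simp [h0 i hi]]
  · have h1 : ∀ e, s.B.mat e k = -B.initialSeed.B.mat e k := congrFun hc
    rw [ClusterSeed.exchange, ClusterSeed.exchange, add_comm]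
    simp only [h1, neg_neg]
    rw [h _ fun i hi => by simp [h0 i hi], h _ fun i hi => by simp [h0 i hi]]

/-- Mutation at k toggles k: the exchange polynomial P stays the same, so x becomes P / x, and a
second mutation returns P / (P / x) = x. -/
lemma IsFlip.exists_mutate [DecidableEq N] {I M : Finset N} {s : ClusterSeed ι}
    (hI : B.IsIndependent I) (hM : M ⊆ I) (hs : B.IsFlip I M s) {k : N} (hk : k ∈ I) :
    B.IsFlip I (if k ∈ M then M.erase k else insert k M) (s.mutate k) := by
  have hex := hs.exchange_eq hI hM hk
  have hcol : ∀ i ∈ I, (s.mutate k).B.column i = B.column i ∨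
      (s.mutate k).B.column i = -B.column i := fun i hi => by
    by_cases hik : i = k
    · subst hik
      rw [show (s.mutate i).B.column i = -s.B.column i from s.B.column_mutate_self i]
      rcases hs.column i hi with h | h <;> simp [h]
    · have h0 : s.B.column i (ι k) = 0 := by
        rcases hs.column i hi with h | h <;> simp [h, hI k hk i hi]
      rw [(s.mutate_x_mutate_of_column_eq_zero hik h0).1]
      exact hs.column i hi
  by_cases hkM : k ∈ M
  · rw [if_pos hkM]
    refine ⟨fun i hi => ?_, fun e he => ?_, hcol⟩
    · rw [s.mutate_x_of_ne fun h => Finset.ne_of_mem_erase hi (ι.injective h)]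
      exact hs.flipped i (Finset.mem_of_mem_erase hi)
    · by_cases hek : e = ι k
      · subst hek
        have hx := B.algebraicIndependent_initialSeed
        rw [ClusterSeed.mutate_x_self, hex, hs.flipped k hkM, oppositeVariable,
          ClusterSeed.mutate_x_self, div_div_cancel₀ (ClusterSeed.exchange_ne_zero _ hx k)]
      · rw [s.mutate_x_of_ne hek]
        refine hs.fixed e fun i hi h => he i (Finset.mem_erase.2 ⟨?_, hi⟩) h
        rintro rfl
        exact hek h
  · rw [if_neg hkM]
    refine ⟨fun i hi => ?_, fun e he => ?_, hcol⟩
    · rcases Finset.mem_insert.1 hi with rfl | hi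
      · rw [ClusterSeed.mutate_x_self, hex, hs.fixed (ι i) fun j hj h =>
          hkM (by rwa [ι.injective h]), oppositeVariable, ClusterSeed.mutate_x_self]
      · rw [s.mutate_x_of_ne fun h => hkM (by rwa [← ι.injective h])]
        exact hs.flipped i hi
    · rw [s.mutate_x_of_ne (he k (Finset.mem_insert_self k M))]
      exact hs.fixed e fun i hi => he i (Finset.mem_insert_of_mem hi)

variable (B) in
lemma isFlip_initialSeed (I : Finset N) : B.IsFlip I ∅ B.initialSeed :=
  ⟨fun _ h => by simp at h, fun _ _ => rfl, fun _ _ => Or.inl rfl⟩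

lemma exists_isSeed_isFlip {I : Finset N} (hI : B.IsIndependent I) {M : Finset N} (hM : M ⊆ I) :
    ∃ s, B.IsSeed s ∧ B.IsFlip I M s := by
  classical
  induction M using Finset.induction with
  | empty => exact ⟨_, B.isSeed_initialSeed, B.isFlip_initialSeed I⟩
  | insert k M hk ih =>
    obtain ⟨s, hs, hf⟩ := ih ((Finset.subset_insert k M).trans hM)
    refine ⟨s.mutate k, hs.mutate k, ?_⟩
    have := hf.exists_mutate hI ((Finset.subset_insert k M).trans hM)
      (hM (Finset.mem_insert_self k M))
    rwa [if_neg hk] at this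

lemma IsSeed.exists_isFlip [Fintype N] (hI : B.IsIndependent Finset.univ) {s : ClusterSeed ι}
    (hs : B.IsSeed s) : ∃ M, B.IsFlip Finset.univ M s := by
  classical
  induction hs with
  | refl => exact ⟨∅, B.isFlip_initialSeed _⟩
  | tail _ h ih =>
    obtain ⟨k, rfl⟩ := h
    obtain ⟨M, hM⟩ := ih
    exact ⟨_, hM.exists_mutate hI (Finset.subset_univ M) (Finset.mem_univ k)⟩

lemma initialSeed_mem_clusterVariables (e : E) : B.initialSeed.x e ∈ B.clusterVariables :=
  ⟨_, B.isSeed_initialSeed, e, rfl⟩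

lemma oppositeVariable_mem_clusterVariables (i : N) :
    B.oppositeVariable i ∈ B.clusterVariables :=
  ⟨_, B.isSeed_initialSeed.mutate i, ι i, rfl⟩

/-- Without edges every seed is obtained by toggling, so each mutable index contributes just two
variables. -/
lemma clusterVariables_eq [Fintype N] (hI : B.IsIndependent Finset.univ) :
    B.clusterVariables = Set.range B.initialSeed.x ∪ Set.range B.oppositeVariable := by
  apply Set.Subset.antisymm
  · rintro _ ⟨s, hs, e, rfl⟩
    obtain ⟨M, hM⟩ := hs.exists_isFlip hI
    by_cases he : ∀ i ∈ M, e ≠ ι i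
    · exact Or.inl ⟨e, (hM.fixed e he).symm⟩
    · push Not at he
      obtain ⟨i, hi, rfl⟩ := he
      exact Or.inr ⟨i, (hM.flipped i hi).symm⟩
  · rintro _ (⟨e, rfl⟩ | ⟨i, rfl⟩)
    · exact initialSeed_mem_clusterVariables e
    · exact oppositeVariable_mem_clusterVariables i

/-- The generators of the cluster algebra of a matrix without edges. -/
lemma clusterAlgebra_eq_adjoin [Fintype N] (hI : B.IsIndependent Finset.univ) :
    B.clusterAlgebra = Algebra.adjoin ℂ (Set.range B.initialSeed.x ∪ Set.range B.oppositeVariable ∪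
      {z | ∃ e, e ∉ Set.range ι ∧ z = (B.initialSeed.x e)⁻¹}) := by
  rw [clusterAlgebra, clusterVariables_eq hI]

lemma inv_mem_clusterAlgebra {e : E} (he : e ∉ Set.range ι) :
    (B.initialSeed.x e)⁻¹ ∈ B.clusterAlgebra :=
  Algebra.subset_adjoin (Or.inr ⟨e, he, rfl⟩)

lemma initialSeed_mem_clusterAlgebra (e : E) : B.initialSeed.x e ∈ B.clusterAlgebra :=
  Algebra.subset_adjoin (Or.inl (initialSeed_mem_clusterVariables e))

lemma oppositeVariable_mem_clusterAlgebra (i : N) : B.oppositeVariable i ∈ B.clusterAlgebra :=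
  Algebra.subset_adjoin (Or.inl (oppositeVariable_mem_clusterVariables i))

lemma isIndependent_restrict {I : Finset N} (hI : B.IsIndependent I) :
    (B.restrict I).IsIndependent Finset.univ := fun i _ j _ => hI i.1 i.2 j.1 j.2

/-- The cluster algebra is contained in the cluster algebra for a set of pairwise unrelated
indices. -/
lemma clusterAlgebra_le_restrict [Fintype N] (hB : LinearIndependent ℤ B.column) {I : Finset N}
    (hI : B.IsIndependent I) : B.clusterAlgebra ≤ (B.restrict I).clusterAlgebra := by
  classical
  intro f hf
  have hx := B.algebraicIndependent_initialSeed
  let p : E → AmbientField E := Function.extend ι B.initialSeed.exchange 1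
  have hpι : ∀ i, p (ι i) = B.initialSeed.exchange i := fun i => ι.injective.extend_apply _ _ i
  have hyι : ∀ i, p (ι i) / B.initialSeed.x (ι i) = B.oppositeVariable i := fun i => by
    rw [hpι, oppositeVariable, ClusterSeed.mutate_x_self]
  have key : f ∈ Algebra.adjoin ℂ (⋃ e, mixedGenerators B.initialSeed.x
      (fun e => p e / B.initialSeed.x e) (I.map ι) ∅ e) := by
    refine mem_adjoin_mixedGenerators hx ?_ ?_ ?_
    · intro e he
      obtain ⟨k, hk, rfl⟩ := Finset.mem_map.1 he
      have h : ∀ n : E → ℕ, (∀ i ∈ I, n (ι i) = 0) → ∏ e, B.initialSeed.x e ^ n e ∈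
          Algebra.adjoin ℂ (⋃ e' ∈ (((I.map ι : Finset E) : Set E)ᶜ),
            {B.initialSeed.x e', (B.initialSeed.x e')⁻¹}) := fun n hn => by
        refine prod_mem fun e _ => ?_
        by_cases he : e ∈ I.map ι
        · obtain ⟨i, hi, rfl⟩ := Finset.mem_map.1 he
          rw [hn i hi, pow_zero]; exact one_mem _
        · exact pow_mem (Algebra.subset_adjoin (Set.mem_biUnion
            (show e ∈ (((I.map ι : Finset E) : Set E)ᶜ) from he) (Or.inl rfl))) _
      have h0 : ∀ i ∈ I, B.initialSeed.B.mat (ι i) k = 0 := fun i hi => hI i hi k hk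
      rw [hpι]
      exact add_mem (h _ fun i hi => by simp [h0 i hi]) (h _ fun i hi => by simp [h0 i hi])
    · intro e he
      obtain ⟨k, hk, rfl⟩ := Finset.mem_map.1 he
      rw [hpι]
      exact ClusterSeed.exchange_ne_zero _ hx k
    · intro M hM
      obtain ⟨M', hM', rfl⟩ := Finset.subset_map_iff.1 hM
      obtain ⟨s, hs, hflip⟩ := exists_isSeed_isFlip hI hM'
      refine (?_ : laurentRing s.x ≤ _) (clusterAlgebra_le_laurentRing hB hs hf)
      have hgen : ∀ e, mixedGenerators B.initialSeed.x (fun e => p e / B.initialSeed.x e) ∅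
          (M'.map ι) e = {s.x e, (s.x e)⁻¹} := fun e => by
        by_cases he : e ∈ M'.map ι
        · obtain ⟨i, hi, rfl⟩ := Finset.mem_map.1 he
          simp only [mixedGenerators, Finset.notMem_empty, if_false, if_pos he, hyι,
            hflip.flipped i hi]
        · simp only [mixedGenerators, Finset.notMem_empty, if_false, if_neg he]
          rw [hflip.fixed e fun i hi h => he (Finset.mem_map.2 ⟨i, hi, h.symm⟩)]
      simp only [hgen]
      refine Algebra.adjoin_le ?_
      rintro _ (⟨e, rfl⟩ | ⟨e, rfl⟩)
      · exact Algebra.subset_adjoin (Set.mem_iUnion.2 ⟨e, Or.inl rfl⟩)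
      · exact Algebra.subset_adjoin (Set.mem_iUnion.2 ⟨e, Or.inr rfl⟩)
  refine (Algebra.adjoin_le (Set.iUnion_subset fun e => ?_) : _ ≤ (B.restrict I).clusterAlgebra) key
  by_cases he : e ∈ I.map ι
  · obtain ⟨i, hi, rfl⟩ := Finset.mem_map.1 he
    simp only [mixedGenerators, if_pos he, hyι]
    rintro _ (rfl | rfl)
    · exact initialSeed_mem_clusterAlgebra (B := B.restrict I) (ι i)
    · exact oppositeVariable_mem_clusterAlgebra (B := B.restrict I) ⟨i, hi⟩
  · simp only [mixedGenerators, if_neg he, Finset.notMem_empty, if_false]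
    rintro _ (rfl | rfl)
    · exact initialSeed_mem_clusterAlgebra (B := B.restrict I) e
    · refine inv_mem_clusterAlgebra (B := B.restrict I) ?_
      rintro ⟨i, rfl⟩
      exact he (Finset.mem_map_of_mem ι i.2)

end ExtendedExchangeMatrix

/-! ### The stratum as a quotient of the cluster algebra of the anticlique. -/

namespace ExtendedExchangeMatrix

variable {E N : Type} [Fintype E] [Fintype N] {ι : N ↪ E} {B : ExtendedExchangeMatrix ι}

lemma coe_outerProduct [DecidableEq N] (I : Finset N) :
    (B.outerProduct I : AmbientField E) = ∏ j ∈ Iᶜ, B.initialSeed.x (ι j) := by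
  rw [outerProduct, ← Subalgebra.coe_val, map_prod]
  rfl

lemma restrict_initialSeed_x (I : Finset N) :
    (B.restrict I).initialSeed.x = B.initialSeed.x := rfl

lemma inv_mem_clusterAlgebra_restrict {I : Finset N} {j : N} (hj : j ∉ I) :
    (B.initialSeed.x (ι j))⁻¹ ∈ (B.restrict I).clusterAlgebra :=
  inv_mem_clusterAlgebra (B := B.restrict I) (by
    rintro ⟨i, hi⟩
    exact hj (by rw [← ι.injective hi]; exact i.2))

/-- The only generators possibly missing from the smaller algebra are the inverses of the mutable
variables outside I, and each of these is cleared by one factor of the outer product. -/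
lemma exists_mul_outerProduct_pow_mem [DecidableEq N] {I : Finset N} (hI : B.IsIndependent I)
    {z : AmbientField E} (hz : z ∈ (B.restrict I).clusterAlgebra) :
    ∃ n : ℕ, z * (B.outerProduct I : AmbientField E) ^ n ∈ B.clusterAlgebra := by
  have hx := B.algebraicIndependent_initialSeed.ne_zero
  have hO := (B.outerProduct I).2
  rw [clusterAlgebra_eq_adjoin (isIndependent_restrict hI), restrict_initialSeed_x] at hz
  generalize hw : (B.outerProduct I : AmbientField E) = w at hO ⊢
  rw [coe_outerProduct] at hw
  induction hz using Algebra.adjoin_induction with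
  | mem z hz =>
    rcases hz with (⟨e, rfl⟩ | ⟨i, rfl⟩) | ⟨e, he, rfl⟩
    · refine ⟨0, ?_⟩
      rw [pow_zero, mul_one]
      exact initialSeed_mem_clusterAlgebra e
    · refine ⟨0, ?_⟩
      rw [pow_zero, mul_one]
      exact oppositeVariable_mem_clusterAlgebra i.1
    · by_cases hr : e ∈ Set.range ι
      · obtain ⟨j, rfl⟩ := hr
        have hj : j ∈ Iᶜ := Finset.mem_compl.2 fun hj => he ⟨⟨j, hj⟩, rfl⟩
        refine ⟨1, ?_⟩
        rw [pow_one, ← hw, ← Finset.mul_prod_erase _ _ hj, inv_mul_cancel_left₀ (hx _)]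
        exact prod_mem fun i _ => initialSeed_mem_clusterAlgebra _
      · refine ⟨0, ?_⟩
        rw [pow_zero, mul_one]
        exact inv_mem_clusterAlgebra hr
  | algebraMap c =>
    refine ⟨0, ?_⟩
    rw [pow_zero, mul_one]
    exact Subalgebra.algebraMap_mem _ c
  | add f g _ _ hf hg =>
    obtain ⟨m, hm⟩ := hf
    obtain ⟨n, hn⟩ := hg
    refine ⟨m + n, ?_⟩
    have h : (f + g) * w ^ (m + n) = f * w ^ m * w ^ n + g * w ^ n * w ^ m := by ring
    rw [h]
    exact add_mem (mul_mem hm (pow_mem hO n)) (mul_mem hn (pow_mem hO m))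
  | mul f g _ _ hf hg =>
    obtain ⟨m, hm⟩ := hf
    obtain ⟨n, hn⟩ := hg
    refine ⟨m + n, ?_⟩
    have h : f * g * w ^ (m + n) = f * w ^ m * (g * w ^ n) := by ring
    rw [h]
    exact mul_mem hm hn

/-- Inverting the outer variables turns the cluster algebra into the cluster algebra for a set
of pairwise unrelated indices. -/
theorem isLocalization_away_outerProduct [DecidableEq N] (hB : LinearIndependent ℤ B.column)
    {I : Finset N} (hI : B.IsIndependent I) :
    letI := (Subalgebra.inclusion (clusterAlgebra_le_restrict hB hI)).toRingHom.toAlgebra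
    IsLocalization.Away (B.outerProduct I) (B.restrict I).clusterAlgebra := by
  let _ := (Subalgebra.inclusion (clusterAlgebra_le_restrict hB hI)).toRingHom.toAlgebra
  have hx := B.algebraicIndependent_initialSeed.ne_zero
  have hcoe : ∀ a : B.clusterAlgebra, ((algebraMap B.clusterAlgebra
      (B.restrict I).clusterAlgebra a : (B.restrict I).clusterAlgebra) : AmbientField E) = a :=
    fun a => (congrArg Subtype.val (DFunLike.congr_fun (RingHom.algebraMap_toAlgebra
      (Subalgebra.inclusion (clusterAlgebra_le_restrict hB hI)).toRingHom) a)).trans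
      (Subalgebra.coe_inclusion (h := clusterAlgebra_le_restrict hB hI) a)
  have hne : (B.outerProduct I : AmbientField E) ≠ 0 := by
    rw [coe_outerProduct]; exact Finset.prod_ne_zero_iff.2 fun _ _ => hx _
  have hinv : (B.outerProduct I : AmbientField E)⁻¹ ∈ (B.restrict I).clusterAlgebra := by
    rw [coe_outerProduct, ← Finset.prod_inv_distrib]
    exact prod_mem fun j hj => inv_mem_clusterAlgebra_restrict (Finset.mem_compl.1 hj)
  refine IsLocalization.Away.mk _ ?_ ?_ ?_
  · refine IsUnit.of_mul_eq_one (⟨_, hinv⟩ : (B.restrict I).clusterAlgebra) (Subtype.ext ?_)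
    rw [Subalgebra.coe_mul, hcoe, Subalgebra.coe_one]
    exact mul_inv_cancel₀ hne
  · rintro ⟨z, hz⟩
    obtain ⟨n, hn⟩ := exists_mul_outerProduct_pow_mem hI hz
    refine ⟨n, ⟨_, hn⟩, Subtype.ext ?_⟩
    rw [Subalgebra.coe_mul, Subalgebra.coe_pow, hcoe, hcoe]
  · intro a b hab
    refine ⟨0, ?_⟩
    rw [Subtype.ext ((hcoe a).symm.trans ((congrArg Subtype.val hab).trans (hcoe b)))]

variable (B) in
/-- The ideal generated by the initial mutable variables. -/
def mutableIdeal : Ideal B.clusterAlgebra :=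
  Ideal.span (Set.range fun i : N => B.initialVariable (ι i))

/-- The coordinate ring of the stratum only depends on the columns indexed by `I`. -/
theorem nonempty_stratumRing_algEquiv [DecidableEq N] (hB : LinearIndependent ℤ B.column)
    {I : Finset N} (hI : B.IsIndependent I) :
    Nonempty (B.StratumRing I ≃ₐ[ℂ]
      (B.restrict I).clusterAlgebra ⧸ (B.restrict I).mutableIdeal) := by
  let _ := (Subalgebra.inclusion (clusterAlgebra_le_restrict hB hI)).toRingHom.toAlgebra
  have : IsScalarTower ℂ B.clusterAlgebra (B.restrict I).clusterAlgebra :=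
    IsScalarTower.of_algebraMap_eq fun _ => rfl
  have := isLocalization_away_outerProduct hB hI
  let e := IsLocalization.algEquiv (Submonoid.powers (B.outerProduct I))
    (Localization.Away (B.outerProduct I)) (B.restrict I).clusterAlgebra
  refine ⟨Ideal.quotientEquivAlg _ _ (e.restrictScalars ℂ) ?_⟩
  rw [stratumIdeal, mutableIdeal, Ideal.map_span, ← Set.image_comp]
  congr 1
  ext z
  constructor
  · rintro ⟨i, rfl⟩
    refine ⟨i.1, i.2, ?_⟩
    exact e.commutes (B.initialVariable (ι i))
  · rintro ⟨i, hi, rfl⟩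
    refine ⟨⟨i, hi⟩, ?_⟩
    exact (e.commutes (B.initialVariable (ι i))).symm

end ExtendedExchangeMatrix

/-! ### Characters of abelian groups. -/

section Characters

/-- Homomorphisms into the multiplicative group of an algebraically closed field extend. -/
lemma exists_addMonoidHom_comp_eq {M M' : Type*} [AddCommGroup M] [AddCommGroup M']
    (f : M →+ M') (hf : Function.Injective f) (g : M →+ Additive ℂˣ) :
    ∃ h : M' →+ Additive ℂˣ, h.comp f = g := by
  -- Roots exist in ℂ, so ℂˣ is divisible, hence injective as an abelian group by Baer's criterion.
  have hsurj : ∀ {n : ℕ}, n ≠ 0 → Function.Surjective fun a : Additive ℂˣ => n • a := by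
    intro n hn a
    obtain ⟨z, hz⟩ := IsAlgClosed.exists_pow_nat_eq (a.toMul : ℂ) (Nat.pos_of_ne_zero hn)
    have hz0 : z ≠ 0 := by
      rintro rfl
      rw [zero_pow hn] at hz
      exact a.toMul.ne_zero hz.symm
    exact ⟨Additive.ofMul (Units.mk0 z hz0), Additive.toMul.injective (Units.ext (by simpa using hz))⟩
  let _ : DivisibleBy (Additive ℂˣ) ℕ := divisibleByOfSMulRightSurj _ _ hsurj
  let _ : DivisibleBy (Additive ℂˣ) ℤ := AddGroup.divisibleByIntOfDivisibleByNat _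
  exact (Module.Baer.of_divisible (Additive ℂˣ)).extension_property_addMonoidHom f hf g

lemma LinearIndependent.exists_character_apply_eq {κ M : Type*} [AddCommGroup M] {v : κ → M}
    (hv : LinearIndependent ℤ v) (c : κ → Additive ℂˣ) :
    ∃ χ : M →+ Additive ℂˣ, ∀ k, χ (v k) = c k := by
  obtain ⟨χ, hχ⟩ := exists_addMonoidHom_comp_eq
    (Finsupp.linearCombination ℤ v).toAddMonoidHom hv
    (Finsupp.linearCombination ℤ c).toAddMonoidHom
  refine ⟨χ, fun k => ?_⟩
  have := DFunLike.congr_fun hχ (Finsupp.single k 1)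
  simpa using this

/-- Characters with values in `ℂˣ` separate the points of an abelian group. -/
lemma exists_character_apply_ne_zero {M : Type*} [AddCommGroup M] {a : M} (ha : a ≠ 0) :
    ∃ χ : M →+ Additive ℂˣ, χ a ≠ 0 := by
  obtain ⟨c, hc⟩ := CharacterModule.exists_character_apply_ne_zero_of_ne_zero ha
  -- The map q ↦ exp(2πi q) has kernel ℤ and so embeds ℚ/ℤ into ℂˣ, which transfers the separation
  -- of points by ℚ/ℤ-valued characters.
  let e : ℚ →+ Additive ℂˣ :=
    { toFun := fun q => Additive.ofMul (Units.mk0 (Complex.exp (q * (2 * Real.pi * Complex.I)))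
        (Complex.exp_ne_zero _))
      map_zero' := Additive.toMul.injective (Units.ext (by simp))
      map_add' := fun p q => Additive.toMul.injective (Units.ext (by
        simp [add_mul, Complex.exp_add])) }
  have he : ∀ q, e q = 0 ↔ (q : AddCircle (1 : ℚ)) = 0 := fun q => by
    have h1 : e q = 0 ↔ Complex.exp (q * (2 * Real.pi * Complex.I)) = 1 := by
      rw [← Additive.toMul.injective.eq_iff, ← Units.val_injective.eq_iff]
      rfl
    rw [h1, Complex.exp_eq_one_iff, AddCircle.coe_eq_zero_iff]
    refine exists_congr fun n => ?_
    rw [mul_left_inj' Complex.two_pi_I_ne_zero, zsmul_one]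
    norm_cast
    exact eq_comm
  let e' : AddCircle (1 : ℚ) →+ Additive ℂˣ := QuotientAddGroup.lift _ e (by
    intro q hq
    exact (he q).2 ((QuotientAddGroup.eq_zero_iff q).2 hq))
  refine ⟨e'.comp c, fun h => hc ?_⟩
  obtain ⟨q, hq⟩ := QuotientAddGroup.mk_surjective (c a)
  change e' (c a) = 0 at h
  rw [← hq] at h ⊢
  exact (he q).1 h

/-- The homomorphism from a group algebra determined by a homomorphism into the units. -/
def AddMonoidAlgebra.liftUnits {Y A : Type*} [AddCommGroup Y] [CommRing A] [Algebra ℂ A]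
    (χ : Y →+ Additive Aˣ) : AddMonoidAlgebra ℂ Y →ₐ[ℂ] A :=
  AddMonoidAlgebra.lift ℂ A Y ((Units.coeHom A).comp (AddMonoidHom.toMultiplicativeLeft χ))

lemma AddMonoidAlgebra.liftUnits_single {Y A : Type*} [AddCommGroup Y] [CommRing A] [Algebra ℂ A]
    (χ : Y →+ Additive Aˣ) (y : Y) (c : ℂ) :
    AddMonoidAlgebra.liftUnits χ (AddMonoidAlgebra.single y c) = c • ((χ y).toMul : A) := by
  rw [liftUnits, AddMonoidAlgebra.lift_single]
  rfl

end Characters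

/-! ### The cluster algebra without edges modulo its mutable variables. -/

/-- The homomorphism of group algebras given by a homomorphism of groups and a character. -/
def AddMonoidAlgebra.twistHom {M Y : Type*} [AddCommGroup M] [AddCommGroup Y] (π : M →+ Y)
    (χ : M →+ Additive ℂˣ) : AddMonoidAlgebra ℂ M →ₐ[ℂ] AddMonoidAlgebra ℂ Y :=
  AddMonoidAlgebra.lift ℂ (AddMonoidAlgebra ℂ Y) M
    { toFun := fun g => AddMonoidAlgebra.single (π g.toAdd) ((χ g.toAdd).toMul : ℂ)
      map_one' := by simp [AddMonoidAlgebra.one_def]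
      map_mul' := fun g h => by simp [AddMonoidAlgebra.single_mul_single] }

lemma AddMonoidAlgebra.twistHom_single {M Y : Type*} [AddCommGroup M] [AddCommGroup Y] (π : M →+ Y)
    (χ : M →+ Additive ℂˣ) (g : M) (c : ℂ) :
    AddMonoidAlgebra.twistHom π χ (AddMonoidAlgebra.single g c) =
      AddMonoidAlgebra.single (π g) (c * ((χ g).toMul : ℂ)) := by
  rw [twistHom, AddMonoidAlgebra.lift_single]
  exact AddMonoidAlgebra.smul_single _ _ _

/-- The source of homomorphisms out of a cluster algebra: by the Laurent phenomenon it sits in a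
copy of a group algebra, on which homomorphisms are given by characters. -/
lemma AlgHom.exists_eq_of_le_range {S K T : Type*} [CommRing S] [CommRing K] [CommRing T]
    [Algebra ℂ S] [Algebra ℂ K] [Algebra ℂ T] (φ : S →ₐ[ℂ] K) (hφ : Function.Injective φ)
    {A : Subalgebra ℂ K} (hA : A ≤ φ.range) (ψ : S →ₐ[ℂ] T) :
    ∃ Ψ : A →ₐ[ℂ] T, ∀ (a : A) (f : S), φ f = a → Ψ a = ψ f := by
  let e := AlgEquiv.ofInjective φ hφ
  refine ⟨(ψ.comp e.symm.toAlgHom).comp (Subalgebra.inclusion hA), fun a f h => ?_⟩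
  have h2 : Subalgebra.inclusion hA a = e f := Subtype.ext h.symm
  exact congrArg ψ ((congrArg e.symm h2).trans (e.symm_apply_apply f))

namespace ExtendedExchangeMatrix

variable {E N : Type} [Fintype E] [Fintype N] {ι : N ↪ E} {B : ExtendedExchangeMatrix ι}

variable (B) in
/-- The lattice generated by the columns and the unit vectors of the mutable variables. -/
def fixingLattice [DecidableEq E] : Submodule ℤ (E → ℤ) :=
  Submodule.span ℤ (Set.range B.column ∪ Set.range fun i => Pi.single (ι i) (1 : ℤ))

/-- Without edges the columns are supported on the frozen coordinates and the unit vectors on the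
mutable ones, so their spans meet in zero. -/
lemma linearIndependent_column_single [DecidableEq E] (hB : LinearIndependent ℤ B.column)
    (hI : B.IsIndependent Finset.univ) :
    LinearIndependent ℤ (Sum.elim B.column fun i => Pi.single (ι i) (1 : ℤ)) := by
  classical
  refine hB.sum_type ?_ ?_
  · exact (Pi.basisFun ℤ E).linearIndependent.comp ι ι.injective |> (by
      simpa [Function.comp_def, Pi.basisFun_apply] using ·)
  · rw [Submodule.disjoint_def]
    intro g hg hg'
    have h0 : ∀ i, g (ι i) = 0 := fun i => by
      have : Submodule.span ℤ (Set.range B.column) ≤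
          LinearMap.ker (LinearMap.proj (R := ℤ) (φ := fun _ : E => ℤ) (ι i)) := by
        rw [Submodule.span_le]
        rintro _ ⟨j, rfl⟩
        exact hI i (Finset.mem_univ _) j (Finset.mem_univ _)
      exact this hg
    have h1 : ∀ e, e ∉ Set.range ι → g e = 0 := fun e he => by
      have : Submodule.span ℤ (Set.range fun i => Pi.single (ι i) (1 : ℤ)) ≤
          LinearMap.ker (LinearMap.proj (R := ℤ) (φ := fun _ : E => ℤ) e) := by
        rw [Submodule.span_le]
        rintro _ ⟨j, rfl⟩
        exact Pi.single_eq_of_ne (fun h => he ⟨j, h.symm⟩) _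
      exact this hg'
    funext e
    by_cases he : e ∈ Set.range ι
    · obtain ⟨i, rfl⟩ := he
      exact h0 i
    · exact h1 e he

variable (B) in
/-- The mutable coordinates of a lattice vector together with its class modulo the
fixing lattice. -/
def gradingHom [DecidableEq E] : (E → ℤ) →+ (N → ℤ) × ((E → ℤ) ⧸ B.fixingLattice) :=
  (LinearMap.funLeft ℤ ℤ ι).toAddMonoidHom.prod B.fixingLattice.mkQ.toAddMonoidHom

variable (B) in
/-- A variable opposite to an initial one, as an element of the cluster algebra. -/
def oppositeElement (i : N) : B.clusterAlgebra :=
  ⟨B.oppositeVariable i, oppositeVariable_mem_clusterAlgebra i⟩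

lemma initialVariable_mul_oppositeElement (i : N) :
    B.initialVariable (ι i) * B.oppositeElement i =
      ∏ e, B.initialVariable e ^ (B.column i e).toNat +
        ∏ e, B.initialVariable e ^ (-B.column i e).toNat := by
  apply Subtype.ext
  refine (B.initialSeed_mul_oppositeVariable i).trans ?_
  rw [← Subalgebra.coe_val, map_add, map_prod, map_prod]
  simp only [map_pow]
  rfl

lemma gradingHom_column [DecidableEq E] (hI : B.IsIndependent Finset.univ) (i : N) :
    B.gradingHom (B.column i) = 0 := by
  refine Prod.ext (funext fun j => hI j (Finset.mem_univ _) i (Finset.mem_univ _)) ?_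
  exact (Submodule.Quotient.mk_eq_zero _).2 (Submodule.subset_span (Or.inl ⟨i, rfl⟩))

/-- This map shows that the quotient has no relations beyond the expected ones. It is defined on the
Laurent ring of the cluster with all x_i replaced by y_i. The character makes x^c equal to -1 on
columns, so P_i maps to zero; since y_i maps to a unit, x_i maps to zero. -/
lemma exists_algHom_gradingHom [DecidableEq E] [DecidableEq N] (hB : LinearIndependent ℤ B.column)
    (hI : B.IsIndependent Finset.univ) {χ : (E → ℤ) →+ Additive ℂˣ}
    (h1 : ∀ i, χ (B.column i) = Additive.ofMul (-1)) (h2 : ∀ i, χ (Pi.single (ι i) 1) = 0) :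
    ∃ Ψ : B.clusterAlgebra →ₐ[ℂ] AddMonoidAlgebra ℂ ((N → ℤ) × ((E → ℤ) ⧸ B.fixingLattice)),
      (∀ i, Ψ (B.initialVariable (ι i)) = 0) ∧
      (∀ i, Ψ (B.oppositeElement i) = AddMonoidAlgebra.single (Pi.single i 1, 0) 1) ∧
      ∀ e, e ∉ Set.range ι → Ψ (B.initialVariable e) = AddMonoidAlgebra.single
        (0, Submodule.Quotient.mk (Pi.single e 1)) ((χ (Pi.single e 1)).toMul : ℂ) := by
  obtain ⟨s, hs, hf⟩ := exists_isSeed_isFlip hI (Finset.subset_univ Finset.univ)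
  have hx := hs.algebraicIndependent
  obtain ⟨Ψ, hΨ⟩ := AlgHom.exists_eq_of_le_range (laurentHom hx.ne_zero) hx.laurentHom_injective
    ((clusterAlgebra_le_laurentRing hB hs).trans (range_laurentHom hx.ne_zero).ge)
    (AddMonoidAlgebra.twistHom B.gradingHom χ)
  have hvar : ∀ (a : B.clusterAlgebra) (e : E), (a : AmbientField E) = s.x e →
      Ψ a = AddMonoidAlgebra.single (B.gradingHom (Pi.single e 1))
        ((χ (Pi.single e 1)).toMul : ℂ) := fun a e ha => by
    rw [hΨ a (AddMonoidAlgebra.single (Pi.single e 1) 1) ?_, AddMonoidAlgebra.twistHom_single,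
      one_mul]
    rw [laurentHom_single, one_smul, laurentMonomial_single, ha]
    simp
  have hopp : ∀ i, Ψ (B.oppositeElement i) = AddMonoidAlgebra.single (Pi.single i 1, 0) 1 :=
    fun i => by
      rw [hvar _ (ι i) (hf.flipped i (Finset.mem_univ i)).symm, h2]
      congr 1
      refine Prod.ext (funext fun j => ?_) ?_
      · change (Pi.single (ι i) (1 : ℤ) : E → ℤ) (ι j) = (Pi.single i (1 : ℤ) : N → ℤ) j
        simp [Pi.single_apply]
      · exact (Submodule.Quotient.mk_eq_zero _).2 (Submodule.subset_span (Or.inr ⟨i, rfl⟩))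
  refine ⟨Ψ, fun i => ?_, hopp, fun e he => ?_⟩
  · have h3 : Ψ (B.initialVariable (ι i) * B.oppositeElement i) = 0 := by
      rw [hΨ _ (AddMonoidAlgebra.single (s.B.column i)⁻ 1 *
        (1 + AddMonoidAlgebra.single (s.B.column i) 1)) ?_]
      · have h4 : AddMonoidAlgebra.twistHom B.gradingHom χ
            (AddMonoidAlgebra.single (s.B.column i) 1) = -1 := by
          rw [AddMonoidAlgebra.twistHom_single]
          rcases hf.column i (Finset.mem_univ i) with hc | hc
          · rw [hc, gradingHom_column hI, h1, AddMonoidAlgebra.one_def]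
            simp
          · rw [hc, map_neg, map_neg, gradingHom_column hI, h1, AddMonoidAlgebra.one_def]
            simp
        rw [map_mul, map_add, map_one, h4, add_neg_cancel, mul_zero]
      · rw [map_mul, map_add, map_one, laurentHom_single, laurentHom_single, one_smul, one_smul,
          ← ClusterSeed.exchange_eq s hx.ne_zero, hf.exchange_eq hI (Finset.subset_univ _)
          (Finset.mem_univ i)]
        exact (B.initialSeed_mul_oppositeVariable i).symm
    rw [map_mul, hopp] at h3
    have h4 := congrArg (· * AddMonoidAlgebra.single
      ((-Pi.single i 1, 0) : (N → ℤ) × ((E → ℤ) ⧸ B.fixingLattice)) (1 : ℂ)) h3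
    simpa [mul_assoc, AddMonoidAlgebra.single_mul_single, ← AddMonoidAlgebra.one_def,
      ← Prod.zero_eq_mk] using h4
  · rw [hvar _ e (hf.fixed e fun i _ h => he ⟨i, h.symm⟩).symm]
    congr 1
    refine Prod.ext (funext fun j => ?_) rfl
    exact Pi.single_eq_of_ne (fun h => he ⟨j, h⟩) _

end ExtendedExchangeMatrix

section Grading

variable {N Q Y : Type} [Fintype N] [CommRing Q] [Algebra ℂ Q] [AddCommGroup Y]

/-- The homomorphism into the units of a group algebra. -/
def AddMonoidAlgebra.unitsHom (Y : Type) [AddCommGroup Y] :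
    Y →+ Additive (AddMonoidAlgebra ℂ Y)ˣ where
  toFun y := Additive.ofMul
    { val := AddMonoidAlgebra.single y 1
      inv := AddMonoidAlgebra.single (-y) 1
      val_inv := by simp [AddMonoidAlgebra.single_mul_single, AddMonoidAlgebra.one_def]
      inv_val := by simp [AddMonoidAlgebra.single_mul_single, AddMonoidAlgebra.one_def] }
  map_zero' := Additive.toMul.injective (Units.ext (by simp [AddMonoidAlgebra.one_def]))
  map_add' g h := Additive.toMul.injective (Units.ext (by
    simp [AddMonoidAlgebra.single_mul_single]))

lemma AlgHom.eq_single_of_forall_single {E : Type} [Fintype E] [DecidableEq E]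
    (Ψ : Q →ₐ[ℂ] AddMonoidAlgebra ℂ Y) (γ : (E → ℤ) →+ Additive Qˣ) (π : (E → ℤ) →+ Y)
    (h : ∀ e, Ψ ((γ (Pi.single e 1)).toMul : Q) = AddMonoidAlgebra.single (π (Pi.single e 1)) 1)
    (g : E → ℤ) : Ψ ((γ g).toMul : Q) = AddMonoidAlgebra.single (π g) 1 := by
  let γ' : (E → ℤ) →+ Additive (AddMonoidAlgebra ℂ Y)ˣ :=
    (Units.map (Ψ : Q →* AddMonoidAlgebra ℂ Y)).toAdditive.comp γ
  have hγ : γ' = (AddMonoidAlgebra.unitsHom Y).comp π := by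
    refine AddMonoidHom.functions_ext _ _ _ fun e => DFunLike.congr_fun
      (AddMonoidHom.ext_int (f := γ'.comp (AddMonoidHom.single (fun _ : E => ℤ) e))
        (g := ((AddMonoidAlgebra.unitsHom Y).comp π).comp (AddMonoidHom.single (fun _ : E => ℤ) e)) ?_)
    exact Additive.toMul.injective (Units.ext (h e))
  exact congrArg (fun u => (u.toMul.val : _)) (DFunLike.congr_fun hγ g)

/-- An algebra generated by elements `o i` and units `ξ y` that are independent, as a suitable
grading shows, is a polynomial ring over a group algebra. -/
lemma nonempty_algEquiv_addMonoidAlgebra [DecidableEq N] (o : N → Q) (ξ : Y →+ Additive Qˣ)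
    (Ψ : Q →ₐ[ℂ] AddMonoidAlgebra ℂ ((N → ℤ) × Y))
    (ho : ∀ i, Ψ (o i) = AddMonoidAlgebra.single (Pi.single i 1, 0) 1)
    (hξ : ∀ y, Ψ ((ξ y).toMul : Q) = AddMonoidAlgebra.single (0, y) 1)
    (hgen : ∀ S : Subalgebra ℂ Q, (∀ i, o i ∈ S) → (∀ y, ((ξ y).toMul : Q) ∈ S) → S = ⊤) :
    Nonempty (Q ≃ₐ[ℂ] AddMonoidAlgebra ℂ ((N →₀ ℕ) × Y)) := by
  let Θ : AddMonoidAlgebra ℂ ((N →₀ ℕ) × Y) →ₐ[ℂ] Q :=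
    AddMonoidAlgebra.lift ℂ _ _
      { toFun := fun y => (∏ i, o i ^ y.toAdd.1 i) * ((ξ y.toAdd.2).toMul : _)
        map_one' := by simp
        map_mul' := fun y z => by
          simp only [toAdd_mul, Prod.fst_add, Prod.snd_add, map_add, toMul_add, Units.val_mul,
            Finsupp.add_apply, pow_add, Finset.prod_mul_distrib]
          ring }
  have hΘ : ∀ u y c, Θ (AddMonoidAlgebra.single (u, y) c) =
      c • ((∏ i, o i ^ u i) * ((ξ y).toMul : _)) := fun u y c =>
    AddMonoidAlgebra.lift_single _ _ _
  -- The composite is induced by the inclusion of exponents (N →₀ ℕ) × Y ⊆ (N → ℤ) × Y, hence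
  -- injective, and therefore so is Θ.
  have hcomp : ∀ f, Ψ (Θ f) = AddMonoidAlgebra.mapDomain
      (fun y : (N →₀ ℕ) × Y => ((fun i => (y.1 i : ℤ), y.2) : (N → ℤ) × Y)) f := by
    intro f
    induction f using AddMonoidAlgebra.induction_linear with
    | zero => simp
    | add f g hf hg => rw [map_add, map_add, hf, hg, AddMonoidAlgebra.mapDomain_add]
    | single y c =>
      obtain ⟨u, y⟩ := y
      have h5 : Ψ (∏ i, o i ^ u i) = AddMonoidAlgebra.single (fun i => (u i : ℤ), 0) 1 := by
        have h7 : ∀ s : Finset N, ∏ i ∈ s, Ψ (o i) ^ u i =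
            AddMonoidAlgebra.single (∑ i ∈ s, Pi.single i (u i : ℤ), 0) 1 := fun s => by
          induction s using Finset.induction with
          | empty => simp [AddMonoidAlgebra.one_def, Prod.zero_eq_mk]
          | insert i s hi ih =>
            rw [Finset.prod_insert hi, Finset.sum_insert hi, ih, ho, AddMonoidAlgebra.single_pow,
              AddMonoidAlgebra.single_mul_single]
            simp [← Pi.single_smul']
        rw [map_prod]
        simp only [map_pow]
        rw [h7, Finset.univ_sum_single]
      rw [hΘ, map_smul, map_mul, hξ, h5, AddMonoidAlgebra.single_mul_single,
        AddMonoidAlgebra.smul_single, AddMonoidAlgebra.mapDomain_single]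
      simp
  have hinj : Function.Injective Θ := by
    have h8 := AddMonoidAlgebra.mapDomain_injective (R := ℂ)
      (f := fun y : (N →₀ ℕ) × Y => ((fun i => (y.1 i : ℤ), y.2) : (N → ℤ) × Y)) (by
        rintro ⟨u, y⟩ ⟨u', y'⟩ h
        have h9 := Prod.mk.inj h
        exact Prod.ext (Finsupp.ext fun i => by exact_mod_cast congrFun h9.1 i) h9.2)
    intro f g hfg
    exact h8 (by rw [← hcomp, ← hcomp, hfg])
  have hsurj : Function.Surjective Θ := by
    rw [← AlgHom.range_eq_top]
    refine hgen _ (fun i => ⟨AddMonoidAlgebra.single (Finsupp.single i 1, 0) 1, ?_⟩) fun y =>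
      ⟨AddMonoidAlgebra.single (0, y) 1, ?_⟩
    · refine (hΘ _ _ _).trans ?_
      rw [Finset.prod_eq_single i (fun j _ hj => by
        rw [Finsupp.single_eq_of_ne hj, pow_zero]) (by simp)]
      simp
    · refine (hΘ _ _ _).trans ?_
      simp
  exact ⟨(AlgEquiv.ofBijective Θ ⟨hinj, hsurj⟩).symm⟩

end Grading

namespace ExtendedExchangeMatrix

variable {E N : Type} [Fintype E] [Fintype N] {ι : N ↪ E} {B : ExtendedExchangeMatrix ι}

variable (B) in
/-- The quotient of the cluster algebra by the mutable variables. -/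
def MutableQuotient : Type := B.clusterAlgebra ⧸ B.mutableIdeal

instance : CommRing B.MutableQuotient := inferInstanceAs (CommRing (B.clusterAlgebra ⧸ B.mutableIdeal))

instance : Algebra ℂ B.MutableQuotient :=
  inferInstanceAs (Algebra ℂ (B.clusterAlgebra ⧸ B.mutableIdeal))

variable (B) in
/-- The quotient map. -/
def toMutableQuotient : B.clusterAlgebra →ₐ[ℂ] B.MutableQuotient :=
  Ideal.Quotient.mkₐ ℂ B.mutableIdeal

lemma mk_initialVariable_mutable (i : N) :
    B.toMutableQuotient (B.initialVariable (ι i)) = 0 :=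
  Ideal.Quotient.eq_zero_iff_mem.2 (Ideal.subset_span ⟨i, rfl⟩)

variable (B) in
/-- The reciprocal of a frozen variable, as an element of the cluster algebra. -/
def inverseElement {e : E} (he : e ∉ Set.range ι) : B.clusterAlgebra :=
  ⟨(B.initialSeed.x e)⁻¹, inv_mem_clusterAlgebra he⟩

lemma initialVariable_mul_inverseElement {e : E} (he : e ∉ Set.range ι) :
    B.initialVariable e * B.inverseElement he = 1 :=
  Subtype.ext (mul_inv_cancel₀ (B.algebraicIndependent_initialSeed.ne_zero e))

variable (B) in
open Classical in
/-- The classes of the frozen variables modulo the mutable variables, completed by `1`. -/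
def frozenUnit (e : E) : B.MutableQuotientˣ :=
  if he : e ∉ Set.range ι then
    Units.map (B.toMutableQuotient : B.clusterAlgebra →* B.MutableQuotient)
      (Units.mkOfMulEqOne _ _ (B.initialVariable_mul_inverseElement he))
  else 1

lemma frozenUnit_of_notMem {e : E} (he : e ∉ Set.range ι) :
    (B.frozenUnit e : B.MutableQuotient) =
      B.toMutableQuotient (B.initialVariable e) := by
  rw [frozenUnit, dif_pos he]
  rfl

lemma frozenUnit_mutable (i : N) : B.frozenUnit (ι i) = 1 :=
  dif_neg (by simp)

lemma frozenUnit_inv_of_notMem {e : E} (he : e ∉ Set.range ι) :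
    ((B.frozenUnit e)⁻¹ : B.MutableQuotientˣ).val =
      B.toMutableQuotient (B.inverseElement he) := by
  rw [frozenUnit, dif_pos he]
  rfl

lemma prod_frozenUnit_pow (n : E → ℕ) (hn : ∀ i, n (ι i) = 0) :
    ((∏ e, B.frozenUnit e ^ n e : B.MutableQuotientˣ) :
      B.MutableQuotient) =
      B.toMutableQuotient (∏ e, B.initialVariable e ^ n e) := by
  rw [← Units.coeHom_apply, map_prod, map_prod]
  refine Finset.prod_congr rfl fun e _ => ?_
  rw [map_pow, map_pow]
  by_cases he : e ∈ Set.range ι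
  · obtain ⟨i, rfl⟩ := he
    rw [hn, pow_zero, pow_zero]
  · rw [Units.coeHom_apply, frozenUnit_of_notMem he]

/-- With x_i = 0 the exchange relation says that its two monomials in the frozen variables are
opposite to each other. -/
lemma prod_frozenUnit_zpow_column (hI : B.IsIndependent Finset.univ) (i : N) :
    ∏ e, B.frozenUnit e ^ B.column i e = -1 := by
  have h0 : ∀ j, B.column i (ι j) = 0 := fun j => hI j (Finset.mem_univ _) i (Finset.mem_univ _)
  have h1 : ∏ e, B.frozenUnit e ^ (B.column i e).toNat =
      -∏ e, B.frozenUnit e ^ (-B.column i e).toNat := by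
    apply Units.ext
    rw [Units.val_neg, prod_frozenUnit_pow _ fun j => by rw [h0]; rfl,
      prod_frozenUnit_pow _ fun j => by rw [h0]; rfl, eq_neg_iff_add_eq_zero, ← map_add,
      ← initialVariable_mul_oppositeElement, map_mul, mk_initialVariable_mutable, zero_mul]
  have h2 : ∏ e, B.frozenUnit e ^ B.column i e =
      (∏ e, B.frozenUnit e ^ (B.column i e).toNat) *
        (∏ e, B.frozenUnit e ^ (-B.column i e).toNat)⁻¹ := by
    rw [← Finset.prod_inv_distrib, ← Finset.prod_mul_distrib]
    refine Finset.prod_congr rfl fun e _ => ?_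
    rw [← zpow_natCast, ← zpow_natCast, ← zpow_neg, ← zpow_add]
    congr 1
    omega
  rw [h2, h1, neg_mul, mul_inv_cancel]

variable (B) in
/-- The homomorphism sending a lattice vector to the corresponding Laurent monomial in the frozen
variables, twisted by a character. -/
def frozenHom (χ : (E → ℤ) →+ Additive ℂˣ) :
    (E → ℤ) →+ Additive B.MutableQuotientˣ :=
  (Fintype.linearCombination ℤ fun e => Additive.ofMul (B.frozenUnit e)).toAddMonoidHom -
    (Units.map (algebraMap ℂ B.MutableQuotient).toMonoidHom).toAdditive.comp χ

lemma frozenHom_apply (χ : (E → ℤ) →+ Additive ℂˣ) (g : E → ℤ) :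
    B.frozenHom χ g = Additive.ofMul (∏ e, B.frozenUnit e ^ g e) -
      Additive.ofMul (Units.map (algebraMap ℂ B.MutableQuotient).toMonoidHom
        (χ g).toMul) := by
  rw [ofMul_prod]
  rfl

lemma frozenHom_single [DecidableEq E] (χ : (E → ℤ) →+ Additive ℂˣ) (e : E) :
    B.frozenHom χ (Pi.single e 1) = Additive.ofMul (B.frozenUnit e) -
      Additive.ofMul (Units.map (algebraMap ℂ B.MutableQuotient).toMonoidHom
        (χ (Pi.single e 1)).toMul) := by
  rw [frozenHom_apply, Finset.prod_eq_single e]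
  · simp
  · intro e' _ he'
    rw [Pi.single_eq_of_ne he', zpow_zero]
  · simp

/-- On a column both the monomial and the character are -1, and on a mutable unit vector both are 1.
Hence the twisted monomials depend only on the class modulo the lattice. -/
lemma fixingLattice_le_ker_frozenHom [DecidableEq E] (hI : B.IsIndependent Finset.univ)
    {χ : (E → ℤ) →+ Additive ℂˣ}
    (h1 : ∀ i, χ (B.column i) = Additive.ofMul (-1)) (h2 : ∀ i, χ (Pi.single (ι i) 1) = 0) :
    B.fixingLattice ≤ LinearMap.ker (B.frozenHom χ).toIntLinearMap := by
  rw [fixingLattice, Submodule.span_le]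
  rintro _ (⟨i, rfl⟩ | ⟨i, rfl⟩)
  · change B.frozenHom χ _ = 0
    rw [frozenHom_apply, prod_frozenUnit_zpow_column hI, h1, sub_eq_zero]
    congr 1
    apply Units.ext
    simp
  · change B.frozenHom χ _ = 0
    rw [frozenHom_single, frozenUnit_mutable, h2]
    simp

variable (B) in
lemma val_frozenHom_single [DecidableEq E] (χ : (E → ℤ) →+ Additive ℂˣ) (e : E) :
    (((χ (Pi.single e 1)).toMul : ℂ) • ((B.frozenHom χ (Pi.single e 1)).toMul :
      B.MutableQuotient)) = B.frozenUnit e := by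
  rw [frozenHom_single, Algebra.smul_def, mul_comm]
  exact congrArg Units.val (inv_mul_cancel_right (B.frozenUnit e) (Units.map
    (algebraMap ℂ B.MutableQuotient).toMonoidHom (χ (Pi.single e 1)).toMul))

/-- The twisted units differ from the classes of the frozen variables and their inverses by non-zero
scalars, and the mutable variables vanish. -/
lemma mutableQuotient_subalgebra_eq_top [DecidableEq E] (hI : B.IsIndependent Finset.univ)
    (χ : (E → ℤ) →+ Additive ℂˣ) (S : Subalgebra ℂ B.MutableQuotient)
    (ho : ∀ i, B.toMutableQuotient (B.oppositeElement i) ∈ S)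
    (hξ : ∀ g, ((B.frozenHom χ g).toMul : B.MutableQuotient) ∈ S) : S = ⊤ := by
  have hS : B.clusterAlgebra ≤ (S.comap B.toMutableQuotient).map B.clusterAlgebra.val := by
    conv_lhs => rw [clusterAlgebra_eq_adjoin hI]
    refine Algebra.adjoin_le ?_
    rintro _ ((⟨e, rfl⟩ | ⟨i, rfl⟩) | ⟨e, he, rfl⟩)
    · refine ⟨B.initialVariable e, ?_, rfl⟩
      change B.toMutableQuotient (B.initialVariable e) ∈ S
      by_cases he : e ∈ Set.range ι
      · obtain ⟨i, rfl⟩ := he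
        rw [mk_initialVariable_mutable]
        exact zero_mem _
      · rw [← frozenUnit_of_notMem he, ← val_frozenHom_single B χ]
        exact S.smul_mem (hξ _) _
    · exact ⟨B.oppositeElement i, ho i, rfl⟩
    · refine ⟨B.inverseElement he, ?_, rfl⟩
      change B.toMutableQuotient (B.inverseElement he) ∈ S
      have h1 : B.toMutableQuotient (B.inverseElement he) =
          (((χ (Pi.single e 1)).toMul⁻¹ : ℂˣ) : ℂ) •
            ((B.frozenHom χ (-Pi.single e 1)).toMul : B.MutableQuotient) := by
        have h2 := val_frozenHom_single B χ e
        rw [map_neg, toMul_neg, ← frozenUnit_inv_of_notMem he]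
        refine Units.inv_eq_of_mul_eq_one_right ?_
        rw [← h2, smul_mul_smul_comm, Units.mul_inv, Units.mul_inv, one_smul]
      rw [h1]
      exact S.smul_mem (hξ _) _
  rw [eq_top_iff]
  rintro q -
  obtain ⟨a, rfl⟩ : ∃ a, B.toMutableQuotient a = q := Ideal.Quotient.mk_surjective q
  obtain ⟨b, hb, hba⟩ := hS a.2
  rw [← Subtype.ext (show (b : AmbientField E) = a from hba)]
  exact hb

/-- Modulo the mutable variables, the cluster algebra of a matrix without edges is a polynomial
ring over the group algebra of the quotient by the fixing lattice. -/
theorem nonempty_quotient_mutableIdeal_algEquiv [DecidableEq E] [DecidableEq N]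
    (hB : LinearIndependent ℤ B.column) (hI : B.IsIndependent Finset.univ) :
    Nonempty ((B.clusterAlgebra ⧸ B.mutableIdeal) ≃ₐ[ℂ]
      AddMonoidAlgebra ℂ ((N →₀ ℕ) × ((E → ℤ) ⧸ B.fixingLattice))) := by
  -- The columns and the mutable unit vectors are independent, so the values -1 and 1 can be
  -- prescribed simultaneously.
  obtain ⟨χ, hχ⟩ := (linearIndependent_column_single hB hI).exists_character_apply_eq
    (Sum.elim (fun _ => Additive.ofMul (-1)) fun _ => 0)
  have h1 : ∀ i, χ (B.column i) = Additive.ofMul (-1) := fun i => hχ (Sum.inl i)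
  have h2 : ∀ i, χ (Pi.single (ι i) 1) = 0 := fun i => hχ (Sum.inr i)
  obtain ⟨Ψ, hΨ0, hΨo, hΨf⟩ := exists_algHom_gradingHom hB hI h1 h2
  let Ψ' : B.MutableQuotient →ₐ[ℂ] AddMonoidAlgebra ℂ ((N → ℤ) × ((E → ℤ) ⧸ B.fixingLattice)) :=
    Ideal.Quotient.liftₐ _ Ψ fun a ha => by
      have : B.mutableIdeal ≤ RingHom.ker Ψ := by
        rw [mutableIdeal, Ideal.span_le]
        rintro _ ⟨i, rfl⟩
        exact hΨ0 i
      exact this ha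
  have hΨ' : ∀ a, Ψ' (B.toMutableQuotient a) = Ψ a := fun _ => rfl
  let ξ : ((E → ℤ) ⧸ B.fixingLattice) →ₗ[ℤ] Additive B.MutableQuotientˣ :=
    B.fixingLattice.liftQ _ (fixingLattice_le_ker_frozenHom hI h1 h2)
  have hξ : ∀ g, ξ (Submodule.Quotient.mk g) = B.frozenHom χ g := fun _ => rfl
  refine nonempty_algEquiv_addMonoidAlgebra (Q := B.MutableQuotient)
    (fun i => B.toMutableQuotient (B.oppositeElement i)) ξ.toAddMonoidHom Ψ' hΨo ?_ ?_
  · intro y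
    obtain ⟨g, rfl⟩ := Submodule.Quotient.mk_surjective _ y
    refine AlgHom.eq_single_of_forall_single Ψ' (B.frozenHom χ)
      ((AddMonoidHom.inr _ _).comp B.fixingLattice.mkQ.toAddMonoidHom) (fun e => ?_) g
    have h3 := congrArg Ψ' (val_frozenHom_single B χ e)
    have h4 : Ψ' (B.frozenUnit e) = ((χ (Pi.single e 1)).toMul : ℂ) •
        AddMonoidAlgebra.single (0, Submodule.Quotient.mk (Pi.single e 1)) 1 := by
      by_cases he : e ∈ Set.range ι
      · obtain ⟨i, rfl⟩ := he
        have h5 : (Submodule.Quotient.mk (Pi.single (ι i) 1) : (E → ℤ) ⧸ B.fixingLattice) = 0 :=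
          (Submodule.Quotient.mk_eq_zero _).2 (Submodule.subset_span (Or.inr ⟨i, rfl⟩))
        rw [frozenUnit_mutable, h2, h5, ← Prod.zero_eq_mk, ← AddMonoidAlgebra.one_def]
        simp
      · rw [frozenUnit_of_notMem he, hΨ', hΨf e he, AddMonoidAlgebra.smul_single, smul_eq_mul,
          mul_one]
    rw [h4, map_smul] at h3
    have h6 := congrArg (((χ (Pi.single e 1)).toMul⁻¹ : ℂˣ) • ·) h3
    simp only [Units.smul_def, smul_smul, Units.inv_mul, one_smul] at h6
    exact h6
  · intro S ho hS
    exact mutableQuotient_subalgebra_eq_top hI χ S ho fun g => hS (Submodule.Quotient.mk g)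

end ExtendedExchangeMatrix

/-! ### Regular functions on groups of cluster automorphisms. -/

/-- The elements of a group algebra are determined by their values at the characters. -/
lemma AddMonoidAlgebra.eq_zero_of_forall_liftUnits {Y : Type} [AddCommGroup Y]
    {f : AddMonoidAlgebra ℂ Y}
    (hf : ∀ χ : Y →+ Additive ℂˣ, AddMonoidAlgebra.liftUnits (A := ℂ) χ f = 0) : f = 0 := by
  -- Elements of Y are viewed as homomorphisms from the dual group to ℂ. They are distinct because
  -- characters separate points, and distinct homomorphisms are linearly independent.
  let ev : Y → (Multiplicative (Y →+ Additive ℂˣ) →* ℂ) := fun y =>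
    { toFun := fun χ => ((χ.toAdd y).toMul : ℂ)
      map_one' := by simp
      map_mul' := by simp }
  have hev : Function.Injective ev := fun y z h => by
    by_contra hyz
    obtain ⟨χ, hχ⟩ := exists_character_apply_ne_zero (sub_ne_zero.2 hyz)
    refine hχ ?_
    rw [map_sub, sub_eq_zero]
    exact Additive.toMul.injective (Units.ext (DFunLike.congr_fun h (Multiplicative.ofAdd χ)))
  have hli := (linearIndependent_monoidHom (Multiplicative (Y →+ Additive ℂˣ)) ℂ).comp ev hev
  have h0 : Finsupp.linearCombination ℂ (fun y => (ev y : Multiplicative (Y →+ Additive ℂˣ) → ℂ))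
      f.coeff = 0 := by
    funext χ
    have h1 := hf χ.toAdd
    rw [AddMonoidAlgebra.liftUnits, AddMonoidAlgebra.lift_apply] at h1
    rw [Finsupp.linearCombination_apply, Finsupp.sum, Finset.sum_apply]
    exact h1
  have h2 := (linearIndependent_iff.1 hli) f.coeff h0
  exact AddMonoidAlgebra.coeff_injective h2

lemma AddMonoidAlgebra.exists_eq_liftUnits {Y : Type} [AddCommGroup Y]
    (F : AddMonoidAlgebra ℂ Y →ₐ[ℂ] ℂ) :
    ∃ χ : Y →+ Additive ℂˣ, F = AddMonoidAlgebra.liftUnits (A := ℂ) χ := by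
  refine ⟨(Units.map (F : AddMonoidAlgebra ℂ Y →* ℂ)).toAdditive.comp
    (AddMonoidAlgebra.unitsHom Y), AlgHom.ext fun f => ?_⟩
  induction f using AddMonoidAlgebra.induction_linear with
  | zero => simp
  | add f g hf hg => rw [map_add, map_add, hf, hg]
  | single y c =>
    have h1 : AddMonoidAlgebra.single y c = c • AddMonoidAlgebra.single y (1 : ℂ) := by
      rw [AddMonoidAlgebra.smul_single, smul_eq_mul, mul_one]
    rw [AddMonoidAlgebra.liftUnits_single, h1, map_smul]
    rfl

namespace ExtendedExchangeMatrix

variable {E N : Type} [Fintype E] {ι : N ↪ E} {B : ExtendedExchangeMatrix ι}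

lemma initialVariable_ne_zero (e : E) : B.initialVariable e ≠ 0 := fun h =>
  B.algebraicIndependent_initialSeed.ne_zero e (congrArg Subtype.val h)

/-- A group of automorphisms that is the group of characters of a quotient of the lattice has the
group algebra of this quotient as its ring of regular functions, and is recovered from it. -/
theorem autRegularFunctions_of_bijective [DecidableEq E]
    {G : Subgroup (B.clusterAlgebra ≃ₐ[ℂ] B.clusterAlgebra)} {Λ : Submodule ℤ (E → ℤ)}
    (Z : G → ((E → ℤ) ⧸ Λ →+ Additive ℂˣ)) (hZ : Function.Bijective Z)
    (hZx : ∀ (φ : G) (e : E), φ.1 (B.initialVariable e) =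
      ((Z φ (Submodule.Quotient.mk (Pi.single e 1))).toMul : ℂ) • B.initialVariable e) :
    Nonempty (B.autRegularFunctions G ≃ₐ[ℂ] AddMonoidAlgebra ℂ ((E → ℤ) ⧸ Λ)) ∧
      Function.Bijective (B.autEval G) := by
  -- The group algebra acts as functions on its characters, that is, on G. It injects, and its image
  -- is generated by the coordinate functions and their inverses.
  let ev : AddMonoidAlgebra ℂ ((E → ℤ) ⧸ Λ) →ₐ[ℂ] (G → ℂ) :=
    AlgHom.pi fun φ : G => AddMonoidAlgebra.liftUnits (A := ℂ) (Z φ)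
  have hev : ∀ f φ, ev f φ = AddMonoidAlgebra.liftUnits (A := ℂ) (Z φ) f := fun _ _ => rfl
  have hsingle : ∀ y φ, ev (AddMonoidAlgebra.single y 1) φ = ((Z φ y).toMul : ℂ) := fun y φ => by
    rw [hev, AddMonoidAlgebra.liftUnits_single, one_smul]
  have hinj : Function.Injective ev := by
    rw [injective_iff_map_eq_zero]
    intro f hf
    refine AddMonoidAlgebra.eq_zero_of_forall_liftUnits fun χ => ?_
    obtain ⟨φ, rfl⟩ := hZ.2 χ
    rw [← hev, hf, Pi.zero_apply]
  have hcoord : ∀ (c d : ℂ) (e : E), c • B.initialVariable e = d • B.initialVariable e → c = d :=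
    fun c d e h => smul_left_injective ℂ (initialVariable_ne_zero e) h
  have hrange : ev.range = B.autRegularFunctions G := by
    apply le_antisymm
    · rintro _ ⟨f, rfl⟩
      change ev f ∈ _
      induction f using AddMonoidAlgebra.induction_linear with
      | zero => rw [map_zero]; exact zero_mem _
      | add f g hf hg => rw [map_add]; exact add_mem hf hg
      | single y c =>
        have h1 : AddMonoidAlgebra.single y c = c • AddMonoidAlgebra.single y (1 : ℂ) := by
          rw [AddMonoidAlgebra.smul_single, smul_eq_mul, mul_one]
        rw [h1, map_smul]
        refine Subalgebra.smul_mem _ ?_ c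
        have hunit : ∀ e, ev (AddMonoidAlgebra.single (Submodule.Quotient.mk (Pi.single e 1)) 1) ∈
            B.autRegularFunctions G := fun e =>
          Algebra.subset_adjoin ⟨e, Or.inl fun φ => by rw [hsingle]; exact hZx φ e⟩
        have hunit' : ∀ e, ev (AddMonoidAlgebra.single (-Submodule.Quotient.mk (Pi.single e 1)) 1) ∈
            B.autRegularFunctions G := fun e =>
          Algebra.subset_adjoin ⟨e, Or.inr fun φ => by
            rw [hsingle, map_neg, toMul_neg, Units.val_inv_eq_inv_val, inv_inv]; exact hZx φ e⟩
        have hadd : ∀ y z, ev (AddMonoidAlgebra.single (y + z) 1) =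
            ev (AddMonoidAlgebra.single y 1) * ev (AddMonoidAlgebra.single z 1) := fun y z => by
          rw [← map_mul, AddMonoidAlgebra.single_mul_single, one_mul]
        -- Requiring both signs makes the admissible exponents a subgroup; it contains the classes
        -- of the unit vectors, hence everything.
        let P : AddSubgroup ((E → ℤ) ⧸ Λ) :=
          { carrier := {y | ev (AddMonoidAlgebra.single y 1) ∈ B.autRegularFunctions G ∧
              ev (AddMonoidAlgebra.single (-y) 1) ∈ B.autRegularFunctions G}
            zero_mem' := by
              rw [Set.mem_ofPred_eq, neg_zero, ← AddMonoidAlgebra.one_def, map_one]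
              exact ⟨one_mem _, one_mem _⟩
            add_mem' := fun {y z} hy hz => ⟨by rw [hadd]; exact mul_mem hy.1 hz.1, by
              rw [neg_add, hadd]; exact mul_mem hy.2 hz.2⟩
            neg_mem' := fun {y} hy => ⟨hy.2, by rw [neg_neg]; exact hy.1⟩ }
        obtain ⟨g, rfl⟩ := Submodule.Quotient.mk_surjective _ y
        have hg : (Submodule.Quotient.mk g : (E → ℤ) ⧸ Λ) =
            ∑ e, g e • Submodule.Quotient.mk (Pi.single e 1) := by
          conv_lhs => rw [← Finset.univ_sum_single g]
          rw [← Submodule.mkQ_apply, map_sum]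
          refine Finset.sum_congr rfl fun e _ => ?_
          rw [← Submodule.mkQ_apply, ← map_smul, ← Pi.single_smul', smul_eq_mul, mul_one]
        have hmem : (Submodule.Quotient.mk g : (E → ℤ) ⧸ Λ) ∈ P := by
          rw [hg]
          exact sum_mem fun e _ => P.zsmul_mem ⟨hunit e, hunit' e⟩ _
        exact hmem.1
    · refine Algebra.adjoin_le ?_
      rintro f ⟨e, hf | hf⟩
      · refine ⟨AddMonoidAlgebra.single (Submodule.Quotient.mk (Pi.single e 1)) 1, ?_⟩
        funext φ
        refine (hsingle _ φ).trans (hcoord _ _ e ?_)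
        rw [← hZx, hf]
      · refine ⟨AddMonoidAlgebra.single (-Submodule.Quotient.mk (Pi.single e 1)) 1, ?_⟩
        funext φ
        refine (hsingle _ φ).trans ?_
        rw [map_neg, toMul_neg, Units.val_inv_eq_inv_val, inv_eq_iff_eq_inv]
        refine hcoord _ _ e ?_
        rw [← hZx, hf]
  let α := (AlgEquiv.ofInjective ev hinj).trans (Subalgebra.equivOfEq _ _ hrange)
  have hα : ∀ φ f, B.autEval G φ (α f) = AddMonoidAlgebra.liftUnits (A := ℂ) (Z φ) f :=
    fun _ _ => rfl
  refine ⟨⟨α.symm⟩, fun φ ψ h => hZ.1 (AddMonoidHom.ext fun y => ?_), fun F => ?_⟩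
  · have h1 := DFunLike.congr_fun h (α (AddMonoidAlgebra.single y 1))
    rw [hα, hα, AddMonoidAlgebra.liftUnits_single, AddMonoidAlgebra.liftUnits_single, one_smul,
      one_smul] at h1
    exact Additive.toMul.injective (Units.ext h1)
  · obtain ⟨χ, hχ⟩ := AddMonoidAlgebra.exists_eq_liftUnits
      (F.comp (α : AddMonoidAlgebra ℂ ((E → ℤ) ⧸ Λ) →ₐ[ℂ] B.autRegularFunctions G))
    obtain ⟨φ, rfl⟩ := hZ.2 χ
    refine ⟨φ, AlgHom.ext fun r => ?_⟩
    obtain ⟨f, rfl⟩ := α.surjective r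
    rw [hα, ← hχ]
    rfl

end ExtendedExchangeMatrix

lemma AddMonoidHom.ext_pi_single {E M : Type*} [Finite E] [DecidableEq E] [AddCommGroup M]
    {f g : (E → ℤ) →+ M} (h : ∀ e, f (Pi.single e 1) = g (Pi.single e 1)) : f = g :=
  AddMonoidHom.functions_ext _ _ _ fun e => DFunLike.congr_fun
    (AddMonoidHom.ext_int (f := f.comp (AddMonoidHom.single (fun _ : E => ℤ) e))
      (g := g.comp (AddMonoidHom.single (fun _ : E => ℤ) e)) (h e))

lemma AddMonoidAlgebra.twistHom_twistHom {M : Type*} [AddCommGroup M]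
    {χ χ' : M →+ Additive ℂˣ} (h : ∀ g, χ g + χ' g = 0) (f : AddMonoidAlgebra ℂ M) :
    AddMonoidAlgebra.twistHom (AddMonoidHom.id M) χ'
      (AddMonoidAlgebra.twistHom (AddMonoidHom.id M) χ f) = f := by
  induction f using AddMonoidAlgebra.induction_linear with
  | zero => simp
  | add f g hf hg => rw [map_add, map_add, hf, hg]
  | single y c =>
    rw [AddMonoidAlgebra.twistHom_single, AddMonoidAlgebra.twistHom_single, mul_assoc,
      AddMonoidHom.id_apply, ← Units.val_mul, ← toMul_add, AddMonoidHom.id_apply, h, toMul_zero,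
      Units.val_one, mul_one]

lemma AlgebraicIndependent.eq_zero_of_smul_laurentMonomial_add {K E : Type} [Field K] [Fintype E]
    [Algebra ℂ K] {x : E → K} (hx : AlgebraicIndependent ℂ x) {g h : E → ℤ} (hgh : g ≠ h) {a b : ℂ}
    (hab : a • laurentMonomial x g + b • laurentMonomial x h = 0) : a = 0 ∧ b = 0 := by
  refine LinearIndependent.pair_iff.1 ?_ a b hab
  have hinj : Function.Injective ![g, h] := by
    intro i j hij
    fin_cases i <;> fin_cases j
    · rfl
    · exact absurd hij hgh
    · exact absurd hij.symm hgh
    · rfl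
  have h1 := hx.linearIndependent_laurentMonomial.comp _ hinj
  convert! h1 using 1
  funext i
  fin_cases i <;> rfl

namespace ExtendedExchangeMatrix

variable {E N : Type} [Fintype E] {ι : N ↪ E} {B : ExtendedExchangeMatrix ι}

/-- The scaling factors of an automorphism form a character of ℤ^E trivial on Λ. Automorphisms are
determined by them and all such characters occur, so G is the character group of the quotient. -/
theorem autRegularFunctions_of_scaling [DecidableEq E]
    {G : Subgroup (B.clusterAlgebra ≃ₐ[ℂ] B.clusterAlgebra)} {Λ : Submodule ℤ (E → ℤ)}
    (h1 : ∀ φ ∈ G, ∃ ζ : (E → ℤ) →+ Additive ℂˣ, Λ ≤ LinearMap.ker ζ.toIntLinearMap ∧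
      ∀ e, φ (B.initialVariable e) = ((ζ (Pi.single e 1)).toMul : ℂ) • B.initialVariable e)
    (h2 : ∀ ζ : (E → ℤ) →+ Additive ℂˣ, Λ ≤ LinearMap.ker ζ.toIntLinearMap → ∃ φ ∈ G,
      ∀ e, φ (B.initialVariable e) = ((ζ (Pi.single e 1)).toMul : ℂ) • B.initialVariable e)
    (h3 : ∀ φ ψ : B.clusterAlgebra ≃ₐ[ℂ] B.clusterAlgebra,
      (∀ e, φ (B.initialVariable e) = ψ (B.initialVariable e)) → φ = ψ) :
    Nonempty (B.autRegularFunctions G ≃ₐ[ℂ] AddMonoidAlgebra ℂ ((E → ℤ) ⧸ Λ)) ∧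
      Function.Bijective (B.autEval G) := by
  choose ζ hζ hζx using h1
  let Z : G → ((E → ℤ) ⧸ Λ →+ Additive ℂˣ) := fun φ =>
    (Λ.liftQ (ζ φ.1 φ.2).toIntLinearMap (hζ φ.1 φ.2)).toAddMonoidHom
  have hZ : ∀ φ g, Z φ (Submodule.Quotient.mk g) = ζ φ.1 φ.2 g := fun _ _ => rfl
  refine autRegularFunctions_of_bijective Z ⟨fun φ ψ h => ?_, fun χ => ?_⟩ fun φ e => ?_
  · refine Subtype.ext (h3 _ _ fun e => ?_)
    rw [hζx _ φ.2, hζx _ ψ.2, ← hZ, ← hZ, h]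
  · obtain ⟨φ, hφ, hφx⟩ := h2 (χ.comp Λ.mkQ.toAddMonoidHom) fun g hg => by
      change χ (Submodule.Quotient.mk g) = 0
      rw [(Submodule.Quotient.mk_eq_zero Λ).2 hg, map_zero]
    refine ⟨⟨φ, hφ⟩, AddMonoidHom.ext fun y => ?_⟩
    obtain ⟨g, rfl⟩ := Submodule.Quotient.mk_surjective _ y
    rw [hZ]
    refine DFunLike.congr_fun (AddMonoidHom.ext_pi_single
      (g := χ.comp Λ.mkQ.toAddMonoidHom) fun e => ?_) g
    refine Additive.toMul.injective (Units.ext (smul_left_injective ℂ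
      (B.initialVariable_ne_zero e) ?_))
    exact (hζx φ hφ e).symm.trans (hφx e)
  · rw [hZ]
    exact hζx _ φ.2 e

section

variable [Fintype N]

/-- The algebra is a domain, so the images of the y_i and of the inverse frozen variables are forced
by the exchange relations and by x_e x_e⁻¹ = 1. -/
lemma algEquiv_ext (hI : B.IsIndependent Finset.univ)
    (φ ψ : B.clusterAlgebra ≃ₐ[ℂ] B.clusterAlgebra)
    (h : ∀ e, φ (B.initialVariable e) = ψ (B.initialVariable e)) : φ = ψ := by
  have hopp : ∀ i, φ (B.oppositeElement i) = ψ (B.oppositeElement i) := fun i => by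
    have h0 : ψ (B.initialVariable (ι i)) ≠ 0 :=
      (map_ne_zero_iff ψ ψ.injective).2 (initialVariable_ne_zero _)
    refine mul_left_cancel₀ h0 ?_
    rw [← map_mul, ← h, ← map_mul, initialVariable_mul_oppositeElement]
    simp only [map_add, map_prod, map_pow, h]
  have hinv : ∀ e (he : e ∉ Set.range ι), φ (B.inverseElement he) = ψ (B.inverseElement he) :=
    fun e he => by
      have h0 : ψ (B.initialVariable e) ≠ 0 :=
        (map_ne_zero_iff ψ ψ.injective).2 (initialVariable_ne_zero _)
      refine mul_left_cancel₀ h0 ?_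
      rw [← map_mul, ← h, ← map_mul, initialVariable_mul_inverseElement, map_one, map_one]
  have hS : B.clusterAlgebra ≤ (AlgHom.equalizer φ.toAlgHom ψ.toAlgHom).map B.clusterAlgebra.val := by
    conv_lhs => rw [clusterAlgebra_eq_adjoin hI]
    refine Algebra.adjoin_le ?_
    rintro _ ((⟨e, rfl⟩ | ⟨i, rfl⟩) | ⟨e, he, rfl⟩)
    · exact ⟨B.initialVariable e, h e, rfl⟩
    · exact ⟨B.oppositeElement i, hopp i, rfl⟩
    · exact ⟨B.inverseElement he, hinv e he, rfl⟩
  refine AlgEquiv.ext fun a => ?_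
  obtain ⟨b, hb, hba⟩ := hS a.2
  rw [← Subtype.ext (show (b : AmbientField E) = a from hba)]
  exact hb

lemma oppositeVariable_eq_laurentHom (i : N) [DecidableEq E] :
    laurentHom B.algebraicIndependent_initialSeed.ne_zero
      (AddMonoidAlgebra.single ((B.column i)⁻ - Pi.single (ι i) 1) 1 *
        (1 + AddMonoidAlgebra.single (B.column i) 1)) = B.oppositeVariable i := by
  have hx := B.algebraicIndependent_initialSeed.ne_zero
  refine mul_left_cancel₀ (hx (ι i)) ?_
  rw [initialSeed_mul_oppositeVariable, ClusterSeed.exchange_eq _ hx, map_mul, map_add, map_one,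
    laurentHom_single, laurentHom_single, one_smul, one_smul, sub_eq_add_neg,
    laurentMonomial_add hx, laurentMonomial_neg, laurentMonomial_single, zpow_one]
  rw [← mul_assoc, mul_comm (laurentMonomial _ _) _, mul_inv_cancel_left₀ (hx _)]
  rfl

/-- A character that is trivial on the columns acts on the cluster algebra. -/
lemma exists_clusterAut [DecidableEq E] (hB : LinearIndependent ℤ B.column)
    (hI : B.IsIndependent Finset.univ) (ζ : (E → ℤ) →+ Additive ℂˣ)
    (hζ : ∀ i, ζ (B.column i) = 0) : ∃ φ ∈ B.clusterAut,
      ∀ e, φ (B.initialVariable e) = ((ζ (Pi.single e 1)).toMul : ℂ) • B.initialVariable e := by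
  have hx := B.algebraicIndependent_initialSeed
  -- The construction is applied to ζ and to -ζ, which give mutually inverse endomorphisms.
  have hex : ∀ ζ : (E → ℤ) →+ Additive ℂˣ, (∀ i, ζ (B.column i) = 0) →
      ∃ Φ : B.clusterAlgebra →ₐ[ℂ] B.clusterAlgebra,
        (∀ (a : B.clusterAlgebra) (f : AddMonoidAlgebra ℂ (E → ℤ)),
          laurentHom hx.ne_zero f = a → laurentHom hx.ne_zero
            (AddMonoidAlgebra.twistHom (AddMonoidHom.id _) ζ f) = Φ a) ∧
        (∀ e, Φ (B.initialVariable e) =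
          ((ζ (Pi.single e 1)).toMul : ℂ) • B.initialVariable e) ∧
        ∀ i, ∃ c : ℂˣ, Φ (B.oppositeElement i) = (c : ℂ) • B.oppositeElement i := by
    intro ζ hζ
    obtain ⟨Φ, hΦ⟩ := AlgHom.exists_eq_of_le_range (laurentHom hx.ne_zero)
      hx.laurentHom_injective ((clusterAlgebra_le_laurentRing hB B.isSeed_initialSeed).trans
        (range_laurentHom hx.ne_zero).ge)
      ((laurentHom hx.ne_zero).comp (AddMonoidAlgebra.twistHom (AddMonoidHom.id _) ζ))
    have hmon : ∀ (a : B.clusterAlgebra) (g : E → ℤ), laurentMonomial B.initialSeed.x g = a →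
        Φ a = ((ζ g).toMul : ℂ) • (a : AmbientField E) := fun a g ha => by
      rw [hΦ a (AddMonoidAlgebra.single g 1) (by rw [laurentHom_single, one_smul, ha]),
        AlgHom.comp_apply, AddMonoidAlgebra.twistHom_single, AddMonoidHom.id_apply, one_mul,
        laurentHom_single, ha]
    have hvar : ∀ e, Φ (B.initialVariable e) =
        ((ζ (Pi.single e 1)).toMul : ℂ) • B.initialSeed.x e := fun e =>
      hmon _ _ (by rw [laurentMonomial_single, zpow_one]; rfl)
    -- As ζ is trivial on the column c, it fixes the factor 1 + x^c of y_i and only scales the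
    -- monomial in front.
    have hopp : ∀ i, Φ (B.oppositeElement i) =
        ((ζ ((B.column i)⁻ - Pi.single (ι i) 1)).toMul : ℂ) • B.oppositeVariable i := fun i => by
      rw [hΦ _ _ (oppositeVariable_eq_laurentHom i), AlgHom.comp_apply, map_mul, map_add, map_one,
        AddMonoidAlgebra.twistHom_single, AddMonoidAlgebra.twistHom_single, hζ, toMul_zero,
        Units.val_one, one_mul, one_mul, AddMonoidHom.id_apply, AddMonoidHom.id_apply,
        ← oppositeVariable_eq_laurentHom i, ← map_smul, ← smul_mul_assoc,
        AddMonoidAlgebra.smul_single, smul_eq_mul, mul_one]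
    have hmem : ∀ a, Φ a ∈ B.clusterAlgebra := by
      have hS : B.clusterAlgebra ≤ (B.clusterAlgebra.comap Φ).map B.clusterAlgebra.val := by
        conv_lhs => rw [clusterAlgebra_eq_adjoin hI]
        refine Algebra.adjoin_le ?_
        rintro _ ((⟨e, rfl⟩ | ⟨i, rfl⟩) | ⟨e, he, rfl⟩)
        · refine ⟨B.initialVariable e, ?_, rfl⟩
          change Φ _ ∈ B.clusterAlgebra
          rw [hvar]
          exact B.clusterAlgebra.smul_mem (initialSeed_mem_clusterAlgebra e) _
        · refine ⟨B.oppositeElement i, ?_, rfl⟩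
          change Φ _ ∈ B.clusterAlgebra
          rw [hopp]
          exact B.clusterAlgebra.smul_mem (oppositeVariable_mem_clusterAlgebra i) _
        · refine ⟨B.inverseElement he, ?_, rfl⟩
          change Φ _ ∈ B.clusterAlgebra
          rw [hmon (B.inverseElement he) (-Pi.single e 1) (by
            rw [laurentMonomial_neg, laurentMonomial_single, zpow_one]; rfl)]
          exact B.clusterAlgebra.smul_mem (inv_mem_clusterAlgebra he) _
      intro a
      obtain ⟨b, hb, hba⟩ := hS a.2
      rw [← Subtype.ext (show (b : AmbientField E) = a from hba)]
      exact hb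
    exact ⟨Φ.codRestrict B.clusterAlgebra hmem, fun a f h => (hΦ a f h).symm,
      fun e => Subtype.ext (hvar e), fun i => ⟨_, Subtype.ext (hopp i)⟩⟩
  have hneg : ∀ i, (-ζ) (B.column i) = 0 := fun i => by rw [AddMonoidHom.neg_apply, hζ, neg_zero]
  obtain ⟨Φ, h1, h2, h3⟩ := hex ζ hζ
  obtain ⟨Φ', h1', -, -⟩ := hex (-ζ) hneg
  have hlift : ∀ a : B.clusterAlgebra, ∃ f, laurentHom hx.ne_zero f = a := fun a =>
    (range_laurentHom hx.ne_zero).ge (clusterAlgebra_le_laurentRing hB B.isSeed_initialSeed a.2)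
  have hinv1 : ∀ a, Φ' (Φ a) = a := fun a => by
    obtain ⟨f, hf⟩ := hlift a
    apply Subtype.ext
    rw [← h1' _ _ (h1 a f hf), AddMonoidAlgebra.twistHom_twistHom fun _ => add_neg_cancel _, hf]
  have hinv2 : ∀ a, Φ (Φ' a) = a := fun a => by
    obtain ⟨f, hf⟩ := hlift a
    apply Subtype.ext
    rw [← h1 _ _ (h1' a f hf), AddMonoidAlgebra.twistHom_twistHom fun _ => neg_add_cancel _, hf]
  refine ⟨AlgEquiv.ofAlgHom Φ Φ' (AlgHom.ext hinv2) (AlgHom.ext hinv1), ?_, h2⟩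
  intro z hz
  rw [clusterVariables_eq hI] at hz
  rcases hz with ⟨e, he⟩ | ⟨i, hi⟩
  · obtain rfl : B.initialVariable e = z := Subtype.ext he
    exact ⟨_, h2 e⟩
  · obtain rfl : B.oppositeElement i = z := Subtype.ext hi
    exact h3 i

/-- A cluster automorphism scales the initial variables by a character that is trivial on the
columns. -/
lemma exists_character_of_mem_clusterAut [DecidableEq E] (hB : LinearIndependent ℤ B.column)
    {φ : B.clusterAlgebra ≃ₐ[ℂ] B.clusterAlgebra} (hφ : φ ∈ B.clusterAut) :
    ∃ ζ : (E → ℤ) →+ Additive ℂˣ, (∀ i, ζ (B.column i) = 0) ∧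
      ∀ e, φ (B.initialVariable e) = ((ζ (Pi.single e 1)).toMul : ℂ) • B.initialVariable e := by
  choose c hc using fun e => hφ (B.initialVariable e) (initialSeed_mem_clusterVariables e)
  choose d hd using fun i => hφ (B.oppositeElement i) (oppositeVariable_mem_clusterVariables i)
  have hx := B.algebraicIndependent_initialSeed
  have hc1 : ∀ g : E → ℤ, (Fintype.linearCombination ℤ fun e => Additive.ofMul (c e)) g =
      Additive.ofMul (∏ e, c e ^ g e) := fun g => by rw [ofMul_prod]; rfl
  refine ⟨(Fintype.linearCombination ℤ fun e => Additive.ofMul (c e)).toAddMonoidHom,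
    fun i => ?_, fun e => ?_⟩
  · change (Fintype.linearCombination ℤ fun e => Additive.ofMul (c e)) _ = 0
    have hprod : ∀ n : E → ℕ, φ (∏ e, B.initialVariable e ^ n e) =
        ((∏ e, c e ^ n e : ℂˣ) : ℂ) • ∏ e, B.initialVariable e ^ n e := fun n => by
      rw [map_prod, ← Units.coeHom_apply, map_prod, ← Finset.prod_smul]
      refine Finset.prod_congr rfl fun e _ => ?_
      rw [map_pow, hc, smul_pow, map_pow, Units.coeHom_apply]
    have h1 := congrArg φ (initialVariable_mul_oppositeElement (B := B) i)
    rw [map_mul, hc, hd, smul_mul_smul_comm, initialVariable_mul_oppositeElement, map_add, hprod,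
      hprod, smul_add, ← sub_eq_zero, add_sub_add_comm, ← sub_smul, ← sub_smul] at h1
    have hmon : ∀ n : E → ℕ, ((∏ e, B.initialVariable e ^ n e : B.clusterAlgebra) :
        AmbientField E) = laurentMonomial B.initialSeed.x (fun e => (n e : ℤ)) := fun n => by
      rw [← Subalgebra.coe_val, map_prod, laurentMonomial]
      refine Finset.prod_congr rfl fun e _ => ?_
      rw [map_pow, zpow_natCast]
      rfl
    have h2 := congrArg Subtype.val h1
    -- The column is non-zero by independence, so the two exchange monomials differ. They are then
    -- linearly independent, and both must be scaled by the same factor as x_i y_i.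
    have hne : (fun e => ((B.column i e).toNat : ℤ)) ≠ fun e => ((-B.column i e).toNat : ℤ) :=
      fun h => hB.ne_zero i (funext fun e => by
        have := congrFun h e
        simp only [Pi.zero_apply] at this ⊢
        omega)
    have h3 := hx.eq_zero_of_smul_laurentMonomial_add hne (by
      rw [← hmon, ← hmon]
      exact h2)
    have h4 : (∏ e, c e ^ (B.column i e).toNat) = ∏ e, c e ^ (-B.column i e).toNat :=
      Units.ext ((sub_eq_zero.1 h3.1).symm.trans (sub_eq_zero.1 h3.2))
    have h5 : ∏ e, c e ^ B.column i e = (∏ e, c e ^ (B.column i e).toNat) *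
        (∏ e, c e ^ (-B.column i e).toNat)⁻¹ := by
      rw [← Finset.prod_inv_distrib, ← Finset.prod_mul_distrib]
      refine Finset.prod_congr rfl fun e _ => ?_
      rw [← zpow_natCast, ← zpow_natCast, ← zpow_neg, ← zpow_add]
      congr 1
      omega
    rw [hc1, h5, h4, mul_inv_cancel]
    rfl
  · change _ = (((Fintype.linearCombination ℤ fun e => Additive.ofMul (c e))
      (Pi.single e 1)).toMul : ℂ) • _
    rw [hc, Fintype.linearCombination_apply_single, one_smul]
    rfl

end

end ExtendedExchangeMatrix

/-! ### Finite duality and the lattice spanned by columns and mutable unit vectors. -/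

/-- The group algebra of a finite abelian group is the algebra of functions on its dual. -/
lemma nonempty_addMonoidAlgebra_algEquiv_dual (Y : Type) [AddCommGroup Y] [Fintype Y] :
    Finite (Y →+ Additive ℂˣ) ∧
      Nonempty (AddMonoidAlgebra ℂ Y ≃ₐ[ℂ] ((Y →+ Additive ℂˣ) → ℂ)) := by
  let v : (Y →+ Additive ℂˣ) → (Multiplicative Y →* ℂ) := fun χ =>
    (Units.coeHom ℂ).comp (AddMonoidHom.toMultiplicativeLeft χ)
  have hv : Function.Injective v := fun χ ψ h => AddMonoidHom.ext fun y =>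
    Additive.toMul.injective (Units.ext (DFunLike.congr_fun h (Multiplicative.ofAdd y)))
  have hli := (linearIndependent_monoidHom (Multiplicative Y) ℂ).comp v hv
  have hfin : Finite (Y →+ Additive ℂˣ) := hli.finite_of_isNoetherian
  let _ := Fintype.ofFinite (Y →+ Additive ℂˣ)
  -- Independence of characters bounds the dual by the group; injectivity of `ev` gives the opposite
  -- inequality, so the dimensions agree.
  have hcard : Fintype.card (Y →+ Additive ℂˣ) ≤ Fintype.card Y := by
    have := hli.fintype_card_le_finrank
    rw [Module.finrank_fintype_fun_eq_card] at this
    exact this.trans_eq (Fintype.card_congr Multiplicative.toAdd)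
  let ev : AddMonoidAlgebra ℂ Y →ₐ[ℂ] ((Y →+ Additive ℂˣ) → ℂ) :=
    AlgHom.pi fun χ => AddMonoidAlgebra.liftUnits (A := ℂ) χ
  have hinj : Function.Injective ev := by
    rw [injective_iff_map_eq_zero]
    intro f hf
    exact AddMonoidAlgebra.eq_zero_of_forall_liftUnits fun χ => congrFun hf χ
  have hfd : Module.Finite ℂ (AddMonoidAlgebra ℂ Y) :=
    Module.Finite.equiv (AddMonoidAlgebra.coeffLinearEquiv ℂ).symm
  have hrank : Module.finrank ℂ (AddMonoidAlgebra ℂ Y) = Fintype.card Y := by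
    rw [(AddMonoidAlgebra.coeffLinearEquiv ℂ).finrank_eq, Module.finrank_finsupp_self]
  have hrank' : Module.finrank ℂ (AddMonoidAlgebra ℂ Y) =
      Module.finrank ℂ ((Y →+ Additive ℂˣ) → ℂ) := by
    refine le_antisymm (LinearMap.finrank_le_finrank_of_injective (f := ev.toLinearMap) hinj) ?_
    rw [hrank, Module.finrank_fintype_fun_eq_card]
    exact hcard
  exact ⟨hfin, ⟨AlgEquiv.ofBijective ev ⟨hinj,
    (LinearMap.injective_iff_surjective_of_finrank_eq_finrank (f := ev.toLinearMap) hrank').1 hinj⟩⟩⟩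

/-- A finitely generated abelian group is the product of a lattice and its torsion. -/
lemma nonempty_addEquiv_prod_torsion (X : Type) [AddCommGroup X] [Module.Finite ℤ X] :
    Nonempty (X ≃+ (Fin (Module.finrank ℤ X) → ℤ) × Submodule.torsion ℤ X) := by
  let T := Submodule.torsion ℤ X
  -- The quotient by the torsion is finitely generated and torsion-free, hence free, and the
  -- projection onto it splits.
  obtain ⟨f, hf⟩ := Module.projective_lifting_property T.mkQ LinearMap.id T.mkQ_surjective
  have e := lequivProdOfRightSplitExact T.subtype_injective (by simp) hf
  have hr : Module.finrank ℤ (X ⧸ T) = Module.finrank ℤ X :=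
    congrArg Cardinal.toNat (rank_quotient_eq_of_le_torsion le_rfl)
  let b := Module.finBasisOfFinrankEq ℤ (X ⧸ T) hr
  exact ⟨e.symm.toAddEquiv.trans (AddEquiv.prodComm.trans
    (b.equivFun.toAddEquiv.prodCongr (AddEquiv.refl _)))⟩

namespace ExtendedExchangeMatrix

variable {E N : Type} [Fintype E] [DecidableEq E] [Fintype N] {ι : N ↪ E}
  {B : ExtendedExchangeMatrix ι}

theorem autRegularFunctions_clusterAut (hB : LinearIndependent ℤ B.column)
    (hI : B.IsIndependent Finset.univ) :
    Nonempty (B.autRegularFunctions B.clusterAut ≃ₐ[ℂ]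
      AddMonoidAlgebra ℂ ((E → ℤ) ⧸ Submodule.span ℤ (Set.range B.column))) ∧
      Function.Bijective (B.autEval B.clusterAut) := by
  refine autRegularFunctions_of_scaling (fun φ hφ => ?_) (fun ζ hζ => ?_) (algEquiv_ext hI)
  · obtain ⟨ζ, hζ, hζx⟩ := exists_character_of_mem_clusterAut hB hφ
    refine ⟨ζ, ?_, hζx⟩
    rw [Submodule.span_le]
    rintro _ ⟨i, rfl⟩
    exact hζ i
  · exact exists_clusterAut hB hI ζ fun i => hζ (Submodule.subset_span ⟨i, rfl⟩)

theorem autRegularFunctions_mutableFixingAut (hB : LinearIndependent ℤ B.column)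
    (hI : B.IsIndependent Finset.univ) :
    Nonempty (B.autRegularFunctions B.mutableFixingAut ≃ₐ[ℂ]
      AddMonoidAlgebra ℂ ((E → ℤ) ⧸ B.fixingLattice)) ∧
      Function.Bijective (B.autEval B.mutableFixingAut) := by
  refine autRegularFunctions_of_scaling (fun φ hφ => ?_) (fun ζ hζ => ?_) (algEquiv_ext hI)
  · obtain ⟨ζ, hζ, hζx⟩ := exists_character_of_mem_clusterAut hB hφ.1
    refine ⟨ζ, ?_, hζx⟩
    rw [fixingLattice, Submodule.span_le]
    rintro _ (⟨i, rfl⟩ | ⟨i, rfl⟩)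
    · exact hζ i
    · refine Additive.toMul.injective (Units.ext (smul_left_injective ℂ
        (B.initialVariable_ne_zero (ι i)) ?_))
      refine ((hζx (ι i)).symm.trans (hφ.2 i)).trans ?_
      simp
  · obtain ⟨φ, hφ, hφx⟩ := exists_clusterAut hB hI ζ fun i =>
      hζ (Submodule.subset_span (Or.inl ⟨i, rfl⟩))
    refine ⟨φ, ⟨hφ, fun i => ?_⟩, hφx⟩
    have h1 : ζ (Pi.single (ι i) 1) = 0 := hζ (Submodule.subset_span (Or.inr ⟨i, rfl⟩))
    rw [hφx, h1, toMul_zero, Units.val_one, one_smul]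

variable (ι) in
open Classical in
/-- The projection that sets the mutable coordinates to zero. -/
def frozenProjection : (E → ℤ) →ₗ[ℤ] (E → ℤ) where
  toFun g e := if e ∈ Set.range ι then 0 else g e
  map_add' g h := by ext e; by_cases he : e ∈ Set.range ι <;> simp only [Pi.add_apply, he, if_true, if_false, add_zero]
  map_smul' c g := by ext e; by_cases he : e ∈ Set.range ι <;> simp only [Pi.smul_apply, he, if_true, if_false, smul_zero, RingHom.id_apply]

lemma frozenProjection_of_forall {g : E → ℤ} (hg : ∀ i, g (ι i) = 0) :
    frozenProjection ι g = g := by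
  funext e
  by_cases he : e ∈ Set.range ι
  · obtain ⟨i, rfl⟩ := he
    exact (if_pos ⟨i, rfl⟩).trans (hg i).symm
  · exact if_neg he

lemma frozenProjection_apply_mutable (g : E → ℤ) (i : N) : frozenProjection ι g (ι i) = 0 :=
  if_pos ⟨i, rfl⟩

lemma sum_single_mem_fixingLattice (u : N → ℤ) :
    ∑ i, Pi.single (ι i) (u i) ∈ B.fixingLattice := by
  refine sum_mem fun i _ => ?_
  have h1 : (Pi.single (ι i) (u i) : E → ℤ) = u i • Pi.single (ι i) 1 := by
    rw [← Pi.single_smul', smul_eq_mul, mul_one]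
  rw [h1]
  exact Submodule.smul_mem _ _ (Submodule.subset_span (Or.inr ⟨i, rfl⟩))

lemma sum_single_apply (u : N → ℤ) (j : N) :
    (∑ i, Pi.single (ι i) (u i) : E → ℤ) (ι j) = u j := by
  classical
  rw [Finset.sum_apply, Finset.sum_eq_single j]
  · simp
  · intro i _ hij
    exact Pi.single_eq_of_ne (fun h => hij (ι.injective h).symm) _
  · simp

lemma add_frozenProjection (g : E → ℤ) :
    ∑ i, Pi.single (ι i) (g (ι i)) + frozenProjection ι g = g := by
  funext e
  by_cases he : e ∈ Set.range ι
  · obtain ⟨i, rfl⟩ := he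
    rw [Pi.add_apply, sum_single_apply, frozenProjection_apply_mutable, add_zero]
  · rw [Pi.add_apply, Finset.sum_apply, Finset.sum_eq_zero, zero_add]
    · exact if_neg he
    · intro i _
      exact Pi.single_eq_of_ne (fun h => he ⟨i, h.symm⟩) _

lemma mkQ_frozenProjection (g : E → ℤ) :
    B.fixingLattice.mkQ (frozenProjection ι g) = B.fixingLattice.mkQ g := by
  conv_rhs => rw [← add_frozenProjection (ι := ι) g]
  rw [map_add, Submodule.mkQ_apply, Submodule.mkQ_apply,
    (Submodule.Quotient.mk_eq_zero _).2 (sum_single_mem_fixingLattice _), zero_add]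

/-- Projecting to the frozen coordinates fixes the columns and kills the unit vectors, so it maps
the lattice into the column span; it also fixes g. -/
lemma mem_span_column_of_mem_fixingLattice (hI : B.IsIndependent Finset.univ) {g : E → ℤ}
    (hg : g ∈ B.fixingLattice) (hg0 : ∀ i, g (ι i) = 0) :
    g ∈ Submodule.span ℤ (Set.range B.column) := by
  have h1 : B.fixingLattice ≤
      (Submodule.span ℤ (Set.range B.column)).comap (frozenProjection ι) := by
    rw [fixingLattice, Submodule.span_le]
    rintro _ (⟨i, rfl⟩ | ⟨i, rfl⟩)
    · change frozenProjection ι (B.column i) ∈ Submodule.span ℤ (Set.range B.column)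
      rw [frozenProjection_of_forall fun j => hI j (Finset.mem_univ _) i (Finset.mem_univ _)]
      exact Submodule.subset_span ⟨i, rfl⟩
    · change frozenProjection ι (Pi.single (ι i) 1) ∈ Submodule.span ℤ (Set.range B.column)
      have : frozenProjection ι (Pi.single (ι i) 1) = 0 := by
        funext e
        by_cases he : e ∈ Set.range ι
        · exact if_pos he
        · exact (if_neg he).trans (Pi.single_eq_of_ne (fun h => he ⟨i, h.symm⟩) _)
      rw [this]
      exact zero_mem _
  have h2 := h1 hg
  rwa [Submodule.mem_comap, frozenProjection_of_forall hg0] at h2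

lemma span_column_apply_mutable (hI : B.IsIndependent Finset.univ) {g : E → ℤ}
    (hg : g ∈ Submodule.span ℤ (Set.range B.column)) (i : N) : g (ι i) = 0 := by
  have : Submodule.span ℤ (Set.range B.column) ≤
      LinearMap.ker (LinearMap.proj (R := ℤ) (φ := fun _ : E => ℤ) (ι i)) := by
    rw [Submodule.span_le]
    rintro _ ⟨j, rfl⟩
    exact hI i (Finset.mem_univ _) j (Finset.mem_univ _)
  exact this hg

/-- The quotient by the columns is the product of the quotient by the fixing lattice and a
lattice. -/
lemma nonempty_quotient_span_column_addEquiv (hI : B.IsIndependent Finset.univ) :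
    Nonempty (((E → ℤ) ⧸ Submodule.span ℤ (Set.range B.column)) ≃+
      (N → ℤ) × ((E → ℤ) ⧸ B.fixingLattice)) := by
  let π : (E → ℤ) →ₗ[ℤ] (N → ℤ) × ((E → ℤ) ⧸ B.fixingLattice) :=
    (LinearMap.funLeft ℤ ℤ ι).prod B.fixingLattice.mkQ
  have hsurj : Function.Surjective π := by
    rintro ⟨u, y⟩
    obtain ⟨g, rfl⟩ := B.fixingLattice.mkQ_surjective y
    refine ⟨∑ i, Pi.single (ι i) (u i) + frozenProjection ι g, Prod.ext (funext fun j => ?_) ?_⟩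
    · change (∑ i, Pi.single (ι i) (u i) + frozenProjection ι g : E → ℤ) (ι j) = u j
      rw [Pi.add_apply, sum_single_apply, frozenProjection_apply_mutable, add_zero]
    · change B.fixingLattice.mkQ _ = _
      rw [map_add, mkQ_frozenProjection, Submodule.mkQ_apply,
        (Submodule.Quotient.mk_eq_zero _).2 (sum_single_mem_fixingLattice _), zero_add]
  -- A vector of the fixing lattice with vanishing mutable coordinates lies in the span of the
  -- columns, so nothing else is killed.
  have hker : Submodule.span ℤ (Set.range B.column) = LinearMap.ker π := by
    apply le_antisymm
    · rw [Submodule.span_le]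
      rintro _ ⟨i, rfl⟩
      exact gradingHom_column hI i
    · intro g hg
      have h1 : π g = 0 := hg
      exact mem_span_column_of_mem_fixingLattice hI
        ((Submodule.Quotient.mk_eq_zero _).1 (congrArg Prod.snd h1))
        fun i => congrFun (congrArg Prod.fst h1) i
  exact ⟨((Submodule.quotEquivOfEq _ _ hker).trans
    (π.quotKerEquivOfSurjective hsurj)).toAddEquiv⟩

lemma mem_columnLattice {g : E → ℤ} :
    g ∈ B.columnLattice ↔ g ∈ Submodule.span ℤ (Set.range B.column) := by
  change g ∈ B.mat.mulVecLin.range ↔ _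
  rw [Matrix.range_mulVecLin]
  rfl

/-- The integer d is a common denominator of the rational coefficients. This form matches membership
in a torsion subgroup. -/
lemma mem_saturatedLattice {g : E → ℤ} : g ∈ B.saturatedLattice ↔
    ∃ d : ℤ, d ≠ 0 ∧ d • g ∈ Submodule.span ℤ (Set.range B.column) := by
  constructor
  · rintro ⟨u, hu⟩
    obtain ⟨⟨d, hd⟩, hdu⟩ := IsLocalization.exist_integer_multiples_of_finite
      (nonZeroDivisors ℤ) u
    choose w hw using hdu
    refine ⟨d, nonZeroDivisors.ne_zero hd, (Submodule.mem_span_range_iff_exists_fun ℤ).2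
      ⟨w, funext fun e => ?_⟩⟩
    have h1 := congrFun hu e
    have h2 : ∀ i, (w i : ℚ) = d * u i := fun i => by
      have := hw i
      rw [Algebra.smul_def] at this
      simpa using this
    have h3 : (((∑ i, w i • B.column i) e : ℤ) : ℚ) = ((d • g) e : ℤ) := by
      simp only [Finset.sum_apply, Pi.smul_apply, smul_eq_mul, Int.cast_sum, Int.cast_mul, h2]
      rw [← h1, Matrix.mulVec, dotProduct, Finset.mul_sum]
      refine Finset.sum_congr rfl fun i _ => ?_
      simp only [Matrix.map_apply, column]
      ring
    exact_mod_cast h3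
  · rintro ⟨d, hd, hdg⟩
    obtain ⟨w, hw⟩ := (Submodule.mem_span_range_iff_exists_fun ℤ).1 hdg
    refine ⟨fun i => w i / d, funext fun e => ?_⟩
    have hd' : (d : ℚ) ≠ 0 := by exact_mod_cast hd
    have h1 := congrArg (Int.cast : ℤ → ℚ) (congrFun hw e)
    simp only [Finset.sum_apply, Pi.smul_apply, smul_eq_mul, Int.cast_sum, Int.cast_mul] at h1
    rw [← mul_right_inj' hd', ← h1, Matrix.mulVec, dotProduct, Finset.mul_sum]
    refine Finset.sum_congr rfl fun i _ => ?_
    simp only [Matrix.map_apply, column]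
    field_simp

/-- The group `X*` is the torsion subgroup of the quotient by the fixing lattice. -/
lemma nonempty_xStar_addEquiv (hI : B.IsIndependent Finset.univ) :
    Nonempty (B.XStar ≃+ Submodule.torsion ℤ ((E → ℤ) ⧸ B.fixingLattice)) := by
  let f : B.saturatedLattice →+ ((E → ℤ) ⧸ B.fixingLattice) :=
    B.fixingLattice.mkQ.toAddMonoidHom.comp B.saturatedLattice.subtype
  have hf : ∀ g, f g = B.fixingLattice.mkQ g.1 := fun _ => rfl
  have hle : Submodule.span ℤ (Set.range B.column) ≤ B.fixingLattice :=
    Submodule.span_mono Set.subset_union_left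
  have hker : B.columnLattice.addSubgroupOf B.saturatedLattice = f.ker := by
    ext g
    rw [AddSubgroup.mem_addSubgroupOf, mem_columnLattice, AddMonoidHom.mem_ker, hf,
      Submodule.mkQ_apply, Submodule.Quotient.mk_eq_zero]
    refine ⟨fun h => hle h, fun h => mem_span_column_of_mem_fixingLattice hI h fun i => ?_⟩
    obtain ⟨d, hd, hdg⟩ := mem_saturatedLattice.1 g.2
    have := span_column_apply_mutable hI hdg i
    rw [Pi.smul_apply, smul_eq_mul] at this
    exact (mul_eq_zero.1 this).resolve_left hd
  have hrange : f.range = (Submodule.torsion ℤ ((E → ℤ) ⧸ B.fixingLattice)).toAddSubgroup := by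
    ext y
    rw [Submodule.mem_toAddSubgroup, Submodule.mem_torsion_iff]
    constructor
    · rintro ⟨g, rfl⟩
      obtain ⟨d, hd, hdg⟩ := mem_saturatedLattice.1 g.2
      refine ⟨⟨d, mem_nonZeroDivisors_of_ne_zero hd⟩, ?_⟩
      change d • f g = 0
      rw [hf, ← map_smul]
      exact (Submodule.Quotient.mk_eq_zero _).2 (hle hdg)
    · rintro ⟨⟨d, hd⟩, hdy⟩
      obtain ⟨g, rfl⟩ := B.fixingLattice.mkQ_surjective y
      change d • B.fixingLattice.mkQ g = 0 at hdy
      -- A torsion class is represented by a vector with zero mutable coordinates. Its multiple in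
      -- the fixing lattice then already lies in the column span, so the representative is
      -- saturated.
      rw [← mkQ_frozenProjection, ← map_smul] at hdy
      refine ⟨⟨frozenProjection ι g, mem_saturatedLattice.2 ⟨d, nonZeroDivisors.ne_zero hd, ?_⟩⟩, ?_⟩
      · refine mem_span_column_of_mem_fixingLattice hI
          ((Submodule.Quotient.mk_eq_zero _).1 hdy) fun i => ?_
        rw [Pi.smul_apply, frozenProjection_apply_mutable, smul_zero]
      · exact mkQ_frozenProjection g
  exact ⟨(QuotientAddGroup.quotientAddEquivOfEq hker).trans
    ((QuotientAddGroup.quotientKerEquivRange f).trans (AddEquiv.addSubgroupCongr hrange))⟩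

lemma two_mul_card_le (hB : LinearIndependent ℤ B.column) (hI : B.IsIndependent Finset.univ) :
    2 * Fintype.card N ≤ Fintype.card E := by
  have h1 := (linearIndependent_column_single hB hI).fintype_card_le_finrank
  rw [Fintype.card_sum, Module.finrank_fintype_fun_eq_card] at h1
  omega

/-- The columns and the mutable unit vectors form a basis of the fixing lattice, whose rank is
therefore twice the number of mutable indices. -/
lemma finrank_quotient_fixingLattice (hB : LinearIndependent ℤ B.column)
    (hI : B.IsIndependent Finset.univ) :
    Module.finrank ℤ ((E → ℤ) ⧸ B.fixingLattice) = Fintype.card E - 2 * Fintype.card N := by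
  have h1 := B.fixingLattice.finrank_quotient_add_finrank
  have h2 := finrank_span_eq_card (linearIndependent_column_single hB hI)
  rw [Set.Sum.elim_range] at h2
  rw [fixingLattice] at h1 ⊢
  rw [h2, Fintype.card_sum, Module.finrank_fintype_fun_eq_card] at h1
  omega

/-- The group of mutable-fixing automorphisms is the product of a torus and the finite group
dual to `X*`. -/
theorem nonempty_addMonoidAlgebra_quotient_fixingLattice_algEquiv
    (hB : LinearIndependent ℤ B.column) (hI : B.IsIndependent Finset.univ) :
    Finite (B.XStar →+ Additive ℂˣ) ∧
      Nonempty (((E → ℤ) ⧸ B.fixingLattice) ≃+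
        (Fin (Fintype.card E - 2 * Fintype.card N) → ℤ) × B.XStar) ∧
      Nonempty (AddMonoidAlgebra ℂ B.XStar ≃ₐ[ℂ] ((B.XStar →+ Additive ℂˣ) → ℂ)) := by
  obtain ⟨e⟩ := nonempty_xStar_addEquiv hI
  obtain ⟨e'⟩ := nonempty_addEquiv_prod_torsion ((E → ℤ) ⧸ B.fixingLattice)
  rw [finrank_quotient_fixingLattice hB hI] at e'
  have hfin : Finite (Submodule.torsion ℤ ((E → ℤ) ⧸ B.fixingLattice)) :=
    Module.finite_of_fg_torsion _ Submodule.torsion_isTorsion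
  have hX : Finite B.XStar := Finite.of_equiv _ e.symm.toEquiv
  let _ := Fintype.ofFinite B.XStar
  obtain ⟨h1, h2⟩ := nonempty_addMonoidAlgebra_algEquiv_dual B.XStar
  exact ⟨h1, ⟨e'.trans ((AddEquiv.refl _).prodCongr e.symm)⟩, h2⟩

end ExtendedExchangeMatrix

/-! ### Assembling the isomorphisms of varieties. -/

/-- The variety of a product of two monoids is the product of the varieties. -/
lemma nonempty_affineVariety_addMonoidAlgebra_prod_iso (X Y : Type) [AddCommMonoid X]
    [AddCommMonoid Y] : Nonempty (affineVariety (AddMonoidAlgebra ℂ (X × Y)) ≅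
      affineVariety (AddMonoidAlgebra ℂ X) ⨯ affineVariety (AddMonoidAlgebra ℂ Y)) :=
  ⟨(nonempty_affineVariety_iso (AddMonoidAlgebra.prodAlgEquivTensor X Y)).some ≪≫
    (nonempty_affineVariety_prod_iso _ _).some.symm⟩

lemma nonempty_affineVariety_addMonoidAlgebra_iso {X Y : Type} [AddCommMonoid X] [AddCommMonoid Y]
    (e : X ≃+ Y) : Nonempty (affineVariety (AddMonoidAlgebra ℂ X) ≅
      affineVariety (AddMonoidAlgebra ℂ Y)) :=
  nonempty_affineVariety_iso (AddMonoidAlgebra.domCongr ℂ ℂ e)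

namespace ExtendedExchangeMatrix

variable {E N : Type} [Fintype E] [Fintype N] {ι : N ↪ E} {B : ExtendedExchangeMatrix ι}

lemma IsFullRank.linearIndependent_column (h : B.IsFullRank) : LinearIndependent ℤ B.column := by
  have h1 : LinearIndependent ℚ (B.mat.map (Int.cast : ℤ → ℚ)).col := by
    rw [linearIndependent_iff_card_eq_finrank_span, Set.finrank, ← Matrix.rank_eq_finrank_span_cols]
    exact h.symm
  rw [Fintype.linearIndependent_iff] at h1 ⊢
  intro w hw i
  have h2 := h1 (fun i => (w i : ℚ)) (funext fun e => by
    have h3 := congrArg (Int.cast : ℤ → ℚ) (congrFun hw e)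
    simp only [Finset.sum_apply, Pi.smul_apply, smul_eq_mul, Int.cast_sum, Int.cast_mul,
      Pi.zero_apply, Int.cast_zero] at h3
    simp only [Finset.sum_apply, Pi.smul_apply, smul_eq_mul, Pi.zero_apply]
    exact h3) i
  exact_mod_cast h2

/-- The absence of arrows in both directions makes both entries non-positive, and skew-symmetry then
makes them zero. -/
lemma isIndependent_of_isIndepSet {I : Finset N}
    (hI : B.undirectedGraph.IsIndepSet (I : Set N)) : B.IsIndependent I := by
  intro i hi j hj
  have hij := B.skew i j
  change B.mat (ι i) j = 0
  by_cases h : i = j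
  · subst h
    omega
  · have h1 := hI hi hj h
    rw [undirectedGraph, SimpleGraph.fromRel_adj, Arrow, Arrow] at h1
    push Not at h1
    have := h1 h
    omega

section Independent

variable [DecidableEq E] [DecidableEq N]

lemma nonempty_autVariety_mutableFixingAut_iso (hB : LinearIndependent ℤ B.column)
    (hI : B.IsIndependent Finset.univ) : Nonempty (B.autVariety B.mutableFixingAut ≅
      affineVariety (AddMonoidAlgebra ℂ ((E → ℤ) ⧸ B.fixingLattice))) :=
  nonempty_affineVariety_iso (autRegularFunctions_mutableFixingAut hB hI).1.some

lemma nonempty_autVariety_clusterAut_iso (hB : LinearIndependent ℤ B.column)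
    (hI : B.IsIndependent Finset.univ) {k : ℕ} (hk : Fintype.card N = k) :
    Nonempty (B.autVariety B.clusterAut ≅ torusVariety k ⨯ B.autVariety B.mutableFixingAut) := by
  obtain ⟨e⟩ := nonempty_quotient_span_column_addEquiv hI
  let e' : (N → ℤ) ≃+ (Fin k → ℤ) :=
    (LinearEquiv.funCongrLeft ℤ ℤ (Fintype.equivFinOfCardEq hk).symm).toAddEquiv
  exact ⟨(nonempty_affineVariety_iso (autRegularFunctions_clusterAut hB hI).1.some).some ≪≫
    (nonempty_affineVariety_addMonoidAlgebra_iso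
      (e.trans (e'.prodCongr (AddEquiv.refl _)))).some ≪≫
    (nonempty_affineVariety_addMonoidAlgebra_prod_iso _ _).some ≪≫
    prod.mapIso (Iso.refl _) (nonempty_autVariety_mutableFixingAut_iso hB hI).some.symm⟩

lemma nonempty_quotient_mutableIdeal_iso (hB : LinearIndependent ℤ B.column)
    (hI : B.IsIndependent Finset.univ) {k : ℕ} (hk : Fintype.card N = k) :
    Nonempty (affineVariety (B.clusterAlgebra ⧸ B.mutableIdeal) ≅
      affineSpaceVariety k ⨯ B.autVariety B.mutableFixingAut) := by
  let e' : (N →₀ ℕ) ≃+ (Fin k →₀ ℕ) := Finsupp.domCongr (Fintype.equivFinOfCardEq hk)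
  exact ⟨(nonempty_affineVariety_iso
      (nonempty_quotient_mutableIdeal_algEquiv hB hI).some).some ≪≫
    (nonempty_affineVariety_addMonoidAlgebra_iso (e'.prodCongr (AddEquiv.refl _))).some ≪≫
    (nonempty_affineVariety_addMonoidAlgebra_prod_iso _ _).some ≪≫
    prod.mapIso (nonempty_affineSpaceVariety_iso k).some.symm
      (nonempty_autVariety_mutableFixingAut_iso hB hI).some.symm⟩

lemma nonempty_autVariety_mutableFixingAut_iso_prod (hB : LinearIndependent ℤ B.column)
    (hI : B.IsIndependent Finset.univ) : Nonempty (B.autVariety B.mutableFixingAut ≅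
      torusVariety (Fintype.card E - 2 * Fintype.card N) ⨯
        finiteVariety (B.XStar →+ Additive ℂˣ)) := by
  obtain ⟨-, ⟨e⟩, ⟨e'⟩⟩ := nonempty_addMonoidAlgebra_quotient_fixingLattice_algEquiv hB hI
  exact ⟨(nonempty_autVariety_mutableFixingAut_iso hB hI).some ≪≫
    (nonempty_affineVariety_addMonoidAlgebra_iso e).some ≪≫
    (nonempty_affineVariety_addMonoidAlgebra_prod_iso _ _).some ≪≫
    prod.mapIso (Iso.refl _) (nonempty_affineVariety_iso e').some⟩

end Independent

end ExtendedExchangeMatrix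

end

theorem mainTheorem11 (n m k : ℕ)
    (B : ExtendedExchangeMatrix (Fin.castAddEmb m : Fin n ↪ Fin (n + m)))
    (hacyclic : B.IsAcyclic) (hrank : B.IsFullRank)
    (I : Finset (Fin n)) (hI : B.undirectedGraph.IsIndepSet (I : Set (Fin n)))
    (hk : I.card = k) :
    2 * k ≤ n + m ∧
    Function.Bijective ((B.restrict I).autEval (B.restrict I).clusterAut) ∧
    Function.Bijective ((B.restrict I).autEval (B.restrict I).mutableFixingAut) ∧
    Nonempty (torusVariety k ⨯ B.stratum I ≅
      affineSpaceVariety k ⨯ (B.restrict I).autVariety (B.restrict I).clusterAut) ∧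
    Nonempty (B.stratum I ≅
      affineSpaceVariety k ⨯ (B.restrict I).autVariety (B.restrict I).mutableFixingAut) ∧
    ∃ (C : Type) (_ : Finite C) (_ : AddTorsor ((B.restrict I).XStar →+ Additive ℂˣ) C),
      Nonempty (affineSpaceVariety k ⨯ (B.restrict I).autVariety (B.restrict I).mutableFixingAut ≅
        affineSpaceVariety k ⨯ (torusVariety (n + m - 2 * k) ⨯ finiteVariety C)) := by
  have hB := hrank.linearIndependent_column
  have hB' : LinearIndependent ℤ (B.restrict I).column := hB.comp _ Subtype.val_injective
  have hI' := ExtendedExchangeMatrix.isIndependent_of_isIndepSet hI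
  have hD := ExtendedExchangeMatrix.isIndependent_restrict hI'
  have hcard : Fintype.card {i // i ∈ I} = k := (Fintype.card_coe I).trans hk
  obtain ⟨e1⟩ := ExtendedExchangeMatrix.nonempty_stratumRing_algEquiv hB hI'
  obtain ⟨e2⟩ := nonempty_affineVariety_iso (R := B.StratumRing I)
    (S := (B.restrict I).clusterAlgebra ⧸ (B.restrict I).mutableIdeal) e1
  obtain ⟨e3⟩ := ExtendedExchangeMatrix.nonempty_quotient_mutableIdeal_iso hB' hD hcard
  obtain ⟨e4⟩ := ExtendedExchangeMatrix.nonempty_autVariety_clusterAut_iso hB' hD hcard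
  have hle := ExtendedExchangeMatrix.two_mul_card_le hB' hD
  obtain ⟨e5⟩ := ExtendedExchangeMatrix.nonempty_autVariety_mutableFixingAut_iso_prod hB' hD
  rw [hcard, Fintype.card_fin] at hle e5
  -- The torsor is the dual group of X* acting on itself.
  refine ⟨hle, (ExtendedExchangeMatrix.autRegularFunctions_clusterAut hB' hD).2,
    (ExtendedExchangeMatrix.autRegularFunctions_mutableFixingAut hB' hD).2, ⟨?_⟩, ⟨e2 ≪≫ e3⟩,
    _, (ExtendedExchangeMatrix.nonempty_addMonoidAlgebra_quotient_fixingLattice_algEquiv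
      hB' hD).1, inferInstance, ⟨prod.mapIso (Iso.refl _) e5⟩⟩
  -- The full automorphism group is the fixing subgroup times a torus of dimension k, so only the
  -- affine space and the torus change places.
  exact prod.mapIso (Iso.refl _) (e2 ≪≫ e3) ≪≫ (Limits.prod.associator _ _ _).symm ≪≫
    prod.mapIso (Limits.prod.braiding _ _) (Iso.refl _) ≪≫ Limits.prod.associator _ _ _ ≪≫
    prod.mapIso (Iso.refl _) e4.symm
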